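/- Let $n\ge 1$, let $Q$ be a real symmetric positive definite $n\times n$ matrix and $B$ a real $n\times n$ matrix all of whose eigenvalues have negative real parts. For $0<t\le\infty$ put $Q_t=\int_0^t e^{sB}Qe^{sB^*}\,ds$, and let $R(x)=\frac12\langle Q_\infty^{-1}x,x\rangle$, $D_t=Q_\infty e^{-tB^*}Q_\infty^{-1}$, $$d\gamma_\infty(x)=(2\pi)^{-n/2}(\det Q_\infty)^{-1/2}e^{-R(x)}\,dx,$$ $$K_t(x,u)=\Big(\frac{\det Q_\infty}{\det Q_t}\Big)^{1/2}e^{R(x)}\exp\Big[-\tfrac12\big\langle (Q_t^{-1}-Q_\infty^{-1})(u-D_tx),\,u-D_tx\big\rangle\Big],\qquad t>0,\ x,u\in\mathbb R^n,$$ the latter being the kernel, with respect to $\gamma_\infty$, of the Ornstein–Uhlenbeck semigroup generated by $\frac12\mathrm{tr}(Q\nabla^2)+\langle Bx,\nabla\rangle$. Let $R_j=\{x\in\mathbb R^n: j\le R(x)\le j+1\}$ for integers $j\ge0$ and $R_j=\emptyset$ for $j<0$. Let $(r_j)_{j\ge0}$ be smooth non-negative functions on $\mathbb R^n$ with $\sum_{j\ge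 0} r_j=1$ everywhere and $\operatorname{supp} r_j\subseteq R_j\cup R_{j+1}$, and let $(\widetilde r_j)_{j\ge0}$ be smooth functions with values in $[0,1]$, with $\widetilde r_j=1$ on $\bigcup_{\nu=j-1}^{j+2}R_\nu$ and $\operatorname{supp}\widetilde r_j\subseteq\bigcup_{\nu=j-2}^{j+3}R_\nu$; assume also that $|\nabla r_j(x)|+|\nabla\widetilde r_j(x)|\le c\,(1+|x|)$ for all $j$ and $x$, with some constant $c$. Put $\eta(x,u)=\sum_{j\ge 0}\widetilde r_j(x)\,r_j(u)$ and $$\mathcal H_t^{\mathrm{glob}}f(x)=\int_{\mathbb R^n}K_t(x,u)\,(1-\eta(x,u))\,f(u)\,d\gamma_\infty(u).$$ For $\varrho\ge1$ and $\phi:(0,1]\to\mathbb R$ let $$\|\phi\|_{v(\varrho),(0,1]}=\sup\Big(\sum_{i=1}^N|\phi(t_i)-\phi(t_{i-1})|^\varrho\Big)^{1/\varrho}\in[0,\infty],$$ the supremum being taken over all finite increasing sequences $(t_i)_0^N$ in $(0,1]$. Then for every real-valued $f\in L^1(\gamma_\infty)$ the integral defining $\mathcal H_t^{\mathrm{glob}}f(x)$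 converges absolutely for all $t\in(0,1]$ and $x\in\mathbb R^n$, and for each $\varrho\ge1$ the operator mapping $f$ to the function $x\mapsto\|\mathcal H_t^{\mathrm{glob}}f(x)\|_{v(\varrho),(0,1]}$ (the seminorm being taken in the variable $t$) is of weak type $(1,1)$ with respect to $\gamma_\infty$: there is a constant $C>0$ depending only on $n$, $Q$ and $B$ such that $$\gamma_\infty\big\{x\in\mathbb R^n:\ \|\mathcal H_t^{\mathrm{glob}}f(x)\|_{v(\varrho),(0,1]}>\alpha\big\}\le\frac C\alpha\,\|f\|_{L^1(\gamma_\infty)}$$ for all $\varrho\ge1$, all $\alpha>0$, all $f\in L^1(\gamma_\infty)$, and all functions $r_j,\widetilde r_j$ as above. -/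

import Mathlib

open MeasureTheory Set
open scoped ENNReal ContDiff Matrix

noncomputable section

namespace OrnsteinUhlenbeck

variable {n : ℕ}

/-- The integrand `e^{sB} Q e^{sB*}` of the covariance matrices. -/
def covIntegrand (Q B : Matrix (Fin n) (Fin n) ℝ) (s : ℝ) : Matrix (Fin n) (Fin n) ℝ :=
  NormedSpace.exp (s • B) * Q * NormedSpace.exp (s • Bᵀ)

/-- `Q_t = ∫_0^t e^{sB} Q e^{sB*} ds` for finite `t`, integrated entrywise. -/
def covMatrix (Q B : Matrix (Fin n) (Fin n) ℝ) (t : ℝ) : Matrix (Fin n) (Fin n) ℝ :=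
  Matrix.of fun i j => ∫ s in (0 : ℝ)..t, covIntegrand Q B s i j

/-- `Q_∞ = ∫_0^∞ e^{sB} Q e^{sB*} ds`, integrated entrywise. -/
def covMatrixInfty (Q B : Matrix (Fin n) (Fin n) ℝ) : Matrix (Fin n) (Fin n) ℝ :=
  Matrix.of fun i j => ∫ s in Ioi (0 : ℝ), covIntegrand Q B s i j

/-- The quadratic expression `⟨M v, v⟩`. -/
def quadForm (M : Matrix (Fin n) (Fin n) ℝ) (v : EuclideanSpace ℝ (Fin n)) : ℝ :=
  inner ℝ (Matrix.toEuclideanLin M v) v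

/-- `R(x) = ½ ⟨Q_∞⁻¹ x, x⟩`. -/
def R (Q B : Matrix (Fin n) (Fin n) ℝ) (x : EuclideanSpace ℝ (Fin n)) : ℝ :=
  1 / 2 * quadForm (covMatrixInfty Q B)⁻¹ x

/-- The normalized Gaussian measure `γ_∞`, with density
`(2π)^{-n/2} (det Q_∞)^{-1/2} exp(-½ ⟨Q_∞⁻¹ x, x⟩)` with respect to Lebesgue measure. -/
def gammaInfty (Q B : Matrix (Fin n) (Fin n) ℝ) : Measure (EuclideanSpace ℝ (Fin n)) :=
  volume.withDensity fun x => ENNReal.ofReal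
    ((2 * Real.pi) ^ (-(n : ℝ) / 2) * (covMatrixInfty Q B).det ^ (-(1 : ℝ) / 2) *
      Real.exp (-(1 / 2) * quadForm (covMatrixInfty Q B)⁻¹ x))

/-- `D_t = Q_∞ e^{-tB*} Q_∞⁻¹`. -/
def flow (Q B : Matrix (Fin n) (Fin n) ℝ) (t : ℝ) : Matrix (Fin n) (Fin n) ℝ :=
  covMatrixInfty Q B * NormedSpace.exp ((-t) • Bᵀ) * (covMatrixInfty Q B)⁻¹

/-- The Mehler kernel `K_t(x,u)`, the kernel of the Ornstein–Uhlenbeck semigroup with respect to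
`γ_∞`. -/
def mehlerKernel (Q B : Matrix (Fin n) (Fin n) ℝ) (t : ℝ) (x u : EuclideanSpace ℝ (Fin n)) : ℝ :=
  ((covMatrixInfty Q B).det / (covMatrix Q B t).det) ^ ((1 : ℝ) / 2) * Real.exp (R Q B x) *
    Real.exp (-(1 / 2) * quadForm ((covMatrix Q B t)⁻¹ - (covMatrixInfty Q B)⁻¹)
      (u - Matrix.toEuclideanLin (flow Q B t) x))

/-- The elliptic ring `R_j = {x : j ≤ R(x) ≤ j + 1}` for `j ≥ 0`; `R_j = ∅` for `j < 0`. -/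
def ring (Q B : Matrix (Fin n) (Fin n) ℝ) (j : ℤ) : Set (EuclideanSpace ℝ (Fin n)) :=
  {x | 0 ≤ j ∧ (j : ℝ) ≤ R Q B x ∧ R Q B x ≤ (j : ℝ) + 1}

/-- The admissible choices of the smooth partition of unity `r_j` subordinate to the rings, and
of the slightly larger cut-off functions `r̃_j` (here `r'`). -/
structure IsRingCutoffs (Q B : Matrix (Fin n) (Fin n) ℝ)
    (r r' : ℕ → EuclideanSpace ℝ (Fin n) → ℝ) : Prop where
  smooth : ∀ j, ContDiff ℝ ∞ (r j)
  nonneg : ∀ j x, 0 ≤ r j x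
  hasSum_one : ∀ x, HasSum (fun j => r j x) 1
  tsupport_subset : ∀ j : ℕ, tsupport (r j) ⊆ ring Q B j ∪ ring Q B (j + 1)
  gradient_le : ∃ c : ℝ, ∀ j x, ‖gradient (r j) x‖ ≤ c * (1 + ‖x‖)
  smooth' : ∀ j, ContDiff ℝ ∞ (r' j)
  mem_Icc' : ∀ j x, r' j x ∈ Icc (0 : ℝ) 1
  eq_one' : ∀ j : ℕ, ∀ ν ∈ Icc ((j : ℤ) - 1) (j + 2), ∀ x ∈ ring Q B ν, r' j x = 1
  tsupport_subset' : ∀ j : ℕ, tsupport (r' j) ⊆ ⋃ ν ∈ Icc ((j : ℤ) - 2) (j + 3), ring Q B ν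
  gradient_le' : ∃ c : ℝ, ∀ j x, ‖gradient (r' j) x‖ ≤ c * (1 + ‖x‖)

/-- `η(x,u) = ∑_j r̃_j(x) r_j(u)`. -/
def eta (r r' : ℕ → EuclideanSpace ℝ (Fin n) → ℝ) (x u : EuclideanSpace ℝ (Fin n)) : ℝ :=
  ∑' j, r' j x * r j u

/-- The global part `𝓗_t^glob f(x) = ∫ K_t(x,u) (1 - η(x,u)) f(u) dγ_∞(u)`. -/
def globalPart (Q B : Matrix (Fin n) (Fin n) ℝ) (r r' : ℕ → EuclideanSpace ℝ (Fin n) → ℝ)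
    (t : ℝ) (f : EuclideanSpace ℝ (Fin n) → ℝ) (x : EuclideanSpace ℝ (Fin n)) : ℝ :=
  ∫ u, mehlerKernel Q B t x u * (1 - eta r r' x u) * f u ∂(gammaInfty Q B)

/-- The variation seminorm `‖φ‖_{v(ϱ), I}` with values in `[0,∞]`: the supremum of
`(∑_{i=1}^N |φ(t_i) - φ(t_{i-1})|^ϱ)^{1/ϱ}` over finite increasing sequences `t_0, …, t_N` in `I`.
As in Mathlib's `eVariationOn`, repetitions are allowed; they contribute nothing to the sum. -/
def variation (ϱ : ℝ) (I : Set ℝ) (φ : ℝ → ℝ) : ℝ≥0∞ :=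
  ⨆ p : ℕ × {t : ℕ → ℝ // Monotone t ∧ ∀ i, t i ∈ I},
    (∑ i ∈ Finset.range p.1,
      ENNReal.ofReal |φ (p.2.1 (i + 1)) - φ (p.2.1 i)| ^ ϱ) ^ (1 / ϱ)

end OrnsteinUhlenbeck

end

/-!
Since `v(ϱ) ≤ v(1)` for `ϱ ≥ 1`, and the total variation over `(0, 1]` is at most
`∫₀¹ |∂_t 𝓗_t^glob f(x)| dt`, it is enough to bound a positive operator whose kernel is the time
integral of a bound for `|∂_t K_t(x, u)|`. The cut-off `1 - η(x, u)` is between `0` and `1` and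
vanishes when `|R x - R u| < 1`, so it may be replaced by the indicator of `|R x - R u| ≥ 1`.

*The kernel.* As `Q_t` is comparable with `t`, one has `Q_t⁻¹ - Q_∞⁻¹ ≥ a / t`, and
differentiating the formula for `K_t` gives (`exists_abs_deriv_mehlerKernel_le`)
`|∂_t K_t(x, u)| ≤ A e^{R x} t^{-n/2} (1/t + (1 + |x|)/√t) exp(-a |u - D_t x|² / t)`.

*Expanding flows.* What is needed about the flow `D_t` is collected in `IsExpandingFlow`: it is a
one-parameter family of linear maps along which `R` grows at the rate `|x|²`. For `D_t = Q_∞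
e^{-tB*} Q_∞⁻¹` the growth follows from `Q_∞ = Q_t + e^{tB} Q_∞ e^{tB*}`, and that every
orbit finally reaches much higher levels from the exponential decay of `e^{tB}`, which is Gelfand's
formula for `e^B`.

*The integrated kernel.* If `|R x - R u| ≥ 1` then for small `t` the point `D_t x` is far from
`u`, `|u - D_t x|² / t ≥ κ / (t (1 + |x|)²) - K` (`exists_separation`), so that the time integral
converges. Let `b` be the distance from `u` to the orbit of `y`. Because `R` grows along orbits,
`u` stays at distance at least `c |y| |s - τ|` from `D_s y` for some `τ`
(`exists_orbit_transversal`), and a Gaussian integration in `√t` bounds the kernel at `(D_s y, u)`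
by `A (b + 1/|y|)^{-n}`, uniformly in `s` (`exists_totalKernel_le_orbitDist`). Two points of a thin
shell `β ≤ R ≤ β + 1` with orbits close to `u` are close to each other, and a ball of radius `r`
meets the shell in volume at most `C r^{n-1} / √β`; summing over dyadic layers, the integral of
`(b + 1/|y|)^{-n}` over the shell is bounded by a constant (`exists_lintegral_orbitDist_le`).

*The weak type estimate* (`IsExpandingFlow.exists_weak_type`). Let `L = α / ‖f‖₁`. On the level
set, for large `L`, a crude polynomial bound for the kernel excludes `R < ½ log L = β + 1`, and
`{R > 8 β}` has measure at most `C / L`. Every remaining point lies on the orbit of a point `y` of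
the shell at `β`; averaging along the flow turns the measure of the level set into an integral
over the shell of `∫ e^{-R (D_s y)} ds` over the times at which `D_s y` is in the level set. As
`R (D_s y)` grows at the rate `β`, that integral is comparable with the value of `e^{-R} / β` at
the first such time, hence by the definition of the level set with `(αβ)⁻¹` times the operator with
kernel `(b + 1/|y|)^{-n}` applied to `|f|`, whose integral over the shell has just been bounded.
-/

noncomputable section

namespace OrnsteinUhlenbeck

/-! ### Elementary estimates -/

theorem exists_pow_mul_exp_neg_sq_le (m : ℕ) {a : ℝ} (ha : 0 < a) :
    ∃ A : ℝ, 0 < A ∧ ∀ z : ℝ, 0 ≤ z → z ^ m * Real.exp (-a * z ^ 2) ≤ A := by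
  -- `(a z²)^m / m! ≤ exp (a z²)`, and `z ^ m ≤ 1 + (z²)^m`
  refine ⟨1 + (m.factorial : ℝ) / a ^ m, by positivity, fun z hz => ?_⟩
  have h1 := Real.pow_div_factorial_le_exp (a * z ^ 2) (by positivity) m
  have hE : 0 < Real.exp (a * z ^ 2) := Real.exp_pos _
  have h2 : z ^ m ≤ 1 + (z ^ 2) ^ m := by
    rcases le_total z 1 with h | h
    · have := pow_le_one₀ (n := m) hz h
      have : 0 ≤ (z ^ 2) ^ m := by positivity
      linarith
    · have : z ^ m ≤ (z ^ 2) ^ m := by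
        gcongr
        nlinarith
      linarith
  have h3 : (z ^ 2) ^ m ≤ (m.factorial : ℝ) / a ^ m * Real.exp (a * z ^ 2) := by
    rw [div_le_iff₀ (by positivity), mul_pow] at h1
    rw [div_mul_eq_mul_div, le_div_iff₀ (by positivity)]
    linarith
  have h4 : 1 ≤ Real.exp (a * z ^ 2) := Real.one_le_exp (by positivity)
  rw [neg_mul, Real.exp_neg, ← div_eq_mul_inv, div_le_iff₀ hE]
  linarith

/-- With `k = √(-θ)`, which is `0` for `θ ≥ 0`, the exponent `(t + θ)² / t` is at least
`(√t - k)²`. -/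
theorem sub_sq_le_add_sq_div {t θ : ℝ} (ht : 0 < t) :
    (Real.sqrt t - Real.sqrt (-θ)) ^ 2 ≤ (t + θ) ^ 2 / t := by
  rw [le_div_iff₀ ht]
  have hw := Real.sqrt_pos.2 ht
  have hwt := Real.sq_sqrt ht.le
  rcases le_total θ 0 with h | h
  · have hk := Real.sqrt_nonneg (-θ)
    have hkt := Real.sq_sqrt (by linarith : 0 ≤ -θ)
    set w := Real.sqrt t
    set k := Real.sqrt (-θ)
    have : t + θ = (w - k) * (w + k) := by linear_combination -hwt + hkt
    rw [this, mul_pow, ← hwt]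
    gcongr
    linarith
  · rw [Real.sqrt_eq_zero_of_nonpos (by linarith : -θ ≤ 0), sub_zero, hwt]
    nlinarith

theorem lintegral_gaussian_sub {a : ℝ} (ha : 0 < a) (k : ℝ) :
    ∫⁻ w : ℝ, ENNReal.ofReal (Real.exp (-a * (w - k) ^ 2)) =
      ENNReal.ofReal (Real.sqrt (Real.pi / a)) := by
  rw [lintegral_sub_right_eq_self (fun w => ENNReal.ofReal (Real.exp (-a * w ^ 2))) k,
    ← integral_gaussian a, ofReal_integral_eq_lintegral_ofReal (integrable_exp_neg_mul_sq ha)]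
  exact Filter.Eventually.of_forall fun _ => (Real.exp_pos _).le

/-- The substitution `t = w²` turns this into a translated Gaussian integral. -/
theorem lintegral_sqrt_gaussian_le {a ρ : ℝ} (ha : 0 < a) (hρ : 0 < ρ) (k : ℝ) :
    ∫⁻ t in Ioc (0 : ℝ) 1,
      ENNReal.ofReal (ρ / Real.sqrt t * Real.exp (-a * ρ ^ 2 * (Real.sqrt t - k) ^ 2)) ≤
      ENNReal.ofReal (2 * Real.sqrt (Real.pi / a)) := by
  have himg : (fun w : ℝ => w ^ 2) '' Ioc 0 1 = Ioc 0 1 := by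
    ext t
    constructor
    · rintro ⟨w, ⟨h0, h1⟩, rfl⟩
      exact ⟨by positivity, by simpa using pow_le_one₀ (n := 2) h0.le h1⟩
    · rintro ⟨h0, h1⟩
      exact ⟨Real.sqrt t, ⟨Real.sqrt_pos.2 h0, Real.sqrt_le_one.2 h1⟩, Real.sq_sqrt h0.le⟩
  have hinj : InjOn (fun w : ℝ => w ^ 2) (Ioc 0 1) := fun x hx y hy h =>
    (pow_left_inj₀ hx.1.le hy.1.le two_ne_zero).1 h
  rw [← himg, lintegral_image_eq_lintegral_abs_deriv_mul (f' := fun w => 2 * w) measurableSet_Ioc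
    (fun w _ => by simpa using (hasDerivAt_pow 2 w).hasDerivWithinAt) hinj]
  calc _ ≤ ∫⁻ w in Ioc (0 : ℝ) 1, ENNReal.ofReal (2 * ρ) *
        ENNReal.ofReal (Real.exp (-(a * ρ ^ 2) * (w - k) ^ 2)) := by
        refine setLIntegral_mono' measurableSet_Ioc fun w hw => le_of_eq ?_
        rw [Real.sqrt_sq hw.1.le, abs_of_pos (by linarith [hw.1]),
          ← ENNReal.ofReal_mul (by linarith [hw.1]), ← ENNReal.ofReal_mul (by positivity)]
        congr 1
        have := hw.1.ne'
        field_simp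
    _ ≤ ∫⁻ w : ℝ, ENNReal.ofReal (2 * ρ) *
        ENNReal.ofReal (Real.exp (-(a * ρ ^ 2) * (w - k) ^ 2)) := setLIntegral_le_lintegral _ _
    _ = _ := by
        rw [lintegral_const_mul' _ _ ENNReal.ofReal_ne_top, lintegral_gaussian_sub (by positivity),
          ← ENNReal.ofReal_mul (by positivity), ← div_div, Real.sqrt_div (by positivity),
          Real.sqrt_sq hρ.le]
        congr 1
        field_simp

/-! ### Expanding linear flows -/

section Flow

variable {E : Type*} [NormedAddCommGroup E] [NormedSpace ℝ E]

/-- A one-parameter group `D` of linear maps which, for times in `[-T, T]`, expands the level sets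
of a function `R` of quadratic growth at the rate `‖x‖²`. The time `T - 2` is long enough for `R`
to grow by the factor `8` along every orbit. -/
structure IsExpandingFlow (R : E → ℝ) (D : ℝ → E →L[ℝ] E) (T c C : ℝ) : Prop where
  two_le : 2 ≤ T
  c_pos : 0 < c
  one_le : 1 ≤ C
  flow_zero : ∀ x, D 0 x = x
  flow_add : ∀ s t x, D (s + t) x = D s (D t x)
  continuous_flow : Continuous fun p : ℝ × E => D p.1 p.2
  continuous_R : Continuous R
  le_R : ∀ x, c * ‖x‖ ^ 2 ≤ R x
  R_le : ∀ x, R x ≤ C * ‖x‖ ^ 2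
  abs_R_sub_le : ∀ x y, |R x - R y| ≤ C * ‖x - y‖ * (‖x‖ + ‖y‖)
  growth : ∀ s t x, -T ≤ s → s ≤ t → t ≤ T → c * (t - s) * ‖x‖ ^ 2 ≤ R (D t x) - R (D s x)
  norm_flow_sub_le : ∀ s ∈ Icc (-T) T, ∀ t ∈ Icc (-T) T, ∀ x,
    ‖D t x - D s x‖ ≤ C * |t - s| * ‖x‖
  norm_flow_le : ∀ t ∈ Icc (-T) T, ∀ x, ‖D t x‖ ≤ C * ‖x‖
  abs_det_le : ∀ t ∈ Icc (-T) T, |LinearMap.det (D t : E →ₗ[ℝ] E)| ≤ C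
  escape : ∀ x, 8 * R x ≤ R (D (T - 2) x)

namespace IsExpandingFlow

variable {R : E → ℝ} {D : ℝ → E →L[ℝ] E} {T c C : ℝ}

theorem flow_neg_flow (h : IsExpandingFlow R D T c C) (t : ℝ) (x : E) : D (-t) (D t x) = x := by
  rw [← h.flow_add, neg_add_cancel, h.flow_zero]

theorem flow_flow_neg (h : IsExpandingFlow R D T c C) (t : ℝ) (x : E) : D t (D (-t) x) = x := by
  rw [← h.flow_add, add_neg_cancel, h.flow_zero]

theorem C_pos (h : IsExpandingFlow R D T c C) : 0 < C := one_pos.trans_le h.one_le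

/-- If the levels of `x` and `u` differ by at least one, then the orbit of `x` needs a time of
order `(1 + ‖x‖)⁻²` to come close to `u`. -/
theorem exists_separation (h : IsExpandingFlow R D T c C) :
    ∃ κ K : ℝ, 0 < κ ∧ 0 < K ∧ ∀ x u : E, 1 ≤ |R x - R u| → ∀ t ∈ Ioc (0 : ℝ) 1,
      κ / (t * (1 + ‖x‖) ^ 2) - K ≤ ‖u - D t x‖ ^ 2 / t := by
  have hC := h.C_pos
  have hC1 := h.one_le
  set δ : ℝ := 1 / (2 * (C * C * (C + 1))) with hδ
  set q : ℝ := 1 / (2 * C * (1 + 2 * C)) with hq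
  have hδ0 : 0 < δ := by positivity
  have hq0 : 0 < q := by positivity
  have hq1 : q ≤ 1 := by
    rw [hq, div_le_one (by positivity)]
    nlinarith
  refine ⟨q ^ 2, q ^ 2 / δ, by positivity, by positivity, fun x u hxu t ht => ?_⟩
  obtain ⟨ht0, ht1⟩ := ht
  have hx := norm_nonneg x
  set m := 1 + ‖x‖ with hm
  have hm1 : 1 ≤ m := by linarith
  set d := ‖u - D t x‖ with hd
  have hd0 : 0 ≤ d := norm_nonneg _
  have htT : t ∈ Icc (-T) T := ⟨by linarith [h.two_le], by linarith [h.two_le]⟩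
  have h0T : (0 : ℝ) ∈ Icc (-T) T := ⟨by linarith [h.two_le], by linarith [h.two_le]⟩
  rcases le_or_gt δ (t * m ^ 2) with hcase | hcase
  · have h1 : q ^ 2 / (t * m ^ 2) ≤ q ^ 2 / δ := by gcongr
    have h2 : 0 ≤ d ^ 2 / t := by positivity
    linarith
  · have hDx := h.norm_flow_le t htT x
    have e1 : |R (D t x) - R x| ≤ 1 / 2 := by
      have h1 := h.abs_R_sub_le (D t x) x
      have h2 := h.norm_flow_sub_le 0 h0T t htT x
      rw [h.flow_zero, sub_zero, abs_of_pos ht0] at h2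
      calc |R (D t x) - R x| ≤ C * ‖D t x - x‖ * (‖D t x‖ + ‖x‖) := h1
        _ ≤ C * (C * t * m) * (C * m + m) := by
            have : ‖x‖ ≤ m := by linarith
            gcongr
            · exact h2.trans (by gcongr)
            · exact hDx.trans (by gcongr)
        _ = (C * C * (C + 1)) * (t * m ^ 2) := by ring
        _ ≤ (C * C * (C + 1)) * δ := by gcongr
        _ = 1 / 2 := by rw [hδ]; field_simp
    have e2 : 1 / 2 ≤ |R u - R (D t x)| := by
      have := abs_sub_le (R x) (R (D t x)) (R u)
      rw [abs_sub_comm (R x) (R (D t x)), abs_sub_comm (R (D t x)) (R u)] at this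
      linarith
    have e3 : q / m ≤ d := by
      rcases le_total d 1 with hd1 | hd1
      · have h1 := h.abs_R_sub_le u (D t x)
        have h2 : ‖u‖ ≤ d + ‖D t x‖ := by
          have := norm_add_le (u - D t x) (D t x)
          simpa using this
        have h3 : 1 / 2 ≤ C * d * ((1 + 2 * C) * m) := by
          refine e2.trans (h1.trans ?_)
          gcongr
          have : C * ‖x‖ ≤ C * m := by gcongr; linarith
          nlinarith
        rw [div_le_iff₀ (by positivity), hq, div_le_iff₀ (by positivity)]
        nlinarith
      · refine le_trans ?_ hd1
        rw [div_le_one (by positivity)]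
        linarith
    have e4 : q ^ 2 / (t * m ^ 2) ≤ d ^ 2 / t := by
      rw [mul_comm t, ← div_div, ← div_pow]
      gcongr
    have : 0 < q ^ 2 / δ := by positivity
    linarith

/-- The distance from `u` to the piece of the orbit of `y` swept out during the time `[0, T]`. -/
def orbitDist (D : ℝ → E →L[ℝ] E) (T : ℝ) (y u : E) : ℝ :=
  sInf ((fun σ => ‖u - D σ y‖) '' Icc 0 T)

theorem orbitDist_nonneg (D : ℝ → E →L[ℝ] E) (T : ℝ) (y u : E) : 0 ≤ orbitDist D T y u :=
  Real.sInf_nonneg (by rintro _ ⟨σ, -, rfl⟩; exact norm_nonneg _)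

theorem continuous_orbitDist (h : IsExpandingFlow R D T c C) :
    Continuous fun p : E × E => orbitDist D T p.1 p.2 := by
  have hc : Continuous fun q : (E × E) × ℝ => ‖q.1.2 - D q.2 q.1.1‖ :=
    ((continuous_snd.comp continuous_fst).sub (h.continuous_flow.comp
      (continuous_snd.prodMk (continuous_fst.comp continuous_fst)))).norm
  exact IsCompact.continuous_sInf (K := Icc (0 : ℝ) T)
    (f := fun (p : E × E) σ => ‖p.2 - D σ p.1‖) isCompact_Icc hc

theorem orbitDist_le (D : ℝ → E →L[ℝ] E) {T : ℝ} (y u : E) {σ : ℝ} (hσ : σ ∈ Icc 0 T) :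
    orbitDist D T y u ≤ ‖u - D σ y‖ :=
  csInf_le ⟨0, by rintro _ ⟨σ, -, rfl⟩; exact norm_nonneg _⟩ ⟨σ, hσ, rfl⟩

theorem exists_orbitDist_eq (h : IsExpandingFlow R D T c C) (y u : E) :
    ∃ τ ∈ Icc 0 T, orbitDist D T y u = ‖u - D τ y‖ := by
  have hc : Continuous fun σ => ‖u - D σ y‖ :=
    (continuous_const.sub (h.continuous_flow.comp
      (continuous_id.prodMk continuous_const))).norm
  have hne : (Icc 0 T).Nonempty := ⟨0, le_rfl, by linarith [h.two_le]⟩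
  obtain ⟨τ, hτ, hmin⟩ := isCompact_Icc.exists_sInf_image_eq hne hc.continuousOn
  exact ⟨τ, hτ, hmin⟩

/-- Along an orbit, the distance to `u` grows linearly away from the closest point, with speed
`‖y‖`. -/
theorem exists_orbit_transversal (h : IsExpandingFlow R D T c C) (y u : E) :
    ∃ τ ∈ Icc 0 T, ∀ σ ∈ Icc 0 T, c / (4 * C ^ 2) * ‖y‖ * |σ - τ| ≤ ‖u - D σ y‖ := by
  have hC := h.C_pos
  obtain ⟨τ, hτ, hb⟩ := h.exists_orbitDist_eq y u
  refine ⟨τ, hτ, fun σ hσ => ?_⟩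
  have hT : -T ≤ 0 := by linarith [h.two_le]
  rcases (norm_nonneg y).eq_or_lt with hy | hy
  · rw [← hy]; simp
  have h1 : c * |σ - τ| * ‖y‖ ^ 2 ≤ |R (D σ y) - R (D τ y)| := by
    rcases le_total σ τ with hle | hle
    · rw [abs_of_nonpos (by linarith : σ - τ ≤ 0), abs_sub_comm, neg_sub]
      exact (h.growth σ τ y (hT.trans hσ.1) hle hτ.2).trans (le_abs_self _)
    · rw [abs_of_nonneg (by linarith : 0 ≤ σ - τ)]
      exact (h.growth τ σ y (hT.trans hτ.1) hle hσ.2).trans (le_abs_self _)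
  have h2 := h.abs_R_sub_le (D σ y) (D τ y)
  have h3 : ‖D σ y - D τ y‖ ≤ 2 * ‖u - D σ y‖ := by
    have e1 := orbitDist_le D y u hσ
    have e2 : D σ y - D τ y = (u - D τ y) - (u - D σ y) := by abel
    rw [e2]
    exact (norm_sub_le _ _).trans (by linarith)
  have h4 := h.norm_flow_le σ ⟨hT.trans hσ.1, hσ.2⟩ y
  have h5 := h.norm_flow_le τ ⟨hT.trans hτ.1, hτ.2⟩ y
  have h6 : c * |σ - τ| * ‖y‖ ^ 2 ≤ C * (2 * ‖u - D σ y‖) * (C * ‖y‖ + C * ‖y‖) :=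
    h1.trans (h2.trans (by gcongr))
  have h7 : (c * ‖y‖ * |σ - τ|) * ‖y‖ ≤ (‖u - D σ y‖ * (4 * C ^ 2)) * ‖y‖ := by
    nlinarith
  have h8 := le_of_mul_le_mul_right h7 hy
  rw [div_mul_eq_mul_div, div_mul_eq_mul_div, div_le_iff₀ (by positivity)]
  exact h8

end IsExpandingFlow

/-! ### The kernel integrated in time -/

/-- The function of `t` which dominates, up to a constant and the factor `e^{R(x)}`, the time
derivative of the Mehler kernel. -/
def timeKernel (D : ℝ → E →L[ℝ] E) (n : ℕ) (a t : ℝ) (x u : E) : ℝ :=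
  (Real.sqrt t ^ n)⁻¹ * (1 / t + (1 + ‖x‖) / Real.sqrt t) *
    Real.exp (-a * (‖u - D t x‖ ^ 2 / t))

/-- The integral of `timeKernel` over `0 < t ≤ 1`. -/
def totalKernel (D : ℝ → E →L[ℝ] E) (n : ℕ) (a : ℝ) (x u : E) : ℝ≥0∞ :=
  ∫⁻ t in Ioc (0 : ℝ) 1, ENNReal.ofReal (timeKernel D n a t x u)

namespace IsExpandingFlow

variable {R : E → ℝ} {D : ℝ → E →L[ℝ] E} {T c C : ℝ}

theorem measurable_totalKernel [MeasurableSpace E] [BorelSpace E] [SecondCountableTopology E]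
    (h : IsExpandingFlow R D T c C) (n : ℕ) (a : ℝ) :
    Measurable fun p : E × E => totalKernel D n a p.1 p.2 := by
  refine Measurable.lintegral_prod_right' (ν := volume.restrict (Ioc (0 : ℝ) 1))
    (f := fun q : (E × E) × ℝ => ENNReal.ofReal (timeKernel D n a q.2 q.1.1 q.1.2)) ?_
  have hD : Measurable fun q : (E × E) × ℝ => ‖q.1.2 - D q.2 q.1.1‖ :=
    (((continuous_snd.comp continuous_fst).sub (h.continuous_flow.comp
      (continuous_snd.prodMk (continuous_fst.comp continuous_fst)))).norm).measurable
  have hn : Measurable fun q : (E × E) × ℝ => ‖q.1.1‖ :=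
    measurable_norm.comp (measurable_fst.comp measurable_fst)
  have hs : Measurable fun q : (E × E) × ℝ => Real.sqrt q.2 :=
    Real.continuous_sqrt.measurable.comp measurable_snd
  refine Measurable.ennreal_ofReal ?_
  unfold timeKernel
  exact ((hs.pow_const n).inv.mul ((measurable_const.div measurable_snd).add
    ((hn.const_add 1).div hs))).mul
    (Real.measurable_exp.comp (((hD.pow_const 2).div measurable_snd).const_mul (-a)))

/-- A polynomial bound for the global part of the kernel. -/
theorem exists_totalKernel_le_pow (h : IsExpandingFlow R D T c C) (n : ℕ) {a : ℝ} (ha : 0 < a) :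
    ∃ A : ℝ, 0 < A ∧ ∀ x u : E, 1 ≤ |R x - R u| →
      totalKernel D n a x u ≤ ENNReal.ofReal (A * (1 + ‖x‖) ^ (n + 3)) := by
  obtain ⟨κ, K, hκ, hK, hsep⟩ := h.exists_separation
  obtain ⟨A, hA, hAle⟩ := exists_pow_mul_exp_neg_sq_le (n + 2) (a := a * κ) (by positivity)
  refine ⟨Real.exp (a * K) * (2 * A), by positivity, fun x u hxu => ?_⟩
  have hx := norm_nonneg x
  set m := 1 + ‖x‖ with hm
  have hm1 : 1 ≤ m := by linarith
  have key : ∀ t ∈ Ioc (0 : ℝ) 1,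
      timeKernel D n a t x u ≤ Real.exp (a * K) * (2 * A) * m ^ (n + 3) := by
    intro t ht
    have hs := hsep x u hxu t ht
    obtain ⟨ht0, ht1⟩ := ht
    have hw := Real.sqrt_pos.2 ht0
    have hw1 : Real.sqrt t ≤ 1 := Real.sqrt_le_one.2 ht1
    have hwt := Real.sq_sqrt ht0.le
    unfold timeKernel
    rw [← hm]
    set w := Real.sqrt t
    have e1 : Real.exp (-a * (‖u - D t x‖ ^ 2 / t)) ≤
        Real.exp (a * K) * Real.exp (-(a * κ) * (1 / (m * w)) ^ 2) := by
      rw [← Real.exp_add]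
      refine Real.exp_le_exp.2 ?_
      have : κ / (t * m ^ 2) = κ * (1 / (m * w)) ^ 2 := by
        rw [← hwt]; field_simp
      rw [this] at hs
      nlinarith
    have e2 : 1 / t + m / w ≤ 2 * m / w ^ 2 := by
      rw [← hwt]
      have h1 : 1 / w ^ 2 ≤ m / w ^ 2 := by gcongr
      have h2 : m / w ≤ m / w ^ 2 := by
        gcongr
        nlinarith
      calc _ ≤ m / w ^ 2 + m / w ^ 2 := add_le_add h1 h2
        _ = _ := by ring
    have e3 := hAle (1 / (m * w)) (by positivity)
    calc (w ^ n)⁻¹ * (1 / t + m / w) * Real.exp (-a * (‖u - D t x‖ ^ 2 / t))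
        ≤ (w ^ n)⁻¹ * (2 * m / w ^ 2) *
          (Real.exp (a * K) * Real.exp (-(a * κ) * (1 / (m * w)) ^ 2)) := by gcongr
      _ = Real.exp (a * K) * (2 * m ^ (n + 3)) *
          ((1 / (m * w)) ^ (n + 2) * Real.exp (-(a * κ) * (1 / (m * w)) ^ 2)) := by
          generalize Real.exp (-(a * κ) * (1 / (m * w)) ^ 2) = X
          rw [div_pow, one_pow, mul_pow]
          field_simp
          ring
      _ ≤ Real.exp (a * K) * (2 * m ^ (n + 3)) * A := by gcongr
      _ = _ := by ring
  calc totalKernel D n a x u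
      ≤ ∫⁻ t in Ioc (0 : ℝ) 1, ENNReal.ofReal (Real.exp (a * K) * (2 * A) * m ^ (n + 3)) :=
        setLIntegral_mono' measurableSet_Ioc fun t ht => ENNReal.ofReal_le_ofReal (key t ht)
    _ = _ := by simp

set_option maxHeartbeats 400000 in
/-- On the whole orbit of `y`, the global part of the kernel is controlled by the distance from
`u` to this orbit. -/
theorem exists_totalKernel_le_orbitDist (h : IsExpandingFlow R D T c C) (n : ℕ) {a : ℝ}
    (ha : 0 < a) :
    ∃ A : ℝ, 0 < A ∧ ∀ y u : E, 1 ≤ ‖y‖ → ∀ s ∈ Icc 0 (T - 1), 1 ≤ |R (D s y) - R u| →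
      totalKernel D n a (D s y) u ≤
        ENNReal.ofReal (A / (orbitDist D T y u + 1 / ‖y‖) ^ n) := by
  obtain ⟨κ, K, hκ, hK, hsep⟩ := h.exists_separation
  have hC := h.C_pos
  have hc := h.c_pos
  set κ' : ℝ := κ / (1 + C) ^ 2 with hκ'
  have hκ'0 : 0 < κ' := by positivity
  set e : ℝ := min 1 κ' with he
  have he0 : 0 < e := lt_min one_pos hκ'0
  set a₁ : ℝ := a * e / 12 with ha₁
  set c' : ℝ := c / (4 * C ^ 2) with hc'
  have hc'0 : 0 < c' := by positivity
  set a₂ : ℝ := a * c' ^ 2 / 3 with ha₂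
  have ha₁0 : 0 < a₁ := by positivity
  have ha₂0 : 0 < a₂ := by positivity
  obtain ⟨A₁, hA₁, hA₁le⟩ := exists_pow_mul_exp_neg_sq_le n ha₁0
  obtain ⟨A₂, hA₂, hA₂le⟩ := exists_pow_mul_exp_neg_sq_le 1 ha₁0
  set A₃ : ℝ := Real.exp (a * K / 3) * A₁ * (A₂ + (1 + C)) with hA₃
  have hA₃0 : 0 < A₃ := by positivity
  refine ⟨A₃ * (2 * Real.sqrt (Real.pi / a₂)), by positivity, fun y u hy s hs hyu => ?_⟩
  obtain ⟨τ, hτ, htrans⟩ := h.exists_orbit_transversal y u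
  set b := orbitDist D T y u with hb
  have hb0 : 0 ≤ b := orbitDist_nonneg D T y u
  set ρ := ‖y‖ with hρ
  have hρ0 : 0 < ρ := one_pos.trans_le hy
  set k := Real.sqrt (-(s - τ)) with hk
  set g := b + 1 / ρ with hg
  have hg0 : 0 < g := by positivity
  have hsT : s ∈ Icc (-T) T := ⟨by linarith [hs.1, h.two_le], by linarith [hs.2]⟩
  set m := 1 + ‖D s y‖ with hm
  have hm0 : 0 < m := by positivity
  have hmρ : m ≤ (1 + C) * ρ := by
    have := h.norm_flow_le s hsT y
    rw [add_mul, one_mul]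
    linarith
  have key : ∀ t ∈ Ioc (0 : ℝ) 1, timeKernel D n a t (D s y) u ≤
      A₃ / g ^ n * (ρ / Real.sqrt t * Real.exp (-a₂ * ρ ^ 2 * (Real.sqrt t - k) ^ 2)) := by
    intro t ht
    have q1 := hsep (D s y) u hyu t ht
    obtain ⟨ht0, ht1⟩ := ht
    have hσ : t + s ∈ Icc 0 T := ⟨by linarith [hs.1], by linarith [hs.2]⟩
    have q2 := orbitDist_le D y u hσ
    have q3 := htrans (t + s) hσ
    have q4 := sub_sq_le_add_sq_div (θ := s - τ) ht0
    have hw := Real.sqrt_pos.2 ht0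
    have hwt := Real.sq_sqrt ht0.le
    unfold timeKernel
    rw [← h.flow_add] at q1 ⊢
    rw [← hm] at q1 ⊢
    rw [← hk] at q4
    set w := Real.sqrt t
    set d := ‖u - D (t + s) y‖
    have p1 : κ' * (1 / ρ) ^ 2 / t - K ≤ d ^ 2 / t := by
      refine le_trans ?_ q1
      have : κ' * (1 / ρ) ^ 2 / t = κ / (t * ((1 + C) * ρ) ^ 2) := by
        rw [hκ']; field_simp
      rw [this]
      gcongr
    have p2 : b ^ 2 / t ≤ d ^ 2 / t := by gcongr
    have p3 : c' ^ 2 * ρ ^ 2 * (w - k) ^ 2 ≤ d ^ 2 / t := by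
      calc _ ≤ c' ^ 2 * ρ ^ 2 * ((t + (s - τ)) ^ 2 / t) := by gcongr
        _ = (c' * ρ * |t + s - τ|) ^ 2 / t := by
          rw [mul_pow, mul_pow, sq_abs]; ring
        _ ≤ _ := by gcongr
    have p4 : e / 2 * (g / w) ^ 2 ≤ κ' * (1 / ρ) ^ 2 / t + b ^ 2 / t := by
      have h1 : e ≤ 1 := min_le_left _ _
      have h2 : e ≤ κ' := min_le_right _ _
      rw [div_pow, hwt, ← add_div, ← mul_div_assoc]
      gcongr
      have : g ^ 2 ≤ 2 * (b ^ 2 + (1 / ρ) ^ 2) := by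
        exact add_sq_le
      calc e / 2 * g ^ 2 ≤ e / 2 * (2 * (b ^ 2 + (1 / ρ) ^ 2)) := by gcongr
        _ = e * (1 / ρ) ^ 2 + e * b ^ 2 := by ring
        _ ≤ κ' * (1 / ρ) ^ 2 + 1 * b ^ 2 := by gcongr
        _ = _ := by ring
    have e1 : Real.exp (-a * (d ^ 2 / t)) ≤ Real.exp (a * K / 3) *
        Real.exp (-a₁ * (g / w) ^ 2) * Real.exp (-a₁ * (g / w) ^ 2) *
        Real.exp (-a₂ * ρ ^ 2 * (w - k) ^ 2) := by
      rw [← Real.exp_add, ← Real.exp_add, ← Real.exp_add]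
      refine Real.exp_le_exp.2 ?_
      have : e / 2 * (g / w) ^ 2 + c' ^ 2 * ρ ^ 2 * (w - k) ^ 2 - K ≤ 3 * (d ^ 2 / t) := by
        linarith
      have := mul_le_mul_of_nonneg_left this (by positivity : 0 ≤ a / 3)
      rw [ha₁, ha₂]
      linarith
    have e2 : 1 / t + m / w ≤ ρ / w * (g / w + (1 + C)) := by
      rw [← hwt, mul_add]
      have h1 : 1 / w ^ 2 ≤ ρ / w * (g / w) := by
        rw [div_mul_div_comm, ← sq]
        gcongr
        rw [hg, mul_add, mul_one_div_cancel hρ0.ne']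
        linarith [mul_nonneg hρ0.le hb0]
      have h2 : m / w ≤ ρ / w * (1 + C) := by
        rw [div_mul_eq_mul_div, mul_comm ρ]
        gcongr
      linarith
    have e3 := hA₁le (g / w) (by positivity)
    have e4 : (g / w + (1 + C)) * Real.exp (-a₁ * (g / w) ^ 2) ≤ A₂ + (1 + C) := by
      have h1 := hA₂le (g / w) (by positivity)
      have h2 : Real.exp (-a₁ * (g / w) ^ 2) ≤ 1 :=
        Real.exp_le_one_iff.2 (by rw [neg_mul]; exact neg_nonpos.2 (by positivity))
      have h3 := mul_le_mul_of_nonneg_left h2 (by positivity : 0 ≤ 1 + C)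
      rw [pow_one] at h1
      rw [add_mul]
      linarith
    calc (w ^ n)⁻¹ * (1 / t + m / w) * Real.exp (-a * (d ^ 2 / t))
        ≤ (w ^ n)⁻¹ * (ρ / w * (g / w + (1 + C))) * (Real.exp (a * K / 3) *
        Real.exp (-a₁ * (g / w) ^ 2) * Real.exp (-a₁ * (g / w) ^ 2) *
        Real.exp (-a₂ * ρ ^ 2 * (w - k) ^ 2)) := by gcongr
      _ = Real.exp (a * K / 3) * ((g / w) ^ n * Real.exp (-a₁ * (g / w) ^ 2)) *
          ((g / w + (1 + C)) * Real.exp (-a₁ * (g / w) ^ 2)) / g ^ n *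
          (ρ / w * Real.exp (-a₂ * ρ ^ 2 * (w - k) ^ 2)) := by
          have hg' := hg0.ne'
          have hw' := hw.ne'
          generalize Real.exp (-a₁ * (g / w) ^ 2) = X
          generalize Real.exp (-a₂ * ρ ^ 2 * (w - k) ^ 2) = Y
          generalize Real.exp (a * K / 3) = Z
          rw [div_pow]
          field_simp
      _ ≤ Real.exp (a * K / 3) * A₁ * (A₂ + (1 + C)) / g ^ n *
          (ρ / w * Real.exp (-a₂ * ρ ^ 2 * (w - k) ^ 2)) := by gcongr
  calc totalKernel D n a (D s y) u
      ≤ ∫⁻ t in Ioc (0 : ℝ) 1, ENNReal.ofReal (A₃ / g ^ n) * ENNReal.ofReal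
          (ρ / Real.sqrt t * Real.exp (-a₂ * ρ ^ 2 * (Real.sqrt t - k) ^ 2)) := by
        refine setLIntegral_mono' measurableSet_Ioc fun t ht => ?_
        rw [← ENNReal.ofReal_mul (by positivity)]
        exact ENNReal.ofReal_le_ofReal (key t ht)
    _ ≤ ENNReal.ofReal (A₃ / g ^ n) * ENNReal.ofReal (2 * Real.sqrt (Real.pi / a₂)) := by
        rw [lintegral_const_mul' _ _ ENNReal.ofReal_ne_top]
        gcongr
        exact lintegral_sqrt_gaussian_le ha₂0 hρ0 k
    _ = _ := by
        rw [← ENNReal.ofReal_mul (by positivity)]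
        congr 1
        ring

end IsExpandingFlow

/-! ### Volume estimates in thin shells -/

/-- The shell between the level sets `β` and `β + 1` of `R`. -/
def levelShell (R : E → ℝ) (β : ℝ) : Set E := {y | β ≤ R y ∧ R y ≤ β + 1}

namespace IsExpandingFlow

variable {R : E → ℝ} {D : ℝ → E →L[ℝ] E} {T c C : ℝ}

theorem isClosed_levelShell (h : IsExpandingFlow R D T c C) (β : ℝ) :
    IsClosed (levelShell R β) :=
  (isClosed_le continuous_const h.continuous_R).inter
    (isClosed_le h.continuous_R continuous_const)

theorem norm_le_of_mem_levelShell (h : IsExpandingFlow R D T c C) {ρ : ℝ} (hρ : 1 ≤ ρ) {y : E}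
    (hy : y ∈ levelShell R (ρ ^ 2)) : ‖y‖ ≤ Real.sqrt (2 / c) * ρ := by
  have hc := h.c_pos
  have h1 := h.le_R y
  have h2 := hy.2
  refine (abs_le_of_sq_le_sq' ?_ (by positivity)).2
  rw [mul_pow, Real.sq_sqrt (by positivity), div_mul_eq_mul_div, le_div_iff₀ hc]
  nlinarith

theorem le_norm_of_mem_levelShell (h : IsExpandingFlow R D T c C) {ρ : ℝ} {y : E}
    (hy : y ∈ levelShell R (ρ ^ 2)) : ρ ≤ C * ‖y‖ := by
  have hC := h.C_pos
  have h1 := h.R_le y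
  have h2 := hy.1
  refine (abs_le_of_sq_le_sq' ?_ (by positivity)).2
  have h3 : C * ‖y‖ ^ 2 ≤ C * (C * ‖y‖ ^ 2) := by
    have := h.one_le
    have := le_mul_of_one_le_left (by positivity : 0 ≤ ‖y‖ ^ 2) this
    gcongr
  calc ρ ^ 2 ≤ C * (C * ‖y‖ ^ 2) := by linarith
    _ = _ := by ring

/-- The points of a shell whose orbits pass within `l ≥ 1 / ρ` of a given point lie in a ball of
radius of order `l`. -/
theorem exists_norm_sub_le_of_orbitDist_le (h : IsExpandingFlow R D T c C) :
    ∃ A : ℝ, 0 < A ∧ ∀ ρ : ℝ, 1 ≤ ρ → ∀ y ∈ levelShell R (ρ ^ 2), ∀ y' ∈ levelShell R (ρ ^ 2),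
      ∀ (u : E) (l : ℝ), 1 / ρ ≤ l → orbitDist D T y u ≤ l → orbitDist D T y' u ≤ l →
      ‖y - y'‖ ≤ A * l := by
  have hC := h.C_pos
  have hc := h.c_pos
  set a := Real.sqrt (2 / c) with ha
  have ha0 : 0 ≤ a := Real.sqrt_nonneg _
  set B := C * (2 * C) * (a + C * a) + 1 with hB
  have hB0 : 0 < B := by positivity
  refine ⟨2 * C + C * (C ^ 2 * B / c) * a, by positivity, ?_⟩
  intro ρ hρ y hy y' hy' u l hl hyl hyl'
  have hρ0 : 0 < ρ := one_pos.trans_le hρ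
  have hl0 : 0 < l := lt_of_lt_of_le (by positivity) hl
  obtain ⟨σ, hσ, hbσ⟩ := h.exists_orbitDist_eq y u
  obtain ⟨σ', hσ', hbσ'⟩ := h.exists_orbitDist_eq y' u
  rw [hbσ] at hyl
  rw [hbσ'] at hyl'
  clear hbσ hbσ'
  have hT := h.two_le
  wlog hle : σ ≤ σ' generalizing y y' σ σ'
  · rw [norm_sub_rev]
    exact this (y := y') (y' := y) (σ := σ') (σ' := σ) (hy := hy') (hy' := hy) (hσ := hσ')
      (hσ' := hσ) (hyl := hyl') (hyl' := hyl) (hle := le_of_not_ge hle)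
  have e1 : ‖D σ y - D σ' y'‖ ≤ 2 * l := by
    have : D σ y - D σ' y' = (u - D σ' y') - (u - D σ y) := by abel
    rw [this]
    exact (norm_sub_le _ _).trans (by linarith)
  set δ := σ' - σ with hδ
  have hδ0 : 0 ≤ δ := by linarith
  have hδT : δ ∈ Icc (-T) T := ⟨by linarith, by linarith [hσ.1, hσ'.2]⟩
  have e2 : ‖y - D δ y'‖ ≤ C * (2 * l) := by
    have e := h.norm_flow_le (-σ) ⟨by linarith [hσ.2], by linarith [hσ.1]⟩ (D σ y - D σ' y')
    rw [map_sub, h.flow_neg_flow, ← h.flow_add, show -σ + σ' = δ by rw [hδ]; ring] at e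
    exact e.trans (by gcongr)
  have e3 := h.growth 0 δ y' (by linarith) hδ0 hδT.2
  rw [h.flow_zero, sub_zero] at e3
  have n1 := h.norm_le_of_mem_levelShell hρ hy
  have n2 := h.norm_le_of_mem_levelShell hρ hy'
  have n3 := h.le_norm_of_mem_levelShell hy'
  rw [← ha] at n1 n2
  have n4 := h.norm_flow_le δ hδT y'
  have e4 : R (D δ y') - R y ≤ C * (C * (2 * l)) * (a * ρ + C * (a * ρ)) := by
    refine (le_abs_self _).trans ?_
    rw [abs_sub_comm]
    refine (h.abs_R_sub_le y (D δ y')).trans ?_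
    gcongr
    exact n4.trans (by gcongr)
  have hlρ : 1 ≤ l * ρ := by rwa [div_le_iff₀ hρ0] at hl
  have e5 : c * δ * ‖y'‖ ^ 2 ≤ B * (l * ρ) := by
    have := hy.2
    have := hy'.1
    rw [hB]
    linarith
  have e6 : δ ≤ C ^ 2 * B / c * (l / ρ) := by
    have : ρ ^ 2 ≤ C ^ 2 * ‖y'‖ ^ 2 := by rw [← mul_pow]; gcongr
    have : c * δ * ρ ^ 2 ≤ C ^ 2 * (B * (l * ρ)) := by
      calc c * δ * ρ ^ 2 ≤ c * δ * (C ^ 2 * ‖y'‖ ^ 2) := by gcongr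
        _ = C ^ 2 * (c * δ * ‖y'‖ ^ 2) := by ring
        _ ≤ _ := by gcongr
    rw [div_mul_div_comm, le_div_iff₀ (by positivity)]
    refine le_of_mul_le_mul_right ?_ hρ0
    linarith
  have e7 : ‖D δ y' - y'‖ ≤ C * (C ^ 2 * B / c) * a * l := by
    have := h.norm_flow_sub_le 0 ⟨by linarith, by linarith⟩ δ hδT y'
    rw [h.flow_zero, sub_zero, abs_of_nonneg hδ0] at this
    calc _ ≤ C * δ * ‖y'‖ := this
      _ ≤ C * (C ^ 2 * B / c * (l / ρ)) * (a * ρ) := by gcongr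
      _ = _ := by field_simp
  calc ‖y - y'‖ = ‖(y - D δ y') + (D δ y' - y')‖ := by congr 1; abel
    _ ≤ _ := (norm_add_le _ _).trans (by linarith)

theorem det_ne_zero (h : IsExpandingFlow R D T c C) (t : ℝ) :
    LinearMap.det (D t : E →ₗ[ℝ] E) ≠ 0 := by
  have h1 : (D (-t) : E →ₗ[ℝ] E) ∘ₗ (D t : E →ₗ[ℝ] E) = LinearMap.id := by
    ext x
    simpa using h.flow_neg_flow t x
  intro h0
  have := congrArg LinearMap.det h1
  rw [LinearMap.det_comp, h0, mul_zero, LinearMap.det_id] at this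
  exact zero_ne_one this

section Measure

variable [FiniteDimensional ℝ E] [MeasurableSpace E] [BorelSpace E]
  (vol : Measure E) [vol.IsAddHaarMeasure]

/-- The part of a shell inside a ball of radius `r` has the volume of a piece of thickness
`1 / ρ`: the images of such a piece under the flow, for times up to `r / ρ`, overlap only for a
time of order `ρ⁻²`, and stay in a ball of radius of order `r`. -/
theorem exists_volume_levelShell_inter_closedBall_le (h : IsExpandingFlow R D T c C) {d : ℕ}
    (hd : Module.finrank ℝ E = d + 1) :
    ∃ A : ℝ, 0 < A ∧ ∀ ρ : ℝ, 1 ≤ ρ → ∀ y₀ ∈ levelShell R (ρ ^ 2), ∀ r : ℝ, 0 < r →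
      vol (levelShell R (ρ ^ 2) ∩ Metric.closedBall y₀ r) ≤ ENNReal.ofReal (A * r ^ d / ρ) := by
  have hC := h.C_pos
  have hc := h.c_pos
  have hT := h.two_le
  set a := Real.sqrt (2 / c) with ha
  have ha0 : 0 < a := Real.sqrt_pos.2 (by positivity)
  set V := (vol (Metric.ball (0 : E) 1)).toReal with hV
  have hVtop : vol (Metric.ball (0 : E) 1) = ENNReal.ofReal V :=
    (ENNReal.ofReal_toReal measure_ball_lt_top.ne).symm
  have hV0 : 0 < V := ENNReal.toReal_pos
    (Metric.measure_ball_pos vol 0 one_pos).ne' measure_ball_lt_top.ne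
  refine ⟨C * (2 * a) * (2 * (C ^ 2 / c)) * (C + 1) ^ (d + 1) * V, by positivity, ?_⟩
  intro ρ hρ y₀ hy₀ r₀ hr₀
  have hρ0 : 0 < ρ := one_pos.trans_le hρ
  -- the shell itself has diameter at most `2 a ρ`
  set r := min r₀ (2 * a * ρ) with hr
  have hr0 : 0 < r := lt_min hr₀ (by positivity)
  set F := levelShell R (ρ ^ 2) ∩ Metric.closedBall y₀ r with hF
  have hFm : MeasurableSet F :=
    ((h.isClosed_levelShell _).inter Metric.isClosed_closedBall).measurableSet
  have hsub : levelShell R (ρ ^ 2) ∩ Metric.closedBall y₀ r₀ ⊆ F := by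
    rintro y ⟨hy, hyr⟩
    refine ⟨hy, ?_⟩
    rw [Metric.mem_closedBall] at hyr ⊢
    refine le_min hyr ?_
    rw [dist_eq_norm]
    have n1 := h.norm_le_of_mem_levelShell hρ hy
    have n2 := h.norm_le_of_mem_levelShell hρ hy₀
    exact (norm_sub_le _ _).trans (by linarith)
  set η := r / (2 * a * ρ) with hη
  have hη0 : 0 < η := by positivity
  have hη1 : η ≤ 1 := by
    rw [hη, div_le_one (by positivity)]
    exact min_le_right _ _
  set w := C ^ 2 / (c * ρ ^ 2) with hw
  have hw0 : 0 < w := by positivity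
  -- the time which an orbit spends in `F`
  have htime : ∀ z : E, ∫⁻ s in Icc 0 η, F.indicator 1 (D (-s) z) ≤
      (Metric.closedBall y₀ ((C + 1) * r)).indicator (fun _ => ENNReal.ofReal (2 * w)) z := by
    intro z
    by_cases hz : ∃ s₁ ∈ Icc 0 η, D (-s₁) z ∈ F
    · obtain ⟨s₁, hs₁, hz₁⟩ := hz
      set y₁ := D (-s₁) z with hy₁
      have hzy : z = D s₁ y₁ := (h.flow_flow_neg s₁ z).symm
      have n1 := h.norm_le_of_mem_levelShell hρ hz₁.1
      have n3 := h.le_norm_of_mem_levelShell hz₁.1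
      have hzball : z ∈ Metric.closedBall y₀ ((C + 1) * r) := by
        rw [Metric.mem_closedBall, dist_eq_norm]
        have e1 := h.norm_flow_sub_le 0 ⟨by linarith, by linarith⟩ s₁
          ⟨by linarith [hs₁.1], by linarith [hs₁.2]⟩ y₁
        rw [h.flow_zero, ← hzy, sub_zero, abs_of_nonneg hs₁.1] at e1
        have e2 : C * s₁ * ‖y₁‖ ≤ C * r := by
          calc C * s₁ * ‖y₁‖ ≤ C * η * (2 * (a * ρ)) := by
                have := hs₁.2
                have : a * ρ ≤ 2 * (a * ρ) := by linarith [mul_pos ha0 hρ0]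
                gcongr
                exact n1.trans this
            _ = C * r := by rw [hη]; field_simp
        have e3 := hz₁.2
        rw [Metric.mem_closedBall, dist_eq_norm] at e3
        calc ‖z - y₀‖ = ‖(z - y₁) + (y₁ - y₀)‖ := by congr 1; abel
          _ ≤ _ := (norm_add_le _ _).trans (by linarith)
      rw [indicator_of_mem hzball]
      have hsubset : ∀ s ∈ Icc 0 η, D (-s) z ∈ F → s ∈ Icc (s₁ - w) (s₁ + w) := by
        intro s hs hsF
        have e0 : D (-s) z = D (s₁ - s) y₁ := by
          rw [hzy, ← h.flow_add]; congr 2; ring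
        rw [e0] at hsF
        have e1 : c * |s₁ - s| * ‖y₁‖ ^ 2 ≤ 1 := by
          have b1 := hsF.1.1
          have b2 := hsF.1.2
          have b3 := hz₁.1.1
          have b4 := hz₁.1.2
          rcases le_total s s₁ with hss | hss
          · have := h.growth 0 (s₁ - s) y₁ (by linarith) (by linarith)
              (by linarith [hs.1, hs₁.2])
            rw [h.flow_zero, sub_zero] at this
            rw [abs_of_nonneg (by linarith)]
            linarith
          · have := h.growth (s₁ - s) 0 y₁ (by linarith [hs.2, hs₁.1]) (by linarith)
              (by linarith)
            rw [h.flow_zero, zero_sub] at this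
            rw [abs_of_nonpos (by linarith)]
            linarith
        have e2 : |s₁ - s| ≤ w := by
          rw [hw, le_div_iff₀ (by positivity)]
          have : ρ ^ 2 ≤ C ^ 2 * ‖y₁‖ ^ 2 := by rw [← mul_pow]; gcongr
          calc |s₁ - s| * (c * ρ ^ 2) ≤ |s₁ - s| * (c * (C ^ 2 * ‖y₁‖ ^ 2)) := by gcongr
            _ = C ^ 2 * (c * |s₁ - s| * ‖y₁‖ ^ 2) := by ring
            _ ≤ C ^ 2 * 1 := by gcongr
            _ = C ^ 2 := mul_one _
        rw [abs_le] at e2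
        exact ⟨by linarith, by linarith⟩
      calc ∫⁻ s in Icc 0 η, F.indicator 1 (D (-s) z)
          ≤ ∫⁻ s in Icc 0 η, (Icc (s₁ - w) (s₁ + w)).indicator 1 s := by
            refine setLIntegral_mono' measurableSet_Icc fun s hs => ?_
            by_cases hsF : D (-s) z ∈ F
            · rw [indicator_of_mem hsF, indicator_of_mem (hsubset s hs hsF)]
              exact le_rfl
            · rw [indicator_of_notMem hsF]
              exact zero_le
        _ ≤ ∫⁻ s, (Icc (s₁ - w) (s₁ + w)).indicator 1 s := setLIntegral_le_lintegral _ _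
        _ = ENNReal.ofReal (2 * w) := by
            rw [lintegral_indicator_one measurableSet_Icc, Real.volume_Icc]
            congr 1; ring
    · push Not at hz
      rw [setLIntegral_congr_fun (g := fun _ => 0) measurableSet_Icc
        fun s hs => indicator_of_notMem (hz s hs) _]
      simp
  have hmeas : Measurable fun p : ℝ × E => F.indicator (1 : E → ℝ≥0∞) (D (-p.1) p.2) :=
    (measurable_one.indicator hFm).comp (h.continuous_flow.comp
      (continuous_fst.neg.prodMk continuous_snd)).measurable
  have hlow : vol F * ENNReal.ofReal (η / C) ≤
      ∫⁻ s in Icc 0 η, ∫⁻ z, F.indicator 1 (D (-s) z) ∂vol := by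
    calc vol F * ENNReal.ofReal (η / C)
        = ∫⁻ s in Icc 0 η, ENNReal.ofReal (1 / C) * vol F := by
          rw [setLIntegral_const, Real.volume_Icc, sub_zero, mul_right_comm,
            ← ENNReal.ofReal_mul (by positivity), mul_comm]
          congr 2; ring
      _ ≤ _ := by
          refine setLIntegral_mono' measurableSet_Icc fun s hs => ?_
          have e1 : ∫⁻ z, F.indicator 1 (D (-s) z) ∂vol =
              vol ((D (-s) : E →ₗ[ℝ] E) ⁻¹' F) := by
            exact lintegral_indicator_one (s := D (-s) ⁻¹' F)
              ((D (-s)).continuous.measurable hFm)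
          rw [e1, Measure.addHaar_preimage_linearMap vol (h.det_ne_zero (-s))]
          gcongr
          rw [abs_inv, ← one_div]
          have := h.abs_det_le (-s) ⟨by linarith [hs.2], by linarith [hs.1]⟩
          have := abs_pos.2 (h.det_ne_zero (-s))
          gcongr
  have hup : ∫⁻ s in Icc 0 η, ∫⁻ z, F.indicator 1 (D (-s) z) ∂vol ≤
      ENNReal.ofReal (2 * w * (((C + 1) * r) ^ (d + 1) * V)) := by
    rw [lintegral_lintegral_swap hmeas.aemeasurable]
    refine (lintegral_mono htime).trans ?_
    rw [lintegral_indicator_const Metric.isClosed_closedBall.measurableSet,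
      Measure.addHaar_closedBall _ _ (by positivity), hd, hVtop,
      ← ENNReal.ofReal_mul (by positivity), ← ENNReal.ofReal_mul (by positivity)]
  calc vol (levelShell R (ρ ^ 2) ∩ Metric.closedBall y₀ r₀) ≤ vol F := measure_mono hsub
    _ ≤ ENNReal.ofReal (2 * w * (((C + 1) * r) ^ (d + 1) * V)) / ENNReal.ofReal (η / C) := by
        rw [ENNReal.le_div_iff_mul_le (Or.inl (by simpa using by positivity))
          (Or.inl ENNReal.ofReal_ne_top)]
        exact hlow.trans hup
    _ = ENNReal.ofReal (C * (2 * a) * (2 * (C ^ 2 / c)) * (C + 1) ^ (d + 1) * V * r ^ d / ρ) := by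
        rw [← ENNReal.ofReal_div_of_pos (by positivity)]
        congr 1
        rw [hη, hw, mul_pow]
        field_simp
        ring
    _ ≤ _ := by
        gcongr
        exact min_le_left _ _

/-- The profile `(orbitDist + 1 / ‖y‖)^{-n}` has bounded integral over every shell: the part where
the distance is about `2 ^ k / ρ` contributes `O(2 ^ {-k})`. -/
theorem exists_lintegral_orbitDist_le (h : IsExpandingFlow R D T c C) {d : ℕ}
    (hd : Module.finrank ℝ E = d + 1) :
    ∃ A : ℝ, 0 < A ∧ ∀ ρ : ℝ, 1 ≤ ρ → ∀ u : E,
      ∫⁻ y in levelShell R (ρ ^ 2),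
        ENNReal.ofReal (1 / (orbitDist D T y u + 1 / ‖y‖) ^ (d + 1)) ∂vol ≤ ENNReal.ofReal A := by
  have hC := h.C_pos
  have hc := h.c_pos
  obtain ⟨A₁, hA₁, hA₁le⟩ := h.exists_norm_sub_le_of_orbitDist_le
  obtain ⟨A₂, hA₂, hA₂le⟩ := h.exists_volume_levelShell_inter_closedBall_le vol hd
  set a := Real.sqrt (2 / c) with ha
  have ha0 : 0 < a := Real.sqrt_pos.2 (by positivity)
  refine ⟨(a + 2) ^ (d + 1) * (A₂ * A₁ ^ d) * 2, by positivity, fun ρ hρ u => ?_⟩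
  have hρ0 : 0 < ρ := one_pos.trans_le hρ
  set W : ℕ → Set E := fun k => {y | y ∈ levelShell R (ρ ^ 2) ∧ orbitDist D T y u ≤ 2 ^ k / ρ}
    with hW
  have hcont : Continuous fun y => orbitDist D T y u :=
    h.continuous_orbitDist.comp (continuous_id.prodMk continuous_const)
  have hWm : ∀ k, MeasurableSet (W k) := fun k =>
    ((h.isClosed_levelShell _).inter (isClosed_le hcont continuous_const)).measurableSet
  have hpt : ∀ y ∈ levelShell R (ρ ^ 2),
      ENNReal.ofReal (1 / (orbitDist D T y u + 1 / ‖y‖) ^ (d + 1)) ≤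
      ∑' k, (W k).indicator (fun _ => ENNReal.ofReal (((a + 2) * ρ / 2 ^ k) ^ (d + 1))) y := by
    intro y hy
    have hb0 := orbitDist_nonneg D T y u
    set b := orbitDist D T y u
    have n1 := h.norm_le_of_mem_levelShell hρ hy
    have n2 := h.le_norm_of_mem_levelShell hy
    have hy0 : 0 < ‖y‖ := by
      by_contra hneg
      have : ‖y‖ = 0 := le_antisymm (not_lt.1 hneg) (norm_nonneg _)
      rw [this] at n2
      linarith
    have hex : ∃ k : ℕ, b ≤ 2 ^ k / ρ := by
      obtain ⟨k, hk⟩ := pow_unbounded_of_one_lt (b * ρ) (one_lt_two (α := ℝ))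
      exact ⟨k, by rw [le_div_iff₀ hρ0]; exact hk.le⟩
    classical
    obtain ⟨k, hk, hkmin⟩ : ∃ k : ℕ, b ≤ 2 ^ k / ρ ∧ ∀ j < k, 2 ^ j / ρ < b :=
      ⟨Nat.find hex, Nat.find_spec hex, fun j hj => not_le.1 (Nat.find_min hex hj)⟩
    have hg : 1 / (b + 1 / ‖y‖) ≤ (a + 2) * ρ / 2 ^ k := by
      rcases k with _ | j
      · rw [pow_zero, div_one, div_le_iff₀ (by positivity)]
        have : 1 ≤ a * ρ * (1 / ‖y‖) := by
          rw [mul_one_div, one_le_div hy0]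
          exact n1
        have : 0 ≤ (a + 2) * ρ * b := by positivity
        have : 0 ≤ 2 * ρ * (1 / ‖y‖) := by positivity
        linarith
      · have hj := hkmin j (Nat.lt_succ_self j)
        have hj0 : 0 < 2 ^ j / ρ := by positivity
        calc 1 / (b + 1 / ‖y‖) ≤ 1 / (2 ^ j / ρ) := by
              gcongr
              have : 0 < 1 / ‖y‖ := by positivity
              linarith
          _ = 2 * ρ / 2 ^ (j + 1) := by rw [pow_succ]; field_simp
          _ ≤ _ := by gcongr; linarith
    have hmem : y ∈ W k := ⟨hy, hk⟩
    refine le_trans ?_ (ENNReal.le_tsum k)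
    rw [indicator_of_mem hmem, ← one_div_pow]
    gcongr
  have hterm : ∀ k, ENNReal.ofReal (((a + 2) * ρ / 2 ^ k) ^ (d + 1)) * vol (W k) ≤
      ENNReal.ofReal ((a + 2) ^ (d + 1) * (A₂ * A₁ ^ d) * (1 / 2) ^ k) := by
    intro k
    rcases (W k).eq_empty_or_nonempty with he | ⟨y₀, hy₀⟩
    · rw [he, measure_empty, mul_zero]
      exact zero_le
    · have h2k : (1 : ℝ) ≤ 2 ^ k := one_le_pow₀ one_le_two
      have hsub : W k ⊆ levelShell R (ρ ^ 2) ∩ Metric.closedBall y₀ (A₁ * (2 ^ k / ρ)) := by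
        intro y hy
        refine ⟨hy.1, ?_⟩
        rw [Metric.mem_closedBall, dist_eq_norm]
        exact hA₁le ρ hρ y hy.1 y₀ hy₀.1 u _ (by gcongr) hy.2 hy₀.2
      calc _ ≤ ENNReal.ofReal (((a + 2) * ρ / 2 ^ k) ^ (d + 1)) *
            ENNReal.ofReal (A₂ * (A₁ * (2 ^ k / ρ)) ^ d / ρ) := by
            gcongr
            exact (measure_mono hsub).trans (hA₂le ρ hρ y₀ hy₀.1 _ (by positivity))
        _ = _ := by
            rw [← ENNReal.ofReal_mul (by positivity)]
            congr 1
            rw [div_pow, mul_pow, mul_pow, div_pow, pow_succ (2 ^ k : ℝ), pow_succ ρ,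
              div_pow, one_pow]
            field_simp
  calc _ ≤ ∫⁻ y in levelShell R (ρ ^ 2), ∑' k, (W k).indicator
        (fun _ => ENNReal.ofReal (((a + 2) * ρ / 2 ^ k) ^ (d + 1))) y ∂vol :=
        setLIntegral_mono' (h.isClosed_levelShell _).measurableSet hpt
    _ ≤ ∫⁻ y, ∑' k, (W k).indicator
        (fun _ => ENNReal.ofReal (((a + 2) * ρ / 2 ^ k) ^ (d + 1))) y ∂vol :=
        setLIntegral_le_lintegral _ _
    _ = ∑' k, ENNReal.ofReal (((a + 2) * ρ / 2 ^ k) ^ (d + 1)) * vol (W k) := by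
        rw [lintegral_tsum fun k => (measurable_const.indicator (hWm k)).aemeasurable]
        simp_rw [lintegral_indicator_const (hWm _)]
    _ ≤ ∑' k : ℕ, ENNReal.ofReal ((a + 2) ^ (d + 1) * (A₂ * A₁ ^ d) * (1 / 2) ^ k) :=
        ENNReal.tsum_le_tsum hterm
    _ = _ := by
        rw [← ENNReal.ofReal_tsum_of_nonneg (fun k => by positivity)
          (summable_geometric_two.mul_left _), tsum_mul_left, tsum_geometric_two]

end Measure

end IsExpandingFlow

/-! ### The weak type estimate -/

/-- An increasing function `φ` with slope at least `k` makes `e^{-φ}` decay like `e^{-k s}` after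
the first time it is below the level `g`. -/
theorem setLIntegral_exp_neg_le {φ : ℝ → ℝ} (hφ : Continuous φ) {k T g : ℝ} (hk : 0 < k)
    (hgrow : ∀ s t, 0 ≤ s → s ≤ t → t ≤ T → k * (t - s) ≤ φ t - φ s) {S : Set ℝ}
    (hg : ∀ s ∈ Icc 0 T, s ∈ S → Real.exp (-φ s) ≤ g) :
    ∫⁻ s in Icc 0 T, S.indicator (fun s => ENNReal.ofReal (Real.exp (-φ s))) s ≤
      ENNReal.ofReal (g / k) := by
  rcases (Icc 0 T ∩ S).eq_empty_or_nonempty with he | hne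
  · rw [setLIntegral_congr_fun (g := fun _ => 0) measurableSet_Icc fun s hs =>
      indicator_of_notMem (fun hS => (he ▸ (⟨hs, hS⟩ : s ∈ Icc 0 T ∩ S) : s ∈ (∅ : Set ℝ))) _]
    simp
  have hbdd : BddBelow (Icc 0 T ∩ S) := ⟨0, fun s hs => hs.1.1⟩
  set s₀ := sInf (Icc 0 T ∩ S) with hs₀
  have hcl : s₀ ∈ closure (Icc 0 T ∩ S) := csInf_mem_closure hne hbdd
  have hs₀g : Real.exp (-φ s₀) ≤ g := by
    have hclosed : IsClosed {s | Real.exp (-φ s) ≤ g} :=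
      isClosed_le (Real.continuous_exp.comp hφ.neg) continuous_const
    exact hclosed.closure_subset_iff.2 (fun s hs => hg s hs.1 hs.2) hcl
  have hs₀0 : 0 ≤ s₀ := Real.sInf_nonneg fun s hs => hs.1.1
  have hg0 : 0 ≤ g := (Real.exp_pos _).le.trans hs₀g
  have hpt : ∀ s ∈ Icc 0 T, S.indicator (fun s => ENNReal.ofReal (Real.exp (-φ s))) s ≤
      (Ici s₀).indicator
        (fun s => ENNReal.ofReal (g * Real.exp (k * s₀) * Real.exp (-k * s))) s := by
    intro s hs
    by_cases hS : s ∈ S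
    · have hle : s₀ ≤ s := csInf_le hbdd ⟨hs, hS⟩
      rw [indicator_of_mem hS, indicator_of_mem (mem_Ici.2 hle)]
      refine ENNReal.ofReal_le_ofReal ?_
      have := hgrow s₀ s hs₀0 hle hs.2
      calc Real.exp (-φ s) ≤ Real.exp (-φ s₀ + (k * s₀ + -k * s)) :=
            Real.exp_le_exp.2 (by linarith)
        _ = Real.exp (-φ s₀) * Real.exp (k * s₀) * Real.exp (-k * s) := by
            rw [Real.exp_add, Real.exp_add, mul_assoc]
        _ ≤ _ := by gcongr
    · rw [indicator_of_notMem hS]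
      exact zero_le
  calc _ ≤ ∫⁻ s in Icc 0 T, (Ici s₀).indicator
        (fun s => ENNReal.ofReal (g * Real.exp (k * s₀) * Real.exp (-k * s))) s :=
        setLIntegral_mono' measurableSet_Icc hpt
    _ ≤ ∫⁻ s, (Ici s₀).indicator
        (fun s => ENNReal.ofReal (g * Real.exp (k * s₀) * Real.exp (-k * s))) s :=
        setLIntegral_le_lintegral _ _
    _ = ∫⁻ s in Ioi s₀, ENNReal.ofReal (g * Real.exp (k * s₀) * Real.exp (-k * s)) := by
        rw [lintegral_indicator measurableSet_Ici]
        exact setLIntegral_congr Ioi_ae_eq_Ici.symm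
    _ = ENNReal.ofReal (g / k) := by
        rw [← ofReal_integral_eq_lintegral_ofReal
          ((integrableOn_exp_mul_Ioi (by linarith : -k < 0) s₀).const_mul _)
          (Filter.Eventually.of_forall fun s => by positivity),
          integral_const_mul, integral_exp_mul_Ioi (by linarith : -k < 0)]
        congr 1
        have : Real.exp (k * s₀) * Real.exp (-k * s₀) = 1 := by
          rw [← Real.exp_add]; simp
        field_simp
        rw [show -(k * s₀) = -k * s₀ by ring]
        linear_combination g * this

theorem exists_one_add_pow_mul_exp_neg_le (m : ℕ) {a : ℝ} (ha : 0 < a) :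
    ∃ A : ℝ, 0 < A ∧ ∀ z : ℝ, 0 ≤ z → (1 + z) ^ m * Real.exp (-a * z ^ 2) ≤ A := by
  obtain ⟨A, hA, hle⟩ := exists_pow_mul_exp_neg_sq_le m ha
  refine ⟨2 ^ m * (1 + A), by positivity, fun z hz => ?_⟩
  have h1 : (1 + z) ^ m ≤ 2 ^ m * (1 + z ^ m) := by
    have := add_pow_le zero_le_one hz m
    rw [one_pow] at this
    refine this.trans ?_
    gcongr
    · norm_num
    · omega
  have h2 : Real.exp (-a * z ^ 2) ≤ 1 :=
    Real.exp_le_one_iff.2 (by rw [neg_mul]; exact neg_nonpos.2 (by positivity))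
  calc _ ≤ 2 ^ m * (1 + z ^ m) * Real.exp (-a * z ^ 2) := by gcongr
    _ = 2 ^ m * (Real.exp (-a * z ^ 2) + z ^ m * Real.exp (-a * z ^ 2)) := by ring
    _ ≤ _ := by gcongr; exact hle z hz

namespace IsExpandingFlow

variable {R : E → ℝ} {D : ℝ → E →L[ℝ] E} {T c C : ℝ}

theorem R_nonneg (h : IsExpandingFlow R D T c C) (x : E) : 0 ≤ R x :=
  (mul_nonneg h.c_pos.le (sq_nonneg _)).trans (h.le_R x)

theorem exists_one_add_norm_pow_le (h : IsExpandingFlow R D T c C) (m : ℕ) :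
    ∃ A : ℝ, 0 < A ∧ ∀ x : E, (1 + ‖x‖) ^ m ≤ A * Real.exp (R x / 2) := by
  obtain ⟨A, hA, hle⟩ := exists_one_add_pow_mul_exp_neg_le m (half_pos h.c_pos)
  refine ⟨A, hA, fun x => ?_⟩
  have h1 := hle ‖x‖ (norm_nonneg x)
  have h2 : Real.exp (-(R x / 2)) ≤ Real.exp (-(c / 2) * ‖x‖ ^ 2) :=
    Real.exp_le_exp.2 (by linarith [h.le_R x])
  rw [← div_le_iff₀ (Real.exp_pos _), div_eq_mul_inv, ← Real.exp_neg]
  exact le_trans (by gcongr) h1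

/-- An orbit which starts high enough spends a time of order `1 / β` in the shell at level `β`
when it is followed backwards. -/
theorem exists_le_time_in_levelShell (h : IsExpandingFlow R D T c C) :
    ∃ w : ℝ, 0 < w ∧ ∀ ρ : ℝ, 1 ≤ ρ → ∀ x : E, ρ ^ 2 + 1 ≤ R x → R x ≤ 8 * ρ ^ 2 →
      ENNReal.ofReal (w / ρ ^ 2) ≤
        ∫⁻ s in Icc 0 (T - 1), (levelShell R (ρ ^ 2)).indicator 1 (D (-s) x) := by
  have hC := h.C_pos
  have hc := h.c_pos
  have hT := h.two_le
  set w : ℝ := min 1 (c / (2 * C ^ 2 * (1 + C))) with hw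
  have hw0 : 0 < w := lt_min one_pos (by positivity)
  refine ⟨w, hw0, fun ρ hρ x hx1 hx2 => ?_⟩
  have hρ0 : 0 < ρ := one_pos.trans_le hρ
  have hρ1 : 1 ≤ ρ ^ 2 := one_le_pow₀ hρ
  have hlow : R (D (-(T - 2)) x) ≤ ρ ^ 2 + 1 := by
    have := h.escape (D (-(T - 2)) x)
    rw [h.flow_flow_neg] at this
    linarith
  have hcont : Continuous fun s : ℝ => R (D (-s) x) :=
    h.continuous_R.comp (h.continuous_flow.comp (continuous_neg.prodMk continuous_const))
  obtain ⟨s₁, hs₁, hval⟩ : ∃ s₁ ∈ Icc 0 (T - 2), R (D (-s₁) x) = ρ ^ 2 + 1 := by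
    have := intermediate_value_Icc' (by linarith : (0 : ℝ) ≤ T - 2) hcont.continuousOn
    refine this ⟨hlow, ?_⟩
    simpa [h.flow_zero] using hx1
  set x₁ := D (-s₁) x with hx₁
  have hw1 : w / ρ ^ 2 ≤ 1 := by
    rw [div_le_one (by positivity)]
    exact (min_le_left _ _).trans hρ1
  have hx₁n : ‖x₁‖ ^ 2 ≤ 2 * ρ ^ 2 / c := by
    rw [le_div_iff₀ hc]
    have := h.le_R x₁
    linarith
  have hin : ∀ s ∈ Icc s₁ (s₁ + w / ρ ^ 2), D (-s) x ∈ levelShell R (ρ ^ 2) := by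
    intro s hs
    set δ := s - s₁ with hδ
    have hδ0 : 0 ≤ δ := by linarith [hs.1]
    have hδw : δ ≤ w / ρ ^ 2 := by linarith [hs.2]
    have e0 : D (-s) x = D (-δ) x₁ := by
      rw [hx₁, ← h.flow_add]; congr 2; ring
    rw [e0]
    have hmem : -δ ∈ Icc (-T) T := ⟨by linarith, by linarith⟩
    have g1 := h.growth (-δ) 0 x₁ (by linarith) (by linarith) (by linarith)
    rw [h.flow_zero] at g1
    have g2 : 0 ≤ c * (0 - -δ) * ‖x₁‖ ^ 2 := by
      rw [zero_sub, neg_neg]; positivity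
    have g3 : R x₁ - R (D (-δ) x₁) ≤ 1 := by
      refine (le_abs_self _).trans ((h.abs_R_sub_le _ _).trans ?_)
      have n1 := h.norm_flow_sub_le (-δ) hmem 0 ⟨by linarith, by linarith⟩ x₁
      rw [h.flow_zero, zero_sub, neg_neg, abs_of_nonneg hδ0] at n1
      have n2 := h.norm_flow_le (-δ) hmem x₁
      calc C * ‖x₁ - D (-δ) x₁‖ * (‖x₁‖ + ‖D (-δ) x₁‖)
          ≤ C * (C * δ * ‖x₁‖) * (‖x₁‖ + C * ‖x₁‖) := by gcongr
        _ = C ^ 2 * (1 + C) * δ * ‖x₁‖ ^ 2 := by ring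
        _ ≤ C ^ 2 * (1 + C) * (w / ρ ^ 2) * (2 * ρ ^ 2 / c) := by gcongr
        _ = 2 * C ^ 2 * (1 + C) / c * w := by field_simp
        _ ≤ 2 * C ^ 2 * (1 + C) / c * (c / (2 * C ^ 2 * (1 + C))) := by
            gcongr; exact min_le_right _ _
        _ = 1 := by field_simp
    constructor
    · linarith
    · linarith
  calc ENNReal.ofReal (w / ρ ^ 2) = ∫⁻ s in Icc s₁ (s₁ + w / ρ ^ 2), 1 := by
        rw [setLIntegral_one, Real.volume_Icc]; congr 1; ring
    _ = ∫⁻ s in Icc s₁ (s₁ + w / ρ ^ 2), (levelShell R (ρ ^ 2)).indicator 1 (D (-s) x) :=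
        setLIntegral_congr_fun measurableSet_Icc fun s hs => by
          rw [indicator_of_mem (hin s hs)]; rfl
    _ ≤ _ := lintegral_mono_set (Icc_subset_Icc hs₁.1 (by linarith [hs₁.2]))

variable [FiniteDimensional ℝ E] [MeasurableSpace E] [BorelSpace E]
  (vol : Measure E) [vol.IsAddHaarMeasure]

theorem lintegral_exp_neg_half_lt_top (h : IsExpandingFlow R D T c C) :
    ∫⁻ x, ENNReal.ofReal (Real.exp (-(R x / 2))) ∂vol < ⊤ := by
  obtain ⟨A, hA, hle⟩ := h.exists_one_add_norm_pow_le (Module.finrank ℝ E + 1)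
  have hint : Integrable (fun x : E => A * (1 + ‖x‖) ^ (-((Module.finrank ℝ E : ℝ) + 1))) vol :=
    (integrable_one_add_norm (by linarith)).const_mul A
  refine lt_of_le_of_lt (lintegral_mono fun x => ENNReal.ofReal_le_ofReal ?_) hint.lintegral_lt_top
  have h1 : 0 < 1 + ‖x‖ := by positivity
  have h2 : (1 + ‖x‖) ^ (-((Module.finrank ℝ E : ℝ) + 1)) =
      ((1 + ‖x‖) ^ (Module.finrank ℝ E + 1))⁻¹ := by
    rw [Real.rpow_neg h1.le, ← Nat.cast_succ, Real.rpow_natCast]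
  rw [h2, ← div_eq_mul_inv, le_div_iff₀ (by positivity), Real.exp_neg, mul_comm,
    ← div_eq_mul_inv, div_le_iff₀ (Real.exp_pos _)]
  exact hle x

theorem lintegral_comp_flow_neg_le (h : IsExpandingFlow R D T c C) {s : ℝ}
    (hs : s ∈ Icc (-T) T) {g : E → ℝ≥0∞} (hg : Measurable g) :
    ∫⁻ x, g (D (-s) x) ∂vol ≤ ENNReal.ofReal C * ∫⁻ y, g y ∂vol := by
  have hmap := Measure.map_linearMap_addHaar_eq_smul_addHaar vol (h.det_ne_zero (-s))
  have hdet : LinearMap.det (D (-s) : E →ₗ[ℝ] E) * LinearMap.det (D s : E →ₗ[ℝ] E) = 1 := by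
    have : (D (-s) : E →ₗ[ℝ] E) ∘ₗ (D s : E →ₗ[ℝ] E) = LinearMap.id := by
      ext x
      simpa using h.flow_neg_flow s x
    rw [← LinearMap.det_comp, this, LinearMap.det_id]
  have e1 : ∫⁻ x, g (D (-s) x) ∂vol =
      ∫⁻ y, g y ∂(vol.map (D (-s) : E →ₗ[ℝ] E)) :=
    (lintegral_map hg (D (-s)).continuous.measurable).symm
  rw [e1, hmap, lintegral_smul_measure, smul_eq_mul]
  gcongr
  rw [← eq_inv_of_mul_eq_one_right hdet]
  exact h.abs_det_le s hs

end IsExpandingFlow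

/-- The global part of `totalKernel`, where the levels of the two points differ by at least one. -/
def globalKernel (R : E → ℝ) (D : ℝ → E →L[ℝ] E) (n : ℕ) (a : ℝ) (x u : E) : ℝ≥0∞ :=
  {p : E × E | 1 ≤ |R p.1 - R p.2|}.indicator (fun p => totalKernel D n a p.1 p.2) (x, u)

namespace IsExpandingFlow

variable {R : E → ℝ} {D : ℝ → E →L[ℝ] E} {T c C : ℝ}

theorem globalKernel_le {n : ℕ} {a : ℝ} {x u : E} {b : ℝ≥0∞}
    (hb : 1 ≤ |R x - R u| → totalKernel D n a x u ≤ b) : globalKernel R D n a x u ≤ b := by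
  unfold globalKernel
  by_cases hxu : 1 ≤ |R x - R u|
  · rw [indicator_of_mem (by exact hxu)]
    exact hb hxu
  · rw [indicator_of_notMem (by exact hxu)]
    exact zero_le

variable [MeasurableSpace E] [BorelSpace E]

theorem measurable_globalKernel [SecondCountableTopology E] (h : IsExpandingFlow R D T c C)
    (n : ℕ) (a : ℝ) :
    Measurable fun p : E × E => globalKernel R D n a p.1 p.2 := by
  refine (h.measurable_totalKernel n a).indicator (measurableSet_le measurable_const ?_)
  exact (((h.continuous_R.comp continuous_fst).sub (h.continuous_R.comp continuous_snd)).abs).measurable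

variable [FiniteDimensional ℝ E] (vol : Measure E) [vol.IsAddHaarMeasure]

/-- The middle part of the level set. Every point of it is reached, along the flow, from the shell
at level `β = ρ²`; on each orbit the kernel is at most its supremum over the orbit, and
`e^{-R}` is integrated from the first time at which the orbit enters the level set. -/
theorem exists_setLIntegral_exp_neg_le (h : IsExpandingFlow R D T c C) {d : ℕ}
    (hd : Module.finrank ℝ E = d + 1) {a : ℝ} (ha : 0 < a) :
    ∃ A : ℝ, 0 < A ∧ ∀ (ν : Measure E) [IsFiniteMeasure ν] (α : ℝ), 0 < α → ∀ ρ : ℝ, C ≤ ρ →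
      ∫⁻ x in {x | ENNReal.ofReal α < ENNReal.ofReal (Real.exp (R x)) *
          ∫⁻ u, globalKernel R D (d + 1) a x u ∂ν} ∩ {x | ρ ^ 2 + 1 ≤ R x ∧ R x ≤ 8 * ρ ^ 2},
        ENNReal.ofReal (Real.exp (-R x)) ∂vol ≤ ENNReal.ofReal (A / α) * ν univ := by
  have hC := h.C_pos
  have hc := h.c_pos
  have hT := h.two_le
  obtain ⟨w, hw, hwle⟩ := h.exists_le_time_in_levelShell
  obtain ⟨A₁, hA₁, hA₁le⟩ := h.exists_totalKernel_le_orbitDist (d + 1) ha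
  obtain ⟨A₂, hA₂, hA₂le⟩ := h.exists_lintegral_orbitDist_le vol hd
  refine ⟨C * (C ^ 2 / c) * (A₁ * A₂) / w, by positivity, ?_⟩
  intro ν _ α hα ρ hρC
  have hρ1 : 1 ≤ ρ := h.one_le.trans hρC
  have hρ0 : 0 < ρ := one_pos.trans_le hρ1
  set G : E → ℝ≥0∞ := fun x => ∫⁻ u, globalKernel R D (d + 1) a x u ∂ν with hG
  have hGm : Measurable G := (h.measurable_globalKernel (d + 1) a).lintegral_prod_right'
  have hRm : Measurable R := h.continuous_R.measurable
  set e : E → ℝ≥0∞ := fun x => ENNReal.ofReal (Real.exp (-R x)) with he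
  have hem : Measurable e := (Real.measurable_exp.comp hRm.neg).ennreal_ofReal
  set S : Set E := {x | ENNReal.ofReal α < ENNReal.ofReal (Real.exp (R x)) * G x} ∩
    {x | ρ ^ 2 + 1 ≤ R x ∧ R x ≤ 8 * ρ ^ 2} with hS
  have hSm : MeasurableSet S :=
    (measurableSet_lt measurable_const
      ((Real.measurable_exp.comp hRm).ennreal_ofReal.mul hGm)).inter
    ((measurableSet_le measurable_const hRm).inter (measurableSet_le hRm measurable_const))
  set W := levelShell R (ρ ^ 2) with hW
  have hWm : MeasurableSet W := (h.isClosed_levelShell _).measurableSet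
  set I := Icc 0 (T - 1) with hI
  set P : E → E → ℝ≥0∞ := fun y u =>
    ENNReal.ofReal (1 / (orbitDist D T y u + 1 / ‖y‖) ^ (d + 1)) with hP
  have hPm : Measurable fun p : E × E => P p.1 p.2 := by
    have h1 := h.continuous_orbitDist.measurable
    have h2 : Measurable fun p : E × E => ‖p.1‖ := measurable_norm.comp measurable_fst
    exact (measurable_const.div ((h1.add (measurable_const.div h2)).pow_const _)).ennreal_ofReal
  have hFm : Measurable (S.indicator e) := hem.indicator hSm
  have hflow : Measurable fun p : ℝ × E => D p.1 p.2 := h.continuous_flow.measurable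
  -- integration along one orbit
  have horbit : ∀ y ∈ W, ∫⁻ s in I, S.indicator e (D s y) ≤
      ENNReal.ofReal (C ^ 2 / c * A₁ / (ρ ^ 2 * α)) * ∫⁻ u, P y u ∂ν := by
    intro y hy
    have n1 := h.le_norm_of_mem_levelShell hy
    have hy1 : 1 ≤ ‖y‖ := by
      have : C * 1 ≤ C * ‖y‖ := by linarith
      exact le_of_mul_le_mul_left this hC
    rcases eq_or_ne (∫⁻ u, P y u ∂ν) ⊤ with htop | htop
    · rw [htop, ENNReal.mul_top (by simpa using by positivity)]
      exact le_top
    obtain ⟨q, hq⟩ : ∃ q : ℝ, (∫⁻ u, P y u ∂ν) = ENNReal.ofReal q ∧ 0 ≤ q :=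
      ⟨_, (ENNReal.ofReal_toReal htop).symm, ENNReal.toReal_nonneg⟩
    obtain ⟨hq, hq0⟩ := hq
    have hGle : ∀ s ∈ I, G (D s y) ≤ ENNReal.ofReal (A₁ * q) := by
      intro s hs
      calc G (D s y) ≤ ∫⁻ u, ENNReal.ofReal A₁ * P y u ∂ν := by
            refine lintegral_mono fun u => globalKernel_le fun hxu => ?_
            rw [hP, ← ENNReal.ofReal_mul hA₁.le, mul_one_div]
            exact hA₁le y u hy1 s hs hxu
        _ = _ := by
            rw [lintegral_const_mul' _ _ ENNReal.ofReal_ne_top, hq, ENNReal.ofReal_mul hA₁.le]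
    have hcont : Continuous fun s : ℝ => R (D s y) :=
      h.continuous_R.comp (h.continuous_flow.comp (continuous_id.prodMk continuous_const))
    have hmain := setLIntegral_exp_neg_le (φ := fun s => R (D s y)) hcont
      (k := c * (ρ ^ 2 / C ^ 2)) (T := T - 1) (g := A₁ * q / α) (by positivity)
      (fun s t hs hst ht => by
        have h1 := h.growth s t y (by linarith) hst (by linarith)
        have h2 : ρ ^ 2 / C ^ 2 ≤ ‖y‖ ^ 2 := by
          rw [div_le_iff₀ (by positivity), mul_comm, ← mul_pow]
          gcongr
        have h3 : 0 ≤ t - s := by linarith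
        calc c * (ρ ^ 2 / C ^ 2) * (t - s) ≤ c * ‖y‖ ^ 2 * (t - s) := by gcongr
          _ = c * (t - s) * ‖y‖ ^ 2 := by ring
          _ ≤ _ := h1)
      (S := {s | D s y ∈ S})
      (fun s hs hsS => by
        have h1 : ENNReal.ofReal α < ENNReal.ofReal (Real.exp (R (D s y)) * (A₁ * q)) := by
          rw [ENNReal.ofReal_mul (Real.exp_pos _).le]
          refine lt_of_lt_of_le hsS.1 ?_
          gcongr
          exact hGle s hs
        have h2 := (ENNReal.ofReal_lt_ofReal_iff_of_nonneg hα.le).1 h1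
        rw [Real.exp_neg, inv_eq_one_div, div_le_div_iff₀ (Real.exp_pos _) hα]
        linarith)
    rw [hq, ← ENNReal.ofReal_mul (by positivity)]
    refine le_trans (le_of_eq ?_) (hmain.trans (le_of_eq ?_))
    · refine setLIntegral_congr_fun measurableSet_Icc fun s hs => ?_
      by_cases hsS : D s y ∈ S
      · rw [indicator_of_mem hsS, indicator_of_mem (by exact hsS)]
      · rw [indicator_of_notMem hsS, indicator_of_notMem (by exact hsS)]
    · congr 1
      field_simp
  -- averaging over the times at which the orbit is in the shell
  have havg : ENNReal.ofReal (w / ρ ^ 2) * ∫⁻ x in S, e x ∂vol ≤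
      ENNReal.ofReal C * ∫⁻ y in W, (∫⁻ s in I, S.indicator e (D s y)) ∂vol := by
    calc ENNReal.ofReal (w / ρ ^ 2) * ∫⁻ x in S, e x ∂vol
        = ∫⁻ x, ENNReal.ofReal (w / ρ ^ 2) * S.indicator e x ∂vol := by
          rw [lintegral_const_mul _ hFm, lintegral_indicator hSm]
      _ ≤ ∫⁻ x, (∫⁻ s in I, S.indicator e x * W.indicator 1 (D (-s) x)) ∂vol := by
          refine lintegral_mono fun x => ?_
          rw [lintegral_const_mul]
          · by_cases hx : x ∈ S
            · rw [mul_comm]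
              gcongr
              exact hwle ρ hρ1 x hx.2.1 hx.2.2
            · rw [indicator_of_notMem hx, mul_zero, zero_mul]
          · exact (measurable_one.indicator hWm).comp
              (hflow.comp (measurable_neg.prodMk measurable_const))
      _ = ∫⁻ s in I, ∫⁻ x, S.indicator e x * W.indicator 1 (D (-s) x) ∂vol := by
          refine lintegral_lintegral_swap (Measurable.aemeasurable ?_)
          exact (hFm.comp measurable_fst).mul ((measurable_one.indicator hWm).comp
            (hflow.comp (measurable_snd.neg.prodMk measurable_fst)))
      _ ≤ ∫⁻ s in I, ENNReal.ofReal C *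
            ∫⁻ y, S.indicator e (D s y) * W.indicator 1 y ∂vol := by
          refine setLIntegral_mono' measurableSet_Icc fun s hs => ?_
          have hsT : s ∈ Icc (-T) T := ⟨by linarith [hs.1], by linarith [hs.2]⟩
          refine le_trans (le_of_eq ?_) (h.lintegral_comp_flow_neg_le vol hsT
            (g := fun y => S.indicator e (D s y) * W.indicator 1 y) ?_)
          · simp_rw [h.flow_flow_neg]
          · exact (hFm.comp (D s).continuous.measurable).mul (measurable_one.indicator hWm)
      _ = ENNReal.ofReal C * ∫⁻ y, (∫⁻ s in I, S.indicator e (D s y) * W.indicator 1 y) ∂vol := by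
          rw [lintegral_const_mul' _ _ ENNReal.ofReal_ne_top, lintegral_lintegral_swap]
          exact ((hFm.comp hflow).mul
            ((measurable_one.indicator hWm).comp measurable_snd)).aemeasurable
      _ = _ := by
          congr 1
          rw [← lintegral_indicator hWm]
          refine lintegral_congr fun y => ?_
          by_cases hy : y ∈ W
          · simp [indicator_of_mem hy]
          · simp [indicator_of_notMem hy]
  have hdouble : ∫⁻ y in W, ∫⁻ u, P y u ∂ν ∂vol ≤ ENNReal.ofReal A₂ * ν univ := by
    rw [lintegral_lintegral_swap hPm.aemeasurable, ← lintegral_const]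
    exact lintegral_mono fun u => hA₂le ρ hρ1 u
  have hfin : ENNReal.ofReal (w / ρ ^ 2) * ∫⁻ x in S, e x ∂vol ≤
      ENNReal.ofReal (w / ρ ^ 2) *
        (ENNReal.ofReal (C * (C ^ 2 / c) * (A₁ * A₂) / w / α) * ν univ) := by
    calc _ ≤ ENNReal.ofReal C * ∫⁻ y in W, (∫⁻ s in I, S.indicator e (D s y)) ∂vol := havg
      _ ≤ ENNReal.ofReal C * ∫⁻ y in W,
            ENNReal.ofReal (C ^ 2 / c * A₁ / (ρ ^ 2 * α)) * ∫⁻ u, P y u ∂ν ∂vol := by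
          gcongr 1
          exact setLIntegral_mono' hWm horbit
      _ ≤ ENNReal.ofReal C * (ENNReal.ofReal (C ^ 2 / c * A₁ / (ρ ^ 2 * α)) *
            (ENNReal.ofReal A₂ * ν univ)) := by
          rw [lintegral_const_mul' _ _ ENNReal.ofReal_ne_top]
          gcongr
      _ = _ := by
          rw [← mul_assoc, ← mul_assoc, ← mul_assoc, ← ENNReal.ofReal_mul (by positivity),
            ← ENNReal.ofReal_mul (by positivity), ← ENNReal.ofReal_mul (by positivity)]
          congr 2
          field_simp
  exact (ENNReal.mul_le_mul_iff_right (by simpa using by positivity) ENNReal.ofReal_ne_top).1 hfin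

/-- The operator with kernel `e^{R(x)} globalKernel` is of weak type `(1, 1)` for the measure
`e^{-R} dx`, also when it acts on measures `ν`. -/
theorem exists_weak_type (h : IsExpandingFlow R D T c C) {d : ℕ}
    (hd : Module.finrank ℝ E = d + 1) {a : ℝ} (ha : 0 < a) :
    ∃ A : ℝ, 0 < A ∧ ∀ (ν : Measure E) [IsFiniteMeasure ν] (α : ℝ), 0 < α →
      vol.withDensity (fun x => ENNReal.ofReal (Real.exp (-R x)))
        {x | ENNReal.ofReal α < ENNReal.ofReal (Real.exp (R x)) *
          ∫⁻ u, globalKernel R D (d + 1) a x u ∂ν} ≤ ENNReal.ofReal (A / α) * ν univ := by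
  have hC := h.C_pos
  have hc := h.c_pos
  obtain ⟨A₀, hA₀, hA₀le⟩ := h.exists_setLIntegral_exp_neg_le vol hd ha
  obtain ⟨A₁, hA₁, hA₁le⟩ := h.exists_totalKernel_le_pow (d + 1) ha
  obtain ⟨A₂, hA₂, hA₂le⟩ := h.exists_one_add_norm_pow_le (d + 1 + 3)
  obtain ⟨Z, hZ, hZ0⟩ : ∃ Z : ℝ, (∫⁻ x, ENNReal.ofReal (Real.exp (-(R x / 2))) ∂vol) =
      ENNReal.ofReal Z ∧ 0 ≤ Z :=
    ⟨_, (ENNReal.ofReal_toReal (h.lintegral_exp_neg_half_lt_top vol).ne).symm,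
      ENNReal.toReal_nonneg⟩
  -- levels `α` above `exp (2 B) * ν univ` are large enough for the geometric argument
  set B : ℝ := max (C ^ 2 + 1) (2 * Real.log (A₁ * A₂)) with hB
  refine ⟨Z * Real.exp (2 * B) + A₀ + Z, by positivity, fun ν _ α hα => ?_⟩
  set G : E → ℝ≥0∞ := fun x => ∫⁻ u, globalKernel R D (d + 1) a x u ∂ν with hG
  have hGm : Measurable G := (h.measurable_globalKernel (d + 1) a).lintegral_prod_right'
  have hRm : Measurable R := h.continuous_R.measurable
  set S : Set E := {x | ENNReal.ofReal α < ENNReal.ofReal (Real.exp (R x)) * G x} with hS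
  have hSm : MeasurableSet S := measurableSet_lt measurable_const
      ((Real.measurable_exp.comp hRm).ennreal_ofReal.mul hGm)
  rw [withDensity_apply _ hSm]
  obtain ⟨M, hM, hM0⟩ : ∃ M : ℝ, ν univ = ENNReal.ofReal M ∧ 0 ≤ M :=
    ⟨_, (ENNReal.ofReal_toReal (measure_ne_top ν univ)).symm, ENNReal.toReal_nonneg⟩
  have hexp : ∀ x, ENNReal.ofReal (Real.exp (-R x)) ≤ ENNReal.ofReal (Real.exp (-(R x / 2))) :=
    fun x => ENNReal.ofReal_le_ofReal (Real.exp_le_exp.2 (by linarith [h.R_nonneg x]))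
  rcases le_or_gt α (Real.exp (2 * B) * M) with hsmall | hlarge
  · calc ∫⁻ x in S, ENNReal.ofReal (Real.exp (-R x)) ∂vol
        ≤ ENNReal.ofReal Z := by
          rw [← hZ]
          exact (setLIntegral_le_lintegral _ _).trans (lintegral_mono hexp)
      _ ≤ _ := by
          rw [hM, ← ENNReal.ofReal_mul (by positivity)]
          refine ENNReal.ofReal_le_ofReal ?_
          rw [div_mul_eq_mul_div, le_div_iff₀ hα]
          have : 0 ≤ (A₀ + Z) * M := by positivity
          nlinarith
  have hGle : ∀ x, G x ≤ ENNReal.ofReal (A₁ * A₂ * Real.exp (R x / 2) * M) := by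
    intro x
    calc G x ≤ ∫⁻ u, ENNReal.ofReal (A₁ * A₂ * Real.exp (R x / 2)) ∂ν := by
          refine lintegral_mono fun u => globalKernel_le fun hxu => ?_
          refine (hA₁le x u hxu).trans (ENNReal.ofReal_le_ofReal ?_)
          rw [mul_assoc]
          gcongr
          exact hA₂le x
      _ = _ := by rw [lintegral_const, hM, ← ENNReal.ofReal_mul (by positivity)]
  rcases hM0.eq_or_lt with hM00 | hMpos
  · have : S = ∅ := by
      refine eq_empty_of_forall_notMem fun x hx => ?_
      have h0 := hGle x
      rw [← hM00, mul_zero, ENNReal.ofReal_zero, nonpos_iff_eq_zero] at h0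
      have hx : ENNReal.ofReal α < ENNReal.ofReal (Real.exp (R x)) * G x := hx
      rw [h0, mul_zero] at hx
      exact not_lt_zero hx
    rw [this]
    simp
  -- `L = α / ν univ = exp (2 (ρ² + 1))`
  set L := α / M with hL
  have hLpos : 0 < L := by positivity
  have hLB : B < Real.log L / 2 := by
    have : Real.exp (2 * B) < L := by rw [hL, lt_div_iff₀ hMpos]; exact hlarge
    have := (Real.lt_log_iff_exp_lt hLpos).2 this
    linarith
  have hB1 : C ^ 2 + 1 ≤ B := le_max_left _ _
  have hB2 : 2 * Real.log (A₁ * A₂) ≤ B := le_max_right _ _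
  set ρ := Real.sqrt (Real.log L / 2 - 1) with hρ
  have hρsq : ρ ^ 2 = Real.log L / 2 - 1 := Real.sq_sqrt (by linarith [sq_nonneg C])
  have hρC : C ≤ ρ := Real.le_sqrt_of_sq_le (by linarith)
  have hlogL : Real.log L = 2 * (ρ ^ 2 + 1) := by rw [hρsq]; ring
  have hLexp : L = Real.exp (2 * (ρ ^ 2 + 1)) := by rw [← hlogL, Real.exp_log hLpos]
  have hρ1 : 1 ≤ ρ ^ 2 := one_le_pow₀ (h.one_le.trans hρC)
  have hlow : ∀ x ∈ S, ρ ^ 2 + 1 ≤ R x := by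
    intro x hx
    by_contra hneg
    push Not at hneg
    have h1 : ENNReal.ofReal α < ENNReal.ofReal
        (Real.exp (R x) * (A₁ * A₂ * Real.exp (R x / 2) * M)) := by
      rw [ENNReal.ofReal_mul (Real.exp_pos _).le]
      refine lt_of_lt_of_le hx ?_
      gcongr
      exact hGle x
    have h2 := (ENNReal.ofReal_lt_ofReal_iff_of_nonneg hα.le).1 h1
    have h3 : L < A₁ * A₂ * (Real.exp (R x) * Real.exp (R x / 2)) := by
      rw [hL, div_lt_iff₀ hMpos]
      linarith
    have h4 : A₁ * A₂ ≤ Real.exp ((ρ ^ 2 + 1) / 2) := by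
      rw [← Real.log_le_iff_le_exp (by positivity)]
      linarith
    have h5 : A₁ * A₂ * (Real.exp (R x) * Real.exp (R x / 2)) ≤ L := by
      rw [hLexp, ← Real.exp_add]
      calc _ ≤ Real.exp ((ρ ^ 2 + 1) / 2) * Real.exp (R x + R x / 2) := by gcongr
        _ = Real.exp ((ρ ^ 2 + 1) / 2 + (R x + R x / 2)) := (Real.exp_add _ _).symm
        _ ≤ _ := Real.exp_le_exp.2 (by linarith)
    linarith
  have hcover : S ⊆ (S ∩ {x | ρ ^ 2 + 1 ≤ R x ∧ R x ≤ 8 * ρ ^ 2}) ∪ {x | 8 * ρ ^ 2 < R x} := by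
    intro x hx
    rcases le_or_gt (R x) (8 * ρ ^ 2) with hle | hlt
    · exact Or.inl ⟨hx, hlow x hx, hle⟩
    · exact Or.inr hlt
  have htail : ∫⁻ x in {x | 8 * ρ ^ 2 < R x}, ENNReal.ofReal (Real.exp (-R x)) ∂vol ≤
      ENNReal.ofReal (Z / α) * ν univ := by
    calc _ ≤ ∫⁻ x in {x | 8 * ρ ^ 2 < R x},
          ENNReal.ofReal L⁻¹ * ENNReal.ofReal (Real.exp (-(R x / 2))) ∂vol := by
          refine setLIntegral_mono' (measurableSet_lt measurable_const hRm) fun x hx => ?_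
          have hx : 8 * ρ ^ 2 < R x := hx
          rw [← ENNReal.ofReal_mul (by positivity), hLexp, ← Real.exp_neg, ← Real.exp_add]
          exact ENNReal.ofReal_le_ofReal (Real.exp_le_exp.2 (by linarith))
      _ ≤ ENNReal.ofReal L⁻¹ * ENNReal.ofReal Z := by
          rw [lintegral_const_mul' _ _ ENNReal.ofReal_ne_top, ← hZ]
          exact mul_le_mul' le_rfl (setLIntegral_le_lintegral _ _)
      _ = _ := by
          rw [hM, ← ENNReal.ofReal_mul (by positivity), ← ENNReal.ofReal_mul (by positivity), hL]
          congr 1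
          field_simp
  calc ∫⁻ x in S, ENNReal.ofReal (Real.exp (-R x)) ∂vol
      ≤ _ := (lintegral_mono_set hcover).trans (lintegral_union_le _ _ _)
    _ ≤ ENNReal.ofReal (A₀ / α) * ν univ + ENNReal.ofReal (Z / α) * ν univ :=
        add_le_add (hA₀le ν α hα ρ hρC) htail
    _ ≤ _ := by
        rw [← add_mul, ← ENNReal.ofReal_add (by positivity) (by positivity), ← add_div]
        gcongr
        have : 0 ≤ Z * Real.exp (2 * B) := by positivity
        linarith

end IsExpandingFlow

end Flow

/-! ### Exponential stability -/

section Stability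

open Filter Topology
open scoped Matrix.Norms.L2Operator

variable {n : ℕ}

theorem exp_mulVec_of_mulVec_eq_smul {A : Matrix (Fin n) (Fin n) ℂ} {v : Fin n → ℂ} {z : ℂ}
    (hv : A *ᵥ v = z • v) : NormedSpace.exp A *ᵥ v = Complex.exp z • v := by
  have hpow : ∀ k : ℕ, A ^ k *ᵥ v = z ^ k • v := by
    intro k
    induction k with
    | zero => simp
    | succ k ih => rw [pow_succ, ← Matrix.mulVec_mulVec, hv, Matrix.mulVec_smul, ih, smul_smul,
        pow_succ, mul_comm]
  have h1 := NormedSpace.exp_series_hasSum_exp' (𝕂 := ℂ) A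
  have h2 : HasSum (fun k => ((k.factorial : ℂ)⁻¹ • A ^ k) *ᵥ v) (NormedSpace.exp A *ᵥ v) :=
    h1.map (Matrix.mulVecBilin ℂ ℂ |>.flip v) (by
      exact LinearMap.continuous_of_finiteDimensional _)
  have h3 := (NormedSpace.exp_series_hasSum_exp' (𝕂 := ℂ) z).smul_const v
  rw [← Complex.exp_eq_exp_ℂ] at h3
  refine h2.unique ?_
  convert h3 using 2 with k
  rw [Matrix.smul_mulVec, hpow, smul_assoc]

/-- Half of the spectral mapping theorem for the exponential: an eigenspace of `exp A` is invariant
under `A`, hence contains an eigenvector of `A`. -/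
theorem exists_mem_spectrum_of_mem_spectrum_exp {A : Matrix (Fin n) (Fin n) ℂ} {μ : ℂ}
    (hμ : μ ∈ spectrum ℂ (NormedSpace.exp A)) : ∃ z ∈ spectrum ℂ A, μ = Complex.exp z := by
  rw [← Matrix.spectrum_toLin', ← Module.End.hasEigenvalue_iff_mem_spectrum] at hμ
  set g : Module.End ℂ (Fin n → ℂ) := Matrix.toLin' (NormedSpace.exp A) with hg
  set f : Module.End ℂ (Fin n → ℂ) := Matrix.toLin' A with hf
  have hcomm : Commute g f := by
    have : Commute (NormedSpace.exp A) A := (Commute.refl A).exp_left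
    rw [hg, hf, commute_iff_eq, Module.End.mul_eq_comp, Module.End.mul_eq_comp,
      ← Matrix.toLin'_mul, ← Matrix.toLin'_mul, this.eq]
  have hmaps : ∀ v ∈ g.eigenspace μ, f v ∈ g.eigenspace μ := by
    intro v hv
    rw [Module.End.mem_eigenspace_iff] at hv ⊢
    have : g (f v) = f (g v) := LinearMap.congr_fun hcomm.eq v
    rw [this, hv, map_smul]
  have hnt : Nontrivial (g.eigenspace μ) := Submodule.nontrivial_iff_ne_bot.2 hμ
  obtain ⟨z, hz⟩ := Module.End.exists_eigenvalue (f.restrict hmaps)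
  obtain ⟨⟨v, hvE⟩, hv⟩ := hz.exists_hasEigenvector
  have hv0 : v ≠ 0 := fun h0 => hv.2 (Subtype.ext h0)
  have hfv : A *ᵥ v = z • v := by
    have := congrArg Subtype.val hv.apply_eq_smul
    simpa [hf] using this
  have hgv : NormedSpace.exp A *ᵥ v = μ • v := by
    have := Module.End.mem_eigenspace_iff.1 hvE
    simpa [hg] using this
  refine ⟨z, ?_, ?_⟩
  · rw [← Matrix.spectrum_toLin', ← Module.End.hasEigenvalue_iff_mem_spectrum]
    exact Module.End.hasEigenvalue_of_hasEigenvector (x := v)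
      ⟨Module.End.mem_eigenspace_iff.2 (by simpa using hfv), hv0⟩
  · rw [exp_mulVec_of_mulVec_eq_smul hfv] at hgv
    exact (smul_left_injective ℂ hv0 hgv).symm

theorem tendsto_exp_pow {A : Matrix (Fin n) (Fin n) ℂ} (hA : ∀ z ∈ spectrum ℂ A, z.re < 0) :
    Tendsto (fun k : ℕ => NormedSpace.exp A ^ k) atTop (𝓝 0) := by
  rcases isEmpty_or_nonempty (Fin n) with hn | hn
  · have : (fun k : ℕ => NormedSpace.exp A ^ k) = fun _ => 0 := funext fun _ =>
      Matrix.ext fun i => (hn.false i).elim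
    rw [this]
    exact tendsto_const_nhds
  set M := NormedSpace.exp A
  have hr : spectralRadius ℂ M < (1 : NNReal) := by
    refine spectrum.spectralRadius_lt_of_forall_lt M fun μ hμ => ?_
    obtain ⟨z, hz, rfl⟩ := exists_mem_spectrum_of_mem_spectrum_exp hμ
    rw [← NNReal.coe_lt_coe, coe_nnnorm, Complex.norm_exp, NNReal.coe_one, Real.exp_lt_one_iff]
    exact hA z hz
  obtain ⟨q, hq1, hq2⟩ := exists_between hr
  have hG := spectrum.pow_nnnorm_pow_one_div_tendsto_nhds_spectralRadius M
  have hev := (hG.eventually_lt_const hq1).and (eventually_ge_atTop 1)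
  lift q to NNReal using (hq2.trans ENNReal.coe_lt_top).ne
  have hq2' : q < 1 := by exact_mod_cast hq2
  rw [tendsto_zero_iff_norm_tendsto_zero]
  refine squeeze_zero' (g := fun k : ℕ => (q : ℝ) ^ k) (Eventually.of_forall fun _ => norm_nonneg _)
    ?_ (tendsto_pow_atTop_nhds_zero_of_lt_one q.2 hq2')
  filter_upwards [hev] with k hk
  obtain ⟨hk1, hk2⟩ := hk
  have hk0 : (0 : ℝ) < k := by exact_mod_cast hk2
  have h1 := ENNReal.rpow_le_rpow hk1.le hk0.le
  rw [← ENNReal.rpow_mul, one_div_mul_cancel hk0.ne', ENNReal.rpow_one, ENNReal.rpow_natCast] at h1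
  have h2 : ‖M ^ k‖₊ ≤ q ^ k := by exact_mod_cast h1
  exact_mod_cast h2

theorem exists_norm_exp_smul_le {B : Matrix (Fin n) (Fin n) ℝ}
    (hB : ∀ z ∈ spectrum ℂ (B.map (algebraMap ℝ ℂ)), z.re < 0) :
    ∃ A q : ℝ, 0 < A ∧ 0 < q ∧ ∀ s : ℝ, 0 ≤ s →
      ‖NormedSpace.exp (s • B)‖ ≤ A * Real.exp (-q * s) := by
  let +nondep : NormedAlgebra ℚ (Matrix (Fin n) (Fin n) ℝ) := .restrictScalars ℚ ℝ _
  have hmap : NormedSpace.exp (B.map (algebraMap ℝ ℂ)) =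
      (NormedSpace.exp B).map (algebraMap ℝ ℂ) := by
    have hc : Continuous (RingHom.mapMatrix (m := Fin n) (algebraMap ℝ ℂ)) :=
      Continuous.matrix_map continuous_id Complex.continuous_ofReal
    exact (NormedSpace.map_exp (RingHom.mapMatrix (algebraMap ℝ ℂ)) hc B).symm
  have h1 : Tendsto (fun k : ℕ => NormedSpace.exp B ^ k) atTop (𝓝 0) := by
    have h2 := tendsto_exp_pow hB
    rw [hmap] at h2
    have h3 : Tendsto (fun k : ℕ => ((((NormedSpace.exp B).map (algebraMap ℝ ℂ)) ^ k).map
        Complex.re)) atTop (𝓝 ((0 : Matrix (Fin n) (Fin n) ℂ).map Complex.re)) :=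
      ((Continuous.matrix_map continuous_id Complex.continuous_re).tendsto 0).comp h2
    have h4 : ∀ k : ℕ, (((NormedSpace.exp B).map (algebraMap ℝ ℂ)) ^ k).map Complex.re =
        NormedSpace.exp B ^ k := by
      intro k
      have : ((NormedSpace.exp B).map (algebraMap ℝ ℂ)) ^ k =
          (NormedSpace.exp B ^ k).map (algebraMap ℝ ℂ) :=
        (map_pow (RingHom.mapMatrix (algebraMap ℝ ℂ)) (NormedSpace.exp B) k).symm
      rw [this]
      ext i j
      simp
    simp_rw [h4] at h3
    convert h3 using 2
    ext i j
    simp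
  have h5 := h1.norm
  rw [norm_zero] at h5
  obtain ⟨m, hm1, hm2⟩ := ((h5.eventually_lt_const (by norm_num : (0 : ℝ) < 1 / 2)).and
    (eventually_ge_atTop 1)).exists
  have hm0 : (0 : ℝ) < m := by exact_mod_cast hm2
  have hcont : Continuous fun s : ℝ => ‖NormedSpace.exp (s • B)‖ :=
    ((NormedSpace.exp_continuous).comp (continuous_id.smul continuous_const)).norm
  obtain ⟨A, hA⟩ := (isCompact_Icc (a := (0 : ℝ)) (b := m)).exists_bound_of_continuousOn
    hcont.continuousOn
  have hA' : ∀ s ∈ Icc (0 : ℝ) m, ‖NormedSpace.exp (s • B)‖ ≤ A := fun s hs => by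
    simpa using hA s hs
  have hA0 : 0 ≤ A := (norm_nonneg _).trans (hA' 0 ⟨le_rfl, hm0.le⟩)
  have hstep : ∀ k : ℕ, ∀ s ∈ Icc ((k : ℝ) * m) ((k + 1) * m),
      ‖NormedSpace.exp (s • B)‖ ≤ A * (1 / 2) ^ k := by
    intro k
    induction k with
    | zero =>
      intro s hs
      rw [pow_zero, mul_one]
      exact hA' s (by simpa using hs)
    | succ k ih =>
      intro s hs
      push_cast at hs
      have e : NormedSpace.exp (s • B) = NormedSpace.exp B ^ m * NormedSpace.exp ((s - m) • B) := by
        rw [← Matrix.exp_nsmul, ← Matrix.exp_add_of_commute]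
        · congr 1
          rw [← Nat.cast_smul_eq_nsmul ℝ, ← add_smul]
          congr 1; ring
        · exact ((Commute.refl B).smul_left _).smul_right _
      rw [e, pow_succ]
      have := ih (s - m) ⟨by linarith [hs.1], by linarith [hs.2]⟩
      calc _ ≤ ‖NormedSpace.exp B ^ m‖ * ‖NormedSpace.exp ((s - m) • B)‖ := norm_mul_le _ _
        _ ≤ (1 / 2) * (A * (1 / 2) ^ k) := by gcongr
        _ = _ := by ring
  refine ⟨2 * A + 1, Real.log 2 / m, by positivity, by positivity, fun s hs => ?_⟩
  set k := ⌊s / m⌋₊ with hk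
  have hk1 : (k : ℝ) ≤ s / m := Nat.floor_le (by positivity)
  have hk2 : s / m < k + 1 := Nat.lt_floor_add_one _
  refine (hstep k s ⟨(le_div_iff₀ hm0).1 hk1, ((div_lt_iff₀ hm0).1 hk2).le⟩).trans ?_
  have h6 : (1 / 2 : ℝ) ^ k ≤ 2 * Real.exp (-(Real.log 2 / m) * s) := by
    have e1 : (1 / 2 : ℝ) ^ k = Real.exp (-(Real.log 2) * k) := by
      rw [mul_comm, Real.exp_nat_mul, Real.exp_neg, Real.exp_log two_pos, one_div]
    have e2 : (2 : ℝ) * Real.exp (-(Real.log 2 / m) * s) =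
        Real.exp (Real.log 2 + -(Real.log 2 / m) * s) := by
      rw [Real.exp_add, Real.exp_log two_pos]
    rw [e1, e2]
    refine Real.exp_le_exp.2 ?_
    have : Real.log 2 * (s / m) ≤ Real.log 2 * (k + 1) :=
      mul_le_mul_of_nonneg_left hk2.le (Real.log_nonneg one_le_two)
    have e3 : Real.log 2 / m * s = Real.log 2 * (s / m) := by ring
    linarith
  calc A * (1 / 2) ^ k ≤ A * (2 * Real.exp (-(Real.log 2 / m) * s)) := by gcongr
    _ ≤ _ := by linarith [Real.exp_pos (-(Real.log 2 / m) * s)]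

end Stability

/-! ### Quadratic forms -/

section Matrices

open scoped Matrix.Norms.L2Operator

variable {n : ℕ}

theorem toEuclideanLin_mul_apply (A M : Matrix (Fin n) (Fin n) ℝ) (x : EuclideanSpace ℝ (Fin n)) :
    Matrix.toEuclideanLin (A * M) x = Matrix.toEuclideanLin A (Matrix.toEuclideanLin M x) := by
  rw [Matrix.toLpLin_mul_same]; rfl

theorem toEuclideanLin_one_apply (x : EuclideanSpace ℝ (Fin n)) :
    Matrix.toEuclideanLin (1 : Matrix (Fin n) (Fin n) ℝ) x = x := by
  rw [← Matrix.coe_toEuclideanCLM_eq_toEuclideanLin, map_one]; rfl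

theorem norm_toEuclideanLin_le (A : Matrix (Fin n) (Fin n) ℝ) (x : EuclideanSpace ℝ (Fin n)) :
    ‖Matrix.toEuclideanLin A x‖ ≤ ‖A‖ * ‖x‖ := by
  rw [← Matrix.coe_toEuclideanCLM_eq_toEuclideanLin]
  exact (Matrix.toEuclideanCLM (n := Fin n) (𝕜 := ℝ) A).le_opNorm x

theorem inner_toEuclideanLin (A : Matrix (Fin n) (Fin n) ℝ) (x y : EuclideanSpace ℝ (Fin n)) :
    inner ℝ (Matrix.toEuclideanLin A x) y = inner ℝ x (Matrix.toEuclideanLin Aᵀ y) := by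
  rw [← Matrix.conjTranspose_eq_transpose_of_trivial, Matrix.toEuclideanLin_conjTranspose_eq_adjoint,
    LinearMap.adjoint_inner_right]

theorem norm_transpose (A : Matrix (Fin n) (Fin n) ℝ) : ‖Aᵀ‖ = ‖A‖ := by
  rw [← Matrix.conjTranspose_eq_transpose_of_trivial, Matrix.l2_opNorm_conjTranspose]

theorem quadForm_add (M N : Matrix (Fin n) (Fin n) ℝ) (v : EuclideanSpace ℝ (Fin n)) :
    quadForm (M + N) v = quadForm M v + quadForm N v := by
  simp [quadForm, inner_add_left]

theorem quadForm_sub (M N : Matrix (Fin n) (Fin n) ℝ) (v : EuclideanSpace ℝ (Fin n)) :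
    quadForm (M - N) v = quadForm M v - quadForm N v := by
  simp [quadForm, inner_sub_left]

theorem quadForm_smul (M : Matrix (Fin n) (Fin n) ℝ) (r : ℝ) (v : EuclideanSpace ℝ (Fin n)) :
    quadForm M (r • v) = r ^ 2 * quadForm M v := by
  simp only [quadForm, map_smul, inner_smul_left, inner_smul_right]
  simp only [conj_trivial]
  ring

theorem abs_quadForm_le (M : Matrix (Fin n) (Fin n) ℝ) (v : EuclideanSpace ℝ (Fin n)) :
    |quadForm M v| ≤ ‖M‖ * ‖v‖ ^ 2 := by
  refine (abs_real_inner_le_norm _ _).trans ?_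
  rw [sq, ← mul_assoc]
  gcongr
  exact norm_toEuclideanLin_le M v

theorem continuous_quadForm (M : Matrix (Fin n) (Fin n) ℝ) : Continuous (quadForm M) :=
  ((LinearMap.continuous_of_finiteDimensional _).inner continuous_id)

theorem quadForm_mul_mul_transpose (A M : Matrix (Fin n) (Fin n) ℝ)
    (v : EuclideanSpace ℝ (Fin n)) :
    quadForm (A * M * Aᵀ) v = quadForm M (Matrix.toEuclideanLin Aᵀ v) := by
  unfold quadForm
  rw [mul_assoc, toEuclideanLin_mul_apply, inner_toEuclideanLin, toEuclideanLin_mul_apply]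

theorem quadForm_eq_dotProduct (M : Matrix (Fin n) (Fin n) ℝ) (v : EuclideanSpace ℝ (Fin n)) :
    quadForm M v = v.ofLp ⬝ᵥ M *ᵥ v.ofLp := by
  rw [quadForm, real_inner_comm, ← Matrix.inner_toEuclideanCLM]
  rfl

theorem posDef_iff_quadForm {M : Matrix (Fin n) (Fin n) ℝ} :
    M.PosDef ↔ Mᵀ = M ∧ ∀ v, v ≠ 0 → 0 < quadForm M v := by
  rw [Matrix.posDef_iff_dotProduct_mulVec, Matrix.IsHermitian,
    Matrix.conjTranspose_eq_transpose_of_trivial]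
  refine and_congr_right fun _ => ⟨fun h v hv => ?_, fun h v hv => ?_⟩
  · rw [quadForm_eq_dotProduct]
    exact h (x := v.ofLp) (by simpa using hv)
  · have := h (WithLp.toLp 2 v) (by simpa using hv)
    rwa [quadForm_eq_dotProduct] at this

theorem exists_le_quadForm {M : Matrix (Fin n) (Fin n) ℝ} (hM : M.PosDef) :
    ∃ m : ℝ, 0 < m ∧ ∀ v, m * ‖v‖ ^ 2 ≤ quadForm M v := by
  obtain ⟨-, hpos⟩ := posDef_iff_quadForm.1 hM
  obtain ⟨m, hm, hle⟩ : ∃ m : ℝ, 0 < m ∧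
      ∀ v ∈ Metric.sphere (0 : EuclideanSpace ℝ (Fin n)) 1, m ≤ quadForm M v := by
    rcases (Metric.sphere (0 : EuclideanSpace ℝ (Fin n)) 1).eq_empty_or_nonempty with he | hne
    · exact ⟨1, one_pos, fun v hv => by rw [he] at hv; exact hv.elim⟩
    · obtain ⟨v₀, hv₀, hmin⟩ := (isCompact_sphere _ _).exists_isMinOn hne
        (continuous_quadForm M).continuousOn
      refine ⟨_, hpos v₀ ?_, fun v hv => hmin hv⟩
      rintro rfl
      simp at hv₀
  refine ⟨m, hm, fun v => ?_⟩
  rcases eq_or_ne v 0 with rfl | hv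
  · simp [quadForm]
  have hv0 : 0 < ‖v‖ := norm_pos_iff.2 hv
  have h1 := hle (‖v‖⁻¹ • v) (by simp [norm_smul, hv0.ne'])
  rw [quadForm_smul, inv_pow, ← div_eq_inv_mul, le_div_iff₀ (by positivity)] at h1
  exact h1

/-- The inverse of a matrix with a positive lower bound for its quadratic form. -/
theorem norm_inv_le_of_le_quadForm {M : Matrix (Fin n) (Fin n) ℝ} (hM : IsUnit M.det) {m : ℝ}
    (hm : 0 < m) (hle : ∀ v, m * ‖v‖ ^ 2 ≤ quadForm M v) : ‖M⁻¹‖ ≤ 1 / m := by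
  rw [Matrix.cstar_norm_def]
  refine ContinuousLinearMap.opNorm_le_bound _ (by positivity) fun x => ?_
  change ‖Matrix.toEuclideanLin M⁻¹ x‖ ≤ _
  set y := Matrix.toEuclideanLin M⁻¹ x with hy
  have hx : Matrix.toEuclideanLin M y = x := by
    rw [hy, ← toEuclideanLin_mul_apply, Matrix.mul_nonsing_inv _ hM, toEuclideanLin_one_apply]
  have h1 := hle y
  have h2 : quadForm M y ≤ ‖x‖ * ‖y‖ := by
    rw [quadForm, hx]
    exact real_inner_le_norm _ _
  rcases (norm_nonneg y).eq_or_lt with h0 | h0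
  · rw [← h0]; positivity
  rw [div_mul_eq_mul_div, one_mul, le_div_iff₀ hm]
  refine le_of_mul_le_mul_right ?_ h0
  linarith

theorem pow_le_det_of_le_quadForm {M : Matrix (Fin n) (Fin n) ℝ} (hM : Mᵀ = M) {m : ℝ}
    (hm : 0 ≤ m) (hle : ∀ v, m * ‖v‖ ^ 2 ≤ quadForm M v) : m ^ n ≤ M.det := by
  have hH : M.IsHermitian := by
    rw [Matrix.IsHermitian, Matrix.conjTranspose_eq_transpose_of_trivial, hM]
  have hev : ∀ i, m ≤ hH.eigenvalues i := by
    intro i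
    have h1 := hle (hH.eigenvectorBasis i)
    rw [hH.eigenvectorBasis.orthonormal.1 i, quadForm_eq_dotProduct] at h1
    rw [hH.eigenvalues_eq i]
    simpa using h1
  rw [hH.det_eq_prod_eigenvalues]
  calc m ^ n = ∏ _i : Fin n, m := by simp
    _ ≤ ∏ i : Fin n, hH.eigenvalues i := Finset.prod_le_prod (fun _ _ => hm) fun i _ => hev i
    _ = _ := by simp

/-! ### The covariance matrices -/

variable (Q B : Matrix (Fin n) (Fin n) ℝ)

theorem exp_add_smul (s t : ℝ) :
    NormedSpace.exp ((s + t) • B) = NormedSpace.exp (s • B) * NormedSpace.exp (t • B) := by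
  rw [add_smul, Matrix.exp_add_of_commute]
  exact ((Commute.refl B).smul_left _).smul_right _

theorem exp_zero_smul : NormedSpace.exp ((0 : ℝ) • B) = 1 := by
  rw [zero_smul, NormedSpace.exp_zero]

theorem exp_neg_smul_mul (s : ℝ) : NormedSpace.exp ((-s) • B) * NormedSpace.exp (s • B) = 1 := by
  rw [← exp_add_smul, neg_add_cancel, exp_zero_smul]

theorem transpose_exp_smul (s : ℝ) :
    (NormedSpace.exp (s • B))ᵀ = NormedSpace.exp (s • Bᵀ) := by
  rw [← Matrix.exp_transpose, Matrix.transpose_smul]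

theorem continuous_exp_smul : Continuous fun s : ℝ => NormedSpace.exp (s • B) :=
  continuous_iff_continuousAt.2 fun s => (hasDerivAt_exp_smul_const (𝕂 := ℝ) B s).continuousAt

theorem exists_norm_exp_smul_le_of_abs_le (T : ℝ) :
    ∃ A : ℝ, 1 ≤ A ∧ ∀ s ∈ Icc (-T) T, ‖NormedSpace.exp (s • B)‖ ≤ A := by
  obtain ⟨A, hA⟩ := (isCompact_Icc (a := -T) (b := T)).exists_bound_of_continuousOn
    (continuous_exp_smul B).continuousOn
  exact ⟨max 1 A, le_max_left _ _, fun s hs => (hA s hs).trans (le_max_right _ _)⟩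

theorem covIntegrand_eq (s : ℝ) :
    covIntegrand Q B s = NormedSpace.exp (s • B) * Q * (NormedSpace.exp (s • B))ᵀ := by
  rw [covIntegrand, transpose_exp_smul]

theorem continuous_covIntegrand : Continuous (covIntegrand Q B) :=
  ((continuous_exp_smul B).mul continuous_const).mul (continuous_exp_smul Bᵀ)

theorem covMatrix_eq_integral (t : ℝ) :
    covMatrix Q B t = ∫ s in (0 : ℝ)..t, covIntegrand Q B s := by
  ext i j
  exact ContinuousLinearMap.intervalIntegral_comp_comm
    (LinearMap.toContinuousLinearMap (Matrix.entryLinearMap ℝ ℝ i j))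
    ((continuous_covIntegrand Q B).intervalIntegrable 0 t)

theorem hasDerivAt_covMatrix (t : ℝ) :
    HasDerivAt (covMatrix Q B) (covIntegrand Q B t) t := by
  have h : covMatrix Q B = fun t => ∫ s in (0 : ℝ)..t, covIntegrand Q B s :=
    funext (covMatrix_eq_integral Q B)
  rw [h]
  exact intervalIntegral.integral_hasDerivAt_right
    ((continuous_covIntegrand Q B).intervalIntegrable 0 t)
    ((continuous_covIntegrand Q B).stronglyMeasurableAtFilter _ _)
    (continuous_covIntegrand Q B).continuousAt

variable {Q B}

theorem integrableOn_covIntegrand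
    (hB : ∀ z ∈ spectrum ℂ (B.map (algebraMap ℝ ℂ)), z.re < 0) :
    IntegrableOn (covIntegrand Q B) (Ioi 0) := by
  obtain ⟨A, q, hA, hq, hle⟩ := exists_norm_exp_smul_le hB
  have h1 : IntegrableOn (fun s => A * ‖Q‖ * A * Real.exp (-(2 * q) * s)) (Ioi 0) :=
    (integrableOn_exp_mul_Ioi (by linarith) 0).const_mul _
  refine Integrable.mono' h1 (continuous_covIntegrand Q B).aestronglyMeasurable ?_
  refine (ae_restrict_iff' measurableSet_Ioi).2 (Filter.Eventually.of_forall fun s hs => ?_)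
  have hs' := hle s (le_of_lt hs)
  calc ‖covIntegrand Q B s‖ ≤ ‖NormedSpace.exp (s • B)‖ * ‖Q‖ * ‖(NormedSpace.exp (s • B))ᵀ‖ := by
        rw [covIntegrand_eq]
        exact (norm_mul_le _ _).trans (by gcongr; exact norm_mul_le _ _)
    _ ≤ A * Real.exp (-q * s) * ‖Q‖ * (A * Real.exp (-q * s)) := by
        rw [norm_transpose]; gcongr
    _ = A * ‖Q‖ * A * (Real.exp (-q * s) * Real.exp (-q * s)) := by ring
    _ = _ := by rw [← Real.exp_add]; congr 2; ring

theorem covMatrixInfty_eq_integral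
    (hB : ∀ z ∈ spectrum ℂ (B.map (algebraMap ℝ ℂ)), z.re < 0) :
    covMatrixInfty Q B = ∫ s in Ioi (0 : ℝ), covIntegrand Q B s := by
  ext i j
  exact ContinuousLinearMap.integral_comp_comm
    (LinearMap.toContinuousLinearMap (Matrix.entryLinearMap ℝ ℝ i j))
    (integrableOn_covIntegrand hB)

/-- The semigroup property `Q_∞ = Q_t + e^{tB} Q_∞ e^{tB*}` of the covariances. -/
theorem covMatrixInfty_eq_add
    (hB : ∀ z ∈ spectrum ℂ (B.map (algebraMap ℝ ℂ)), z.re < 0) {t : ℝ} (ht : 0 ≤ t) :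
    covMatrixInfty Q B = covMatrix Q B t +
      NormedSpace.exp (t • B) * covMatrixInfty Q B * (NormedSpace.exp (t • B))ᵀ := by
  have hint := integrableOn_covIntegrand (Q := Q) hB
  set L : Matrix (Fin n) (Fin n) ℝ →L[ℝ] Matrix (Fin n) (Fin n) ℝ :=
    (ContinuousLinearMap.mul ℝ _ (NormedSpace.exp (t • B))).comp
      ((ContinuousLinearMap.mul ℝ _).flip (NormedSpace.exp (t • B))ᵀ) with hL
  have hLapp : ∀ M, L M = NormedSpace.exp (t • B) * M * (NormedSpace.exp (t • B))ᵀ := by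
    intro M
    simp [hL, mul_assoc]
  have h1 : NormedSpace.exp (t • B) * covMatrixInfty Q B * (NormedSpace.exp (t • B))ᵀ =
      ∫ s in Ioi t, covIntegrand Q B s := by
    rw [← hLapp, covMatrixInfty_eq_integral hB, ← ContinuousLinearMap.integral_comp_comm L hint]
    have e1 : ∀ s, L (covIntegrand Q B s) = covIntegrand Q B (s + t) := by
      intro s
      rw [hLapp, covIntegrand_eq, covIntegrand_eq, add_comm s t, exp_add_smul,
        Matrix.transpose_mul]
      simp only [mul_assoc]
    simp_rw [e1]
    have e2 := (measurePreserving_add_right volume t).setIntegral_preimage_emb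
      (measurableEmbedding_addRight t) (covIntegrand Q B) (Ioi t)
    rwa [preimage_add_const_Ioi, sub_self] at e2
  rw [h1, covMatrixInfty_eq_integral hB, covMatrix_eq_integral,
    intervalIntegral.integral_of_le ht, ← setIntegral_union _ measurableSet_Ioi,
    Ioc_union_Ioi_eq_Ioi ht]
  · exact hint.mono_set Ioc_subset_Ioi_self
  · exact hint.mono_set (Ioi_subset_Ioi ht)
  · exact disjoint_left.2 fun x hx hx' => not_lt.2 hx.2 hx'

theorem transpose_covIntegrand (hQ : Qᵀ = Q) (s : ℝ) :
    (covIntegrand Q B s)ᵀ = covIntegrand Q B s := by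
  rw [covIntegrand_eq]
  simp [Matrix.transpose_mul, hQ, mul_assoc]

theorem transpose_covMatrix (hQ : Qᵀ = Q) (t : ℝ) : (covMatrix Q B t)ᵀ = covMatrix Q B t := by
  ext i j
  have : ∀ s, covIntegrand Q B s j i = covIntegrand Q B s i j := fun s =>
    congrFun (congrFun (transpose_covIntegrand (B := B) hQ s) i) j
  simp [covMatrix, this]

theorem transpose_covMatrixInfty (hQ : Qᵀ = Q) : (covMatrixInfty Q B)ᵀ = covMatrixInfty Q B := by
  ext i j
  have : ∀ s, covIntegrand Q B s j i = covIntegrand Q B s i j := fun s =>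
    congrFun (congrFun (transpose_covIntegrand (B := B) hQ s) i) j
  simp [covMatrixInfty, this]

/-- `quadForm M v` as a function of `M`. -/
def quadFormCLM (v : EuclideanSpace ℝ (Fin n)) : Matrix (Fin n) (Fin n) ℝ →L[ℝ] ℝ :=
  LinearMap.toContinuousLinearMap
    { toFun := fun M => quadForm M v
      map_add' := fun M N => quadForm_add M N v
      map_smul' := fun r M => by simp [quadForm, inner_smul_left] }

theorem exists_le_quadForm_covMatrix (hQ : Q.PosDef) (T : ℝ) :
    ∃ m : ℝ, 0 < m ∧ ∀ t ∈ Icc 0 T, ∀ v, m * t * ‖v‖ ^ 2 ≤ quadForm (covMatrix Q B t) v := by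
  obtain ⟨q, hq, hqle⟩ := exists_le_quadForm hQ
  obtain ⟨A, hA1, hA⟩ := exists_norm_exp_smul_le_of_abs_le Bᵀ T
  have hA0 : 0 < A := one_pos.trans_le hA1
  refine ⟨q / A ^ 2, by positivity, fun t ht v => ?_⟩
  have h1 : quadForm (covMatrix Q B t) v = ∫ s in (0 : ℝ)..t, quadForm (covIntegrand Q B s) v := by
    rw [covMatrix_eq_integral]
    exact (ContinuousLinearMap.intervalIntegral_comp_comm (quadFormCLM v)
      ((continuous_covIntegrand Q B).intervalIntegrable 0 t)).symm
  have hcont : Continuous fun s => quadForm (covIntegrand Q B s) v :=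
    (quadFormCLM v).continuous.comp (continuous_covIntegrand Q B)
  have h2 : ∀ s ∈ Icc 0 t, q / A ^ 2 * ‖v‖ ^ 2 ≤ quadForm (covIntegrand Q B s) v := by
    intro s hs
    rw [covIntegrand_eq, quadForm_mul_mul_transpose, transpose_exp_smul]
    refine le_trans ?_ (hqle _)
    have h3 : ‖v‖ ≤ A * ‖Matrix.toEuclideanLin (NormedSpace.exp (s • Bᵀ)) v‖ := by
      have e : v = Matrix.toEuclideanLin (NormedSpace.exp ((-s) • Bᵀ))
          (Matrix.toEuclideanLin (NormedSpace.exp (s • Bᵀ)) v) := by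
        rw [← toEuclideanLin_mul_apply, exp_neg_smul_mul, toEuclideanLin_one_apply]
      calc ‖v‖ = _ := congrArg norm e
        _ ≤ _ := norm_toEuclideanLin_le _ _
        _ ≤ _ := by
          gcongr
          exact hA (-s) ⟨by linarith [hs.2, ht.2], by linarith [hs.1, ht.1, ht.2]⟩
    rw [div_mul_eq_mul_div, div_le_iff₀ (by positivity), mul_assoc]
    gcongr
    rw [← mul_pow, mul_comm _ A]
    gcongr
  rw [h1]
  calc q / A ^ 2 * t * ‖v‖ ^ 2 = ∫ _s in (0 : ℝ)..t, q / A ^ 2 * ‖v‖ ^ 2 := by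
        rw [intervalIntegral.integral_const, smul_eq_mul]; ring
    _ ≤ _ := intervalIntegral.integral_mono_on ht.1 (by simp)
        (hcont.intervalIntegrable 0 t) h2

theorem exists_norm_covIntegrand_le (Q B : Matrix (Fin n) (Fin n) ℝ) (T : ℝ) :
    ∃ A : ℝ, 0 < A ∧ ∀ t ∈ Icc 0 T, ‖covIntegrand Q B t‖ ≤ A ∧ ‖covMatrix Q B t‖ ≤ A * t := by
  obtain ⟨A, hA⟩ := (isCompact_Icc (a := 0) (b := T)).exists_bound_of_continuousOn
    (continuous_covIntegrand Q B).continuousOn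
  refine ⟨max 1 A, by positivity, fun t ht => ?_⟩
  have h1 : ∀ s ∈ Icc 0 T, ‖covIntegrand Q B s‖ ≤ max 1 A := fun s hs =>
    (hA s hs).trans (le_max_right _ _)
  refine ⟨h1 t ht, ?_⟩
  rw [covMatrix_eq_integral]
  have := intervalIntegral.norm_integral_le_of_norm_le_const (a := 0) (b := t) (C := max 1 A)
    (f := covIntegrand Q B) fun s hs => h1 s (by
      rw [uIoc_of_le ht.1] at hs
      exact ⟨hs.1.le, hs.2.trans ht.2⟩)
  rwa [sub_zero, abs_of_nonneg ht.1] at this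

theorem posDef_covMatrix (hQ : Q.PosDef) {t : ℝ} (ht : 0 < t) : (covMatrix Q B t).PosDef := by
  obtain ⟨m, hm, hle⟩ := exists_le_quadForm_covMatrix (B := B) hQ t
  refine posDef_iff_quadForm.2 ⟨transpose_covMatrix (posDef_iff_quadForm.1 hQ).1 t, fun v hv => ?_⟩
  have : 0 < ‖v‖ := norm_pos_iff.2 hv
  exact lt_of_lt_of_le (by positivity) (hle t ⟨ht.le, le_rfl⟩ v)

theorem quadForm_covMatrixInfty_eq_add
    (hB : ∀ z ∈ spectrum ℂ (B.map (algebraMap ℝ ℂ)), z.re < 0) {t : ℝ} (ht : 0 ≤ t)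
    (v : EuclideanSpace ℝ (Fin n)) :
    quadForm (covMatrixInfty Q B) v = quadForm (covMatrix Q B t) v +
      quadForm (covMatrixInfty Q B) (Matrix.toEuclideanLin (NormedSpace.exp (t • Bᵀ)) v) := by
  conv_lhs => rw [covMatrixInfty_eq_add hB ht]
  rw [quadForm_add, quadForm_mul_mul_transpose, transpose_exp_smul]

theorem posDef_covMatrixInfty (hQ : Q.PosDef)
    (hB : ∀ z ∈ spectrum ℂ (B.map (algebraMap ℝ ℂ)), z.re < 0) :
    (covMatrixInfty Q B).PosDef := by
  have hQt := (posDef_iff_quadForm.1 hQ).1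
  have hnonneg : ∀ v, 0 ≤ quadForm (covMatrixInfty Q B) v := by
    intro v
    have h1 : quadForm (covMatrixInfty Q B) v =
        ∫ s in Ioi (0 : ℝ), quadForm (covIntegrand Q B s) v := by
      rw [covMatrixInfty_eq_integral hB]
      exact (ContinuousLinearMap.integral_comp_comm (quadFormCLM v)
        (integrableOn_covIntegrand hB)).symm
    rw [h1]
    refine integral_nonneg fun s => ?_
    obtain ⟨q, hq, hqle⟩ := exists_le_quadForm hQ
    rw [covIntegrand_eq, quadForm_mul_mul_transpose]
    exact le_trans (by positivity) (hqle _)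
  refine posDef_iff_quadForm.2 ⟨transpose_covMatrixInfty hQt, fun v hv => ?_⟩
  rw [quadForm_covMatrixInfty_eq_add hB zero_le_one]
  have := (posDef_iff_quadForm.1 (posDef_covMatrix (B := B) hQ one_pos)).2 v hv
  linarith [hnonneg (Matrix.toEuclideanLin (NormedSpace.exp ((1 : ℝ) • Bᵀ)) v)]

/-! ### The flow of the drift -/

theorem isUnit_det_covMatrixInfty (hQ : Q.PosDef)
    (hB : ∀ z ∈ spectrum ℂ (B.map (algebraMap ℝ ℂ)), z.re < 0) :
    IsUnit (covMatrixInfty Q B).det :=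
  (posDef_covMatrixInfty hQ hB).det_pos.ne'.isUnit

theorem flow_zero (hP : IsUnit (covMatrixInfty Q B).det) : flow Q B 0 = 1 := by
  rw [flow, neg_zero, exp_zero_smul, mul_one, Matrix.mul_nonsing_inv _ hP]

theorem flow_add (hP : IsUnit (covMatrixInfty Q B).det) (s t : ℝ) :
    flow Q B (s + t) = flow Q B s * flow Q B t := by
  simp only [flow]
  rw [neg_add, exp_add_smul]
  calc _ = covMatrixInfty Q B * NormedSpace.exp ((-s) • Bᵀ) *
      ((covMatrixInfty Q B)⁻¹ * covMatrixInfty Q B) * NormedSpace.exp ((-t) • Bᵀ) *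
      (covMatrixInfty Q B)⁻¹ := by
        rw [Matrix.nonsing_inv_mul _ hP]; simp only [mul_assoc, one_mul]
    _ = _ := by simp only [mul_assoc]

/-- The derivative of `t ↦ D_t`. -/
def flowDeriv (Q B : Matrix (Fin n) (Fin n) ℝ) (t : ℝ) : Matrix (Fin n) (Fin n) ℝ :=
  covMatrixInfty Q B * (NormedSpace.exp ((-t) • Bᵀ) * (-Bᵀ)) * (covMatrixInfty Q B)⁻¹

theorem hasDerivAt_flow (t : ℝ) : HasDerivAt (flow Q B) (flowDeriv Q B t) t := by
  have h1 := hasDerivAt_exp_smul_const (𝕂 := ℝ) (-Bᵀ) t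
  have h2 := (h1.const_mul (covMatrixInfty Q B)).mul_const (covMatrixInfty Q B)⁻¹
  simp only [smul_neg, ← neg_smul] at h2
  exact h2

theorem continuous_flow : Continuous (flow Q B) :=
  continuous_iff_continuousAt.2 fun t => (hasDerivAt_flow t).continuousAt

theorem continuous_flowDeriv : Continuous (flowDeriv Q B) :=
  (continuous_const.mul (((continuous_exp_smul Bᵀ).comp continuous_neg).mul
    continuous_const)).mul continuous_const

theorem R_flow (hP : IsUnit (covMatrixInfty Q B).det) (t : ℝ) (x : EuclideanSpace ℝ (Fin n)) :
    R Q B (Matrix.toEuclideanLin (flow Q B t) x) = 1 / 2 * quadForm (covMatrixInfty Q B)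
      (Matrix.toEuclideanLin (NormedSpace.exp ((-t) • Bᵀ) * (covMatrixInfty Q B)⁻¹) x) := by
  have h1 : (covMatrixInfty Q B)⁻¹ * flow Q B t =
      NormedSpace.exp ((-t) • Bᵀ) * (covMatrixInfty Q B)⁻¹ := by
    rw [flow, mul_assoc (covMatrixInfty Q B), ← mul_assoc, Matrix.nonsing_inv_mul _ hP, one_mul]
  rw [R, quadForm, ← toEuclideanLin_mul_apply, h1, quadForm, real_inner_comm, flow,
    mul_assoc (covMatrixInfty Q B), toEuclideanLin_mul_apply (covMatrixInfty Q B)]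

/-- Along the flow, `R` grows by the quadratic form of a covariance matrix. -/
theorem R_flow_sub_R_flow (hP : IsUnit (covMatrixInfty Q B).det)
    (hB : ∀ z ∈ spectrum ℂ (B.map (algebraMap ℝ ℂ)), z.re < 0) {s t : ℝ} (hst : s ≤ t)
    (x : EuclideanSpace ℝ (Fin n)) :
    R Q B (Matrix.toEuclideanLin (flow Q B t) x) - R Q B (Matrix.toEuclideanLin (flow Q B s) x) =
      1 / 2 * quadForm (covMatrix Q B (t - s))
        (Matrix.toEuclideanLin (NormedSpace.exp ((-t) • Bᵀ) * (covMatrixInfty Q B)⁻¹) x) := by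
  rw [R_flow hP, R_flow hP, quadForm_covMatrixInfty_eq_add hB (sub_nonneg.2 hst),
    ← toEuclideanLin_mul_apply, ← mul_assoc, ← exp_add_smul, show t - s + -t = -s by ring]
  ring

theorem exists_flow_growth (hQ : Q.PosDef)
    (hB : ∀ z ∈ spectrum ℂ (B.map (algebraMap ℝ ℂ)), z.re < 0) (T : ℝ) :
    ∃ c : ℝ, 0 < c ∧ ∀ s t x, -T ≤ s → s ≤ t → t ≤ T → c * (t - s) * ‖x‖ ^ 2 ≤
      R Q B (Matrix.toEuclideanLin (flow Q B t) x) -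
        R Q B (Matrix.toEuclideanLin (flow Q B s) x) := by
  have hP := isUnit_det_covMatrixInfty hQ hB
  obtain ⟨m, hm, hle⟩ := exists_le_quadForm_covMatrix (B := B) hQ (2 * T)
  obtain ⟨A, hA1, hA⟩ := exists_norm_exp_smul_le_of_abs_le Bᵀ T
  have hA0 : 0 < A := one_pos.trans_le hA1
  set p := 1 + ‖covMatrixInfty Q B‖ with hp
  have hp0 : 0 < p := by positivity
  refine ⟨1 / 2 * m / (p * A) ^ 2, by positivity, fun s t x hs hst ht => ?_⟩
  rw [R_flow_sub_R_flow hP hB hst]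
  set y := Matrix.toEuclideanLin (NormedSpace.exp ((-t) • Bᵀ) * (covMatrixInfty Q B)⁻¹) x with hy
  have h1 := hle (t - s) ⟨by linarith, by linarith⟩ y
  have h2 : ‖x‖ ≤ p * A * ‖y‖ := by
    have e : x = Matrix.toEuclideanLin (covMatrixInfty Q B * NormedSpace.exp (t • Bᵀ)) y := by
      have := exp_neg_smul_mul Bᵀ (-t)
      rw [neg_neg] at this
      rw [hy, ← toEuclideanLin_mul_apply, mul_assoc, ← mul_assoc (NormedSpace.exp (t • Bᵀ)),
        this, one_mul, Matrix.mul_nonsing_inv _ hP, toEuclideanLin_one_apply]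
    calc ‖x‖ = _ := congrArg norm e
      _ ≤ ‖covMatrixInfty Q B * NormedSpace.exp (t • Bᵀ)‖ * ‖y‖ := norm_toEuclideanLin_le _ _
      _ ≤ ‖covMatrixInfty Q B‖ * ‖NormedSpace.exp (t • Bᵀ)‖ * ‖y‖ := by
          gcongr; exact norm_mul_le _ _
      _ ≤ p * A * ‖y‖ := by
          gcongr
          · rw [hp]; linarith
          · exact hA t ⟨by linarith, ht⟩
  have hts : 0 ≤ t - s := by linarith
  calc 1 / 2 * m / (p * A) ^ 2 * (t - s) * ‖x‖ ^ 2
      ≤ 1 / 2 * m / (p * A) ^ 2 * (t - s) * (p * A * ‖y‖) ^ 2 := by gcongr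
    _ = 1 / 2 * (m * (t - s) * ‖y‖ ^ 2) := by rw [mul_pow (p * A)]; field_simp
    _ ≤ _ := by gcongr

theorem exists_flow_expand (hQ : Q.PosDef)
    (hB : ∀ z ∈ spectrum ℂ (B.map (algebraMap ℝ ℂ)), z.re < 0) :
    ∃ N : ℕ, ∀ x, 8 * R Q B x ≤ R Q B (Matrix.toEuclideanLin (flow Q B N) x) := by
  have hP := isUnit_det_covMatrixInfty hQ hB
  obtain ⟨c, hc, hgrow⟩ := exists_flow_growth hQ hB 1
  set A := 1 / 2 * ‖(covMatrixInfty Q B)⁻¹‖ + 1 with hA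
  have hA0 : 0 < A := by positivity
  have hRle : ∀ x, R Q B x ≤ A * ‖x‖ ^ 2 := fun x => by
    have := (le_abs_self _).trans (abs_quadForm_le (covMatrixInfty Q B)⁻¹ x)
    rw [R, hA]
    nlinarith [sq_nonneg ‖x‖]
  have hR0 : ∀ x, 0 ≤ R Q B x := fun x => by
    obtain ⟨m, hm, hle⟩ := exists_le_quadForm (posDef_covMatrixInfty hQ hB).inv
    have := (by positivity : 0 ≤ m * ‖x‖ ^ 2).trans (hle x)
    rw [R]; positivity
  have hstep : ∀ x, (1 + c / A) * R Q B x ≤ R Q B (Matrix.toEuclideanLin (flow Q B 1) x) := by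
    intro x
    have h1 := hgrow 0 1 x (by norm_num) zero_le_one le_rfl
    rw [flow_zero hP, toEuclideanLin_one_apply, sub_zero, mul_one] at h1
    have h2 : c / A * R Q B x ≤ c * ‖x‖ ^ 2 := by
      rw [div_mul_eq_mul_div, div_le_iff₀ hA0, mul_assoc, mul_comm (‖x‖ ^ 2)]
      gcongr
      exact hRle x
    linarith
  have hpow : ∀ N : ℕ, ∀ x, (1 + c / A) ^ N * R Q B x ≤
      R Q B (Matrix.toEuclideanLin (flow Q B N) x) := by
    intro N
    induction N with
    | zero =>
      intro x
      rw [Nat.cast_zero, flow_zero hP, toEuclideanLin_one_apply, pow_zero, one_mul]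
    | succ k ih =>
      intro x
      rw [Nat.cast_succ, flow_add hP, toEuclideanLin_mul_apply]
      refine le_trans ?_ (ih _)
      rw [pow_succ, mul_assoc]
      gcongr
      exact hstep x
  obtain ⟨N, hN⟩ := pow_unbounded_of_one_lt 8 (by
    have : 0 < c / A := by positivity
    linarith : 1 < 1 + c / A)
  refine ⟨N, fun x => le_trans ?_ (hpow N x)⟩
  have := hR0 x
  gcongr

theorem continuous_toEuclideanCLM :
    Continuous fun M : Matrix (Fin n) (Fin n) ℝ =>
      Matrix.toEuclideanCLM (n := Fin n) (𝕜 := ℝ) M :=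
  LinearMap.continuous_of_finiteDimensional
    (Matrix.toEuclideanCLM (n := Fin n) (𝕜 := ℝ)).toAlgEquiv.toLinearMap

theorem exists_isExpandingFlow (hQ : Q.PosDef)
    (hB : ∀ z ∈ spectrum ℂ (B.map (algebraMap ℝ ℂ)), z.re < 0) :
    ∃ T c C : ℝ, IsExpandingFlow (R Q B)
      (fun t => Matrix.toEuclideanCLM (n := Fin n) (𝕜 := ℝ) (flow Q B t)) T c C := by
  have hP := isUnit_det_covMatrixInfty hQ hB
  obtain ⟨N, hN⟩ := exists_flow_expand hQ hB
  set T : ℝ := N + 2 with hT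
  have hT2 : 2 ≤ T := by
    have : (0 : ℝ) ≤ N := Nat.cast_nonneg N
    linarith
  obtain ⟨c₁, hc₁, hgrow⟩ := exists_flow_growth hQ hB T
  obtain ⟨m, hm, hmle⟩ := exists_le_quadForm (posDef_covMatrixInfty hQ hB).inv
  obtain ⟨C₁, hC₁⟩ := (isCompact_Icc (a := -T) (b := T)).exists_bound_of_continuousOn
    (continuous_flow (Q := Q) (B := B)).continuousOn
  obtain ⟨C₂, hC₂⟩ := (isCompact_Icc (a := -T) (b := T)).exists_bound_of_continuousOn
    (continuous_flowDeriv (Q := Q) (B := B)).continuousOn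
  have hcontD : Continuous fun t => Matrix.toEuclideanCLM (n := Fin n) (𝕜 := ℝ) (flow Q B t) :=
    continuous_toEuclideanCLM.comp continuous_flow
  obtain ⟨C₃, hC₃⟩ := (isCompact_Icc (a := -T) (b := T)).exists_bound_of_continuousOn
    (ContinuousLinearMap.continuous_det.comp hcontD).continuousOn
  set p := ‖(covMatrixInfty Q B)⁻¹‖ with hp
  set C := max (max 1 p) (max C₁ (max C₂ C₃)) with hC
  have b0 : 1 ≤ C := (le_max_left _ _).trans (le_max_left _ _)
  have bp : p ≤ C := (le_max_right _ _).trans (le_max_left _ _)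
  have b1 : C₁ ≤ C := (le_max_left _ _).trans (le_max_right _ _)
  have b2 : C₂ ≤ C := ((le_max_left _ _).trans (le_max_right _ _)).trans (le_max_right _ _)
  have b3 : C₃ ≤ C := ((le_max_right _ _).trans (le_max_right _ _)).trans (le_max_right _ _)
  refine ⟨T, min c₁ (1 / 2 * m), C, ?_⟩
  constructor
  · exact hT2
  · exact lt_min hc₁ (by positivity)
  · exact b0
  · intro x
    simp only [flow_zero hP, map_one]
    rfl
  · intro s t x
    simp only [flow_add hP, map_mul]
    rfl
  · exact (hcontD.comp continuous_fst).clm_apply continuous_snd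
  · exact continuous_const.mul (continuous_quadForm _)
  · intro x
    calc min c₁ (1 / 2 * m) * ‖x‖ ^ 2 ≤ 1 / 2 * m * ‖x‖ ^ 2 := by
          gcongr; exact min_le_right _ _
      _ ≤ _ := by rw [R, mul_assoc]; gcongr; exact hmle x
  · intro x
    have h1 := (le_abs_self _).trans (abs_quadForm_le (covMatrixInfty Q B)⁻¹ x)
    calc R Q B x ≤ 1 / 2 * (p * ‖x‖ ^ 2) := by rw [R]; gcongr
      _ ≤ 1 * (C * ‖x‖ ^ 2) := by gcongr; norm_num
      _ = _ := one_mul _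
  · intro x y
    have e : quadForm (covMatrixInfty Q B)⁻¹ x - quadForm (covMatrixInfty Q B)⁻¹ y =
        inner ℝ (Matrix.toEuclideanLin (covMatrixInfty Q B)⁻¹ (x - y)) x +
        inner ℝ (Matrix.toEuclideanLin (covMatrixInfty Q B)⁻¹ y) (x - y) := by
      simp only [quadForm, map_sub, inner_sub_left, inner_sub_right]
      ring
    have h1 := abs_real_inner_le_norm
      (Matrix.toEuclideanLin (covMatrixInfty Q B)⁻¹ (x - y)) x
    have h2 := abs_real_inner_le_norm
      (Matrix.toEuclideanLin (covMatrixInfty Q B)⁻¹ y) (x - y)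
    have h3 := norm_toEuclideanLin_le (covMatrixInfty Q B)⁻¹ (x - y)
    have h4 := norm_toEuclideanLin_le (covMatrixInfty Q B)⁻¹ y
    rw [R, R, ← mul_sub, abs_mul, abs_of_pos (by norm_num : (0 : ℝ) < 1 / 2), e]
    have h5 : |inner ℝ (Matrix.toEuclideanLin (covMatrixInfty Q B)⁻¹ (x - y)) x +
        inner ℝ (Matrix.toEuclideanLin (covMatrixInfty Q B)⁻¹ y) (x - y)| ≤
        C * ‖x - y‖ * (‖x‖ + ‖y‖) := by
      calc _ ≤ p * ‖x - y‖ * ‖x‖ + p * ‖y‖ * ‖x - y‖ := by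
            refine (abs_add_le _ _).trans (add_le_add (h1.trans ?_) (h2.trans ?_)) <;> gcongr
        _ = p * ‖x - y‖ * (‖x‖ + ‖y‖) := by ring
        _ ≤ _ := by gcongr
    have h6 : 0 ≤ C * ‖x - y‖ * (‖x‖ + ‖y‖) := by positivity
    linarith
  · intro s t x hs hst ht
    have : 0 ≤ t - s := by linarith
    calc min c₁ (1 / 2 * m) * (t - s) * ‖x‖ ^ 2 ≤ c₁ * (t - s) * ‖x‖ ^ 2 := by
          gcongr; exact min_le_left _ _
      _ ≤ _ := hgrow s t x hs hst ht
  · intro s hs t ht x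
    have h1 : ‖flow Q B t - flow Q B s‖ ≤ C * ‖t - s‖ :=
      (convex_Icc (-T) T).norm_image_sub_le_of_norm_hasDerivWithin_le
        (fun r _ => (hasDerivAt_flow r).hasDerivWithinAt) (fun r hr => (hC₂ r hr).trans b2) hs ht
    have h2 : Matrix.toEuclideanLin (flow Q B t) x - Matrix.toEuclideanLin (flow Q B s) x =
        Matrix.toEuclideanLin (flow Q B t - flow Q B s) x := by
      rw [map_sub]; rfl
    change ‖Matrix.toEuclideanLin (flow Q B t) x - Matrix.toEuclideanLin (flow Q B s) x‖ ≤ _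
    rw [h2, ← Real.norm_eq_abs]
    exact (norm_toEuclideanLin_le _ _).trans (by gcongr)
  · intro t ht x
    exact (norm_toEuclideanLin_le (flow Q B t) x).trans (by gcongr; exact (hC₁ t ht).trans b1)
  · intro t ht
    exact (hC₃ t ht).trans b3
  · intro x
    have : T - 2 = N := by rw [hT]; ring
    rw [this]
    exact hN x

/-! ### The time derivative of the Mehler kernel -/

/-- The exponent of the Mehler kernel is of order `t⁻¹`: with `v = Q_t w = Q_∞ z`, the
form `⟨w - z, v⟩` equals `⟨(Q_∞ - Q_t) z, z⟩ + ⟨Q_t (w - z), w - z⟩`. -/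
theorem exists_le_quadForm_inv_sub_inv (hQ : Q.PosDef)
    (hB : ∀ z ∈ spectrum ℂ (B.map (algebraMap ℝ ℂ)), z.re < 0) :
    ∃ a : ℝ, 0 < a ∧ ∀ t ∈ Ioc (0 : ℝ) 1, ∀ v,
      a / t * ‖v‖ ^ 2 ≤ quadForm ((covMatrix Q B t)⁻¹ - (covMatrixInfty Q B)⁻¹) v := by
  obtain ⟨m, hm, hmle⟩ := exists_le_quadForm_covMatrix (B := B) hQ 1
  obtain ⟨A, hA, hAle⟩ := exists_norm_covIntegrand_le Q B 1
  obtain ⟨p, hp, hple⟩ := exists_le_quadForm (posDef_covMatrixInfty hQ hB)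
  obtain ⟨b, hb1, hble⟩ := exists_norm_exp_smul_le_of_abs_le Bᵀ 1
  have hb : 0 < b := one_pos.trans_le hb1
  have hPu := isUnit_det_covMatrixInfty hQ hB
  set q := 1 + ‖covMatrixInfty Q B‖ with hq
  have hq0 : 0 < q := by positivity
  refine ⟨m / A ^ 2 * (p / b ^ 2 / q) ^ 2, by positivity, fun t ht v => ?_⟩
  obtain ⟨ht0, ht1⟩ := ht
  have htm : t ∈ Icc (0 : ℝ) 1 := ⟨ht0.le, ht1⟩
  have hSpos := posDef_covMatrix (B := B) hQ ht0
  have hSu : IsUnit (covMatrix Q B t).det := hSpos.det_pos.ne'.isUnit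
  set S := covMatrix Q B t with hS
  set P := covMatrixInfty Q B with hP
  have hSt : Sᵀ = S := transpose_covMatrix (posDef_iff_quadForm.1 hQ).1 t
  set w := Matrix.toEuclideanLin S⁻¹ v with hw
  set z := Matrix.toEuclideanLin P⁻¹ v with hz
  have hSw : Matrix.toEuclideanLin S w = v := by
    rw [hw, ← toEuclideanLin_mul_apply, Matrix.mul_nonsing_inv _ hSu, toEuclideanLin_one_apply]
  have hPz : Matrix.toEuclideanLin P z = v := by
    rw [hz, ← toEuclideanLin_mul_apply, Matrix.mul_nonsing_inv _ hPu, toEuclideanLin_one_apply]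
  set y := Matrix.toEuclideanLin (P - S) z with hy
  set x := w - z with hx
  have hSx : Matrix.toEuclideanLin S x = y := by
    rw [hx, hy, map_sub, hSw, map_sub, LinearMap.sub_apply, hPz]
  have hyz : y + Matrix.toEuclideanLin S z = v := by
    rw [hy, map_sub, LinearMap.sub_apply, hPz]
    abel
  have hdecomp : quadForm (S⁻¹ - P⁻¹) v = quadForm (P - S) z + quadForm S x := by
    have e1 : quadForm (S⁻¹ - P⁻¹) v = inner ℝ x v := by
      rw [quadForm, map_sub, LinearMap.sub_apply]
    have e2 : inner ℝ x (Matrix.toEuclideanLin S z) = inner ℝ y z := by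
      conv_lhs => rw [← hSt]
      rw [← inner_toEuclideanLin, hSx]
    have e3 : quadForm S x = inner ℝ x y := by rw [quadForm, hSx, real_inner_comm]
    rw [e1, ← hyz, inner_add_right, e2, e3, quadForm, ← hy]
    ring
  -- `P - S = e^{tB} P e^{tB*}` and `e^{tB*}` is invertible
  have hlow : p / b ^ 2 * ‖z‖ ^ 2 ≤ quadForm (P - S) z := by
    have e1 : quadForm (P - S) z =
        quadForm P (Matrix.toEuclideanLin (NormedSpace.exp (t • Bᵀ)) z) := by
      rw [quadForm_sub, quadForm_covMatrixInfty_eq_add hB ht0.le z]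
      ring
    have e2 : ‖z‖ ≤ b * ‖Matrix.toEuclideanLin (NormedSpace.exp (t • Bᵀ)) z‖ := by
      have e : z = Matrix.toEuclideanLin (NormedSpace.exp ((-t) • Bᵀ))
          (Matrix.toEuclideanLin (NormedSpace.exp (t • Bᵀ)) z) := by
        rw [← toEuclideanLin_mul_apply, exp_neg_smul_mul, toEuclideanLin_one_apply]
      calc ‖z‖ = _ := congrArg norm e
        _ ≤ _ := norm_toEuclideanLin_le _ _
        _ ≤ _ := by
          gcongr
          exact hble (-t) ⟨by linarith, by linarith⟩
    rw [e1]
    refine le_trans ?_ (hple _)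
    rw [div_mul_eq_mul_div, div_le_iff₀ (by positivity), mul_assoc]
    gcongr
    rw [← mul_pow, mul_comm _ b]
    gcongr
  have hv : ‖v‖ ≤ q * ‖z‖ := by
    rw [← hPz]
    refine (norm_toEuclideanLin_le _ _).trans ?_
    gcongr
    rw [hq]
    linarith
  have hyz' : p / b ^ 2 * ‖z‖ ≤ ‖y‖ := by
    rcases (norm_nonneg z).eq_or_lt with h0 | h0
    · rw [← h0, mul_zero]; exact norm_nonneg _
    have h1 : quadForm (P - S) z ≤ ‖y‖ * ‖z‖ := real_inner_le_norm _ _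
    refine le_of_mul_le_mul_right ?_ h0
    linarith
  have hyx : ‖y‖ ≤ A * t * ‖x‖ := by
    rw [← hSx]
    exact (norm_toEuclideanLin_le _ _).trans (by gcongr; exact (hAle t htm).2)
  have hvx : p / b ^ 2 / q * ‖v‖ ≤ A * t * ‖x‖ := by
    calc p / b ^ 2 / q * ‖v‖ ≤ p / b ^ 2 / q * (q * ‖z‖) := by gcongr
      _ = p / b ^ 2 * ‖z‖ := by field_simp
      _ ≤ _ := hyz'.trans hyx
  have h1 := hmle t htm x
  have h2 : 0 ≤ quadForm (P - S) z := le_trans (by positivity) hlow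
  calc m / A ^ 2 * (p / b ^ 2 / q) ^ 2 / t * ‖v‖ ^ 2
      = m / A ^ 2 / t * (p / b ^ 2 / q * ‖v‖) ^ 2 := by ring
    _ ≤ m / A ^ 2 / t * (A * t * ‖x‖) ^ 2 := by gcongr
    _ = m * t * ‖x‖ ^ 2 := by field_simp
    _ ≤ _ := by rw [hdecomp]; linarith

theorem abs_apply_le_norm (M : Matrix (Fin n) (Fin n) ℝ) (i j : Fin n) : |M i j| ≤ ‖M‖ := by
  have h1 := norm_toEuclideanLin_le M (EuclideanSpace.single j 1)
  have h2 := PiLp.norm_apply_le (Matrix.toEuclideanLin M (EuclideanSpace.single j 1)) i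
  have h3 : Matrix.toEuclideanLin M (EuclideanSpace.single j 1) i = M i j := by
    simp
  rw [h3, Real.norm_eq_abs] at h2
  simpa using h2.trans h1

theorem hasDerivAt_inv_matrix {S : ℝ → Matrix (Fin n) (Fin n) ℝ} {S' : Matrix (Fin n) (Fin n) ℝ}
    {t : ℝ} (hS : HasDerivAt S S' t) (hu : IsUnit (S t).det) :
    HasDerivAt (fun t => (S t)⁻¹) (-((S t)⁻¹ * S' * (S t)⁻¹)) t := by
  have hu' : IsUnit (S t) := (Matrix.isUnit_iff_isUnit_det _).2 hu
  obtain ⟨U, hU⟩ := hu'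
  have h1 := hasFDerivAt_ringInverse (𝕜 := ℝ) U
  rw [hU] at h1
  have h2 := h1.comp_hasDerivAt t hS
  have h3 : (U⁻¹ : (Matrix (Fin n) (Fin n) ℝ)ˣ) = (S t)⁻¹ := by
    rw [← hU, Matrix.coe_units_inv]
  simp only [neg_apply, ContinuousLinearMap.mulLeftRight_apply, h3] at h2
  have e : (fun t => (S t)⁻¹) = Ring.inverse ∘ S :=
    funext fun s => Matrix.nonsing_inv_eq_ringInverse (S s)
  rw [e]
  exact h2

/-- The determinant of `S(t) = O(t)` has derivative `O(t ^ (n - 1))`. -/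
theorem exists_hasDerivAt_det {S : ℝ → Matrix (Fin n) (Fin n) ℝ} {S' : Matrix (Fin n) (Fin n) ℝ}
    {t A : ℝ} (ht : 0 ≤ t) (hS : HasDerivAt S S' t) (hA : ‖S t‖ ≤ A * t) (hA' : ‖S'‖ ≤ A) :
    ∃ δ : ℝ, HasDerivAt (fun t => (S t).det) δ t ∧
      t * |δ| ≤ (n.factorial * n * A ^ n) * t ^ n := by
  have hA0 : 0 ≤ A := (norm_nonneg _).trans hA'
  have hentry : ∀ i j, HasDerivAt (fun t => S t i j) (S' i j) t := fun i j =>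
    (LinearMap.toContinuousLinearMap
      (Matrix.entryLinearMap ℝ ℝ i j)).hasFDerivAt.comp_hasDerivAt t hS
  have hprod : ∀ σ : Equiv.Perm (Fin n), HasDerivAt
      (fun t => Equiv.Perm.sign σ • ∏ i, S t (σ i) i)
      (Equiv.Perm.sign σ • ∑ i, (∏ j ∈ Finset.univ.erase i, S t (σ j) j) • S' (σ i) i) t :=
    fun σ => by
      have := HasDerivAt.fun_finsetProd (u := Finset.univ) fun i _ => hentry (σ i) i
      simp only [Units.smul_def, zsmul_eq_mul]
      exact this.const_mul _
  refine ⟨∑ σ : Equiv.Perm (Fin n),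
    Equiv.Perm.sign σ • ∑ i, (∏ j ∈ Finset.univ.erase i, S t (σ j) j) • S' (σ i) i, ?_, ?_⟩
  · simp only [Matrix.det_apply]
    exact HasDerivAt.fun_sum fun σ _ => hprod σ
  · have hterm : ∀ (σ : Equiv.Perm (Fin n)) (i : Fin n),
        t * |(∏ j ∈ Finset.univ.erase i, S t (σ j) j) • S' (σ i) i| ≤ A ^ n * t ^ n := by
      intro σ i
      have h1 : |∏ j ∈ Finset.univ.erase i, S t (σ j) j| ≤ (A * t) ^ (n - 1) := by
        rw [Finset.abs_prod]
        calc _ ≤ ∏ _j ∈ Finset.univ.erase i, A * t :=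
              Finset.prod_le_prod (fun _ _ => abs_nonneg _)
                fun j _ => (abs_apply_le_norm _ _ _).trans hA
          _ = _ := by simp [Finset.card_erase_of_mem]
      have h2 : |S' (σ i) i| ≤ A := (abs_apply_le_norm _ _ _).trans hA'
      have hn : n - 1 + 1 = n := Nat.sub_add_cancel (Fin.pos i)
      rw [smul_eq_mul, abs_mul]
      calc _ ≤ t * ((A * t) ^ (n - 1) * A) := by gcongr
        _ = (A * t) ^ (n - 1 + 1) := by ring
        _ = _ := by rw [hn, mul_pow]
    calc _ ≤ t * ∑ σ : Equiv.Perm (Fin n), ∑ i : Fin n,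
          |(∏ j ∈ Finset.univ.erase i, S t (σ j) j) • S' (σ i) i| := by
          gcongr
          refine (Finset.abs_sum_le_sum_abs _ _).trans (Finset.sum_le_sum fun σ _ => ?_)
          refine le_trans (le_of_eq ?_) (Finset.abs_sum_le_sum_abs _ _)
          rcases Int.units_eq_one_or (Equiv.Perm.sign σ) with h | h <;> simp [h]
      _ ≤ ∑ _σ : Equiv.Perm (Fin n), ∑ _i : Fin n, A ^ n * t ^ n := by
          simp_rw [Finset.mul_sum]
          exact Finset.sum_le_sum fun σ _ => Finset.sum_le_sum fun i _ => hterm σ i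
      _ = _ := by
          simp [Fintype.card_perm]
          ring

theorem mehlerKernel_eq_exp (hQ : Q.PosDef)
    (hB : ∀ z ∈ spectrum ℂ (B.map (algebraMap ℝ ℂ)), z.re < 0) {t : ℝ} (ht : 0 < t)
    (x u : EuclideanSpace ℝ (Fin n)) :
    mehlerKernel Q B t x u = Real.exp (1 / 2 * (Real.log (covMatrixInfty Q B).det -
      Real.log (covMatrix Q B t).det) + R Q B x + -(1 / 2) *
      quadForm ((covMatrix Q B t)⁻¹ - (covMatrixInfty Q B)⁻¹)
        (u - Matrix.toEuclideanLin (flow Q B t) x)) := by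
  have h1 := (posDef_covMatrixInfty hQ hB).det_pos
  have h2 := (posDef_covMatrix (B := B) hQ ht).det_pos
  rw [mehlerKernel, Real.rpow_def_of_pos (by positivity), Real.log_div h1.ne' h2.ne',
    Real.exp_add, Real.exp_add, mul_comm (1 / 2 : ℝ)]

theorem exists_mehlerKernel_le (hQ : Q.PosDef)
    (hB : ∀ z ∈ spectrum ℂ (B.map (algebraMap ℝ ℂ)), z.re < 0) :
    ∃ a A : ℝ, 0 < a ∧ 0 < A ∧ ∀ t ∈ Ioc (0 : ℝ) 1, ∀ x u,
      mehlerKernel Q B t x u ≤ A * Real.exp (R Q B x) * ((Real.sqrt t ^ n)⁻¹ *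
        Real.exp (-a * (‖u - Matrix.toEuclideanLin (flow Q B t) x‖ ^ 2 / t))) := by
  obtain ⟨a, ha, hale⟩ := exists_le_quadForm_inv_sub_inv hQ hB
  obtain ⟨m, hm, hmle⟩ := exists_le_quadForm_covMatrix (B := B) hQ 1
  have h1 := (posDef_covMatrixInfty hQ hB).det_pos
  refine ⟨a / 2, Real.sqrt ((covMatrixInfty Q B).det / m ^ n), by positivity, by positivity,
    fun t ht x u => ?_⟩
  have hS := posDef_covMatrix (B := B) hQ ht.1
  have hdet : (m * t) ^ n ≤ (covMatrix Q B t).det :=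
    pow_le_det_of_le_quadForm (transpose_covMatrix (posDef_iff_quadForm.1 hQ).1 t)
      (mul_nonneg hm.le ht.1.le) (hmle t ⟨ht.1.le, ht.2⟩)
  have hmt : 0 < (m * t) ^ n := pow_pos (mul_pos hm ht.1) n
  have hroot : ((covMatrixInfty Q B).det / (covMatrix Q B t).det) ^ ((1 : ℝ) / 2) ≤
      Real.sqrt ((covMatrixInfty Q B).det / m ^ n) * (Real.sqrt t ^ n)⁻¹ := by
    rw [← Real.sqrt_eq_rpow]
    calc _ ≤ Real.sqrt ((covMatrixInfty Q B).det / (m * t) ^ n) := by gcongr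
      _ = Real.sqrt ((covMatrixInfty Q B).det / m ^ n / (Real.sqrt t ^ n) ^ 2) := by
          rw [mul_pow, ← div_div, ← pow_mul, mul_comm n 2, pow_mul, Real.sq_sqrt ht.1.le]
      _ = _ := by
          rw [Real.sqrt_div (by positivity), Real.sqrt_sq (by positivity), div_eq_mul_inv]
  have hv := hale t ht (u - Matrix.toEuclideanLin (flow Q B t) x)
  have hexp : Real.exp (-(1 / 2) * quadForm ((covMatrix Q B t)⁻¹ - (covMatrixInfty Q B)⁻¹)
      (u - Matrix.toEuclideanLin (flow Q B t) x)) ≤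
      Real.exp (-(a / 2) * (‖u - Matrix.toEuclideanLin (flow Q B t) x‖ ^ 2 / t)) := by
    have : a / t * ‖u - Matrix.toEuclideanLin (flow Q B t) x‖ ^ 2 =
      a * (‖u - Matrix.toEuclideanLin (flow Q B t) x‖ ^ 2 / t) := by ring
    exact Real.exp_le_exp.2 (by linarith)
  rw [mehlerKernel]
  calc _ ≤ Real.sqrt ((covMatrixInfty Q B).det / m ^ n) * (Real.sqrt t ^ n)⁻¹ *
        Real.exp (R Q B x) *
        Real.exp (-(a / 2) * (‖u - Matrix.toEuclideanLin (flow Q B t) x‖ ^ 2 / t)) := by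
        gcongr
    _ = _ := by ring

/-- The logarithmic time derivative of the Mehler kernel. -/
theorem exists_hasDerivAt_mehlerKernel (hQ : Q.PosDef)
    (hB : ∀ z ∈ spectrum ℂ (B.map (algebraMap ℝ ℂ)), z.re < 0) :
    ∃ A : ℝ, 0 < A ∧ ∀ t ∈ Ioc (0 : ℝ) 1, ∀ x u, ∃ g : ℝ,
      HasDerivAt (fun t => mehlerKernel Q B t x u) (mehlerKernel Q B t x u * g) t ∧
      |g| ≤ A * (1 / t + ‖u - Matrix.toEuclideanLin (flow Q B t) x‖ ^ 2 / t ^ 2 +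
        ‖x‖ * ‖u - Matrix.toEuclideanLin (flow Q B t) x‖ / t) := by
  obtain ⟨m, hm, hmle⟩ := exists_le_quadForm_covMatrix (B := B) hQ 1
  obtain ⟨A, hA, hAle⟩ := exists_norm_covIntegrand_le Q B 1
  obtain ⟨F, hF⟩ := (isCompact_Icc (a := (0 : ℝ)) (b := 1)).exists_bound_of_continuousOn
    (continuous_flowDeriv (Q := Q) (B := B)).continuousOn
  have hF0 : 0 ≤ F := (norm_nonneg _).trans (hF 0 ⟨le_rfl, zero_le_one⟩)
  set p := ‖(covMatrixInfty Q B)⁻¹‖ with hp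
  set c₁ := n.factorial * n * A ^ n / m ^ n with hc₁
  set c₂ := 1 / m * A * (1 / m) with hc₂
  set c₃ := 2 * (1 / m + p) * F with hc₃
  have hc₁0 : 0 ≤ c₁ := by positivity
  have hc₂0 : 0 ≤ c₂ := by positivity
  have hc₃0 : 0 ≤ c₃ := by positivity
  refine ⟨c₁ + c₂ + c₃ + 1, by positivity, fun t ht x u => ?_⟩
  obtain ⟨ht0, ht1⟩ := ht
  have htm : t ∈ Icc (0 : ℝ) 1 := ⟨ht0.le, ht1⟩
  have hSpos := posDef_covMatrix (B := B) hQ ht0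
  have hSu : IsUnit (covMatrix Q B t).det := hSpos.det_pos.ne'.isUnit
  have hS := hasDerivAt_covMatrix Q B t
  obtain ⟨δ, hδ, hδle⟩ := exists_hasDerivAt_det ht0.le hS (hAle t htm).2 (hAle t htm).1
  have hdet : (m * t) ^ n ≤ (covMatrix Q B t).det :=
    pow_le_det_of_le_quadForm (transpose_covMatrix (posDef_iff_quadForm.1 hQ).1 t)
      (by positivity) (hmle t htm)
  have hinv : ‖(covMatrix Q B t)⁻¹‖ ≤ 1 / m / t := by
    rw [div_div]
    exact norm_inv_le_of_le_quadForm hSu (by positivity) (hmle t htm)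
  set N : ℝ → Matrix (Fin n) (Fin n) ℝ := fun t => (covMatrix Q B t)⁻¹ - (covMatrixInfty Q B)⁻¹
    with hN
  set N' := -((covMatrix Q B t)⁻¹ * covIntegrand Q B t * (covMatrix Q B t)⁻¹) with hN'
  have hNd : HasDerivAt N N' t := (hasDerivAt_inv_matrix hS hSu).sub_const _
  have hN'le : ‖N'‖ ≤ c₂ / t ^ 2 := by
    rw [hN', norm_neg]
    calc _ ≤ ‖(covMatrix Q B t)⁻¹‖ * ‖covIntegrand Q B t‖ * ‖(covMatrix Q B t)⁻¹‖ :=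
          (norm_mul_le _ _).trans (by gcongr; exact norm_mul_le _ _)
      _ ≤ 1 / m / t * A * (1 / m / t) := by
          gcongr
          exact (hAle t htm).1
      _ = _ := by rw [hc₂]; ring
  have hNle : ‖N t‖ ≤ (1 / m + p) / t := by
    calc ‖N t‖ ≤ 1 / m / t + p := (norm_sub_le _ _).trans (by gcongr)
      _ ≤ 1 / m / t + p / t := by
          gcongr
          exact le_div_self (norm_nonneg _) ht0 ht1
      _ = _ := by ring
  set L : Matrix (Fin n) (Fin n) ℝ →L[ℝ]
      (EuclideanSpace ℝ (Fin n) →L[ℝ] EuclideanSpace ℝ (Fin n)) :=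
    LinearMap.toContinuousLinearMap
      (Matrix.toEuclideanCLM (n := Fin n) (𝕜 := ℝ)).toAlgEquiv.toLinearMap with hL
  have hLapp : ∀ M y, L M y = Matrix.toEuclideanLin M y := fun M y => rfl
  set v : ℝ → EuclideanSpace ℝ (Fin n) := fun t => u - L (flow Q B t) x with hv
  set v' := -(L (flowDeriv Q B t) x) with hv'
  have hvd : HasDerivAt v v' t := by
    have h1 := L.hasFDerivAt.comp_hasDerivAt t (hasDerivAt_flow (Q := Q) (B := B) t)
    have h2 := h1.clm_apply (hasDerivAt_const t x)
    simp only [map_zero, add_zero] at h2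
    exact h2.const_sub u
  have hv'le : ‖v'‖ ≤ F * ‖x‖ := by
    rw [hv', norm_neg, hLapp]
    exact (norm_toEuclideanLin_le _ _).trans (by gcongr; exact hF t htm)
  set φ' : ℝ := inner ℝ (L (N t) (v t)) v' + inner ℝ (L N' (v t) + L (N t) v') (v t) with hφ'
  have hφd : HasDerivAt (fun t => quadForm (N t) (v t)) φ' t := by
    have h1 := L.hasFDerivAt.comp_hasDerivAt t hNd
    exact (h1.clm_apply hvd).inner ℝ hvd
  set d := ‖v t‖ with hd
  have hφ'le : |φ'| ≤ c₂ * (d ^ 2 / t ^ 2) + c₃ * (‖x‖ * d / t) := by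
    have b1 : |inner ℝ (L (N t) (v t)) v'| ≤ (1 / m + p) / t * d * (F * ‖x‖) := by
      refine (abs_real_inner_le_norm _ _).trans ?_
      gcongr
      exact (norm_toEuclideanLin_le _ _).trans (by gcongr)
    have b2 : |inner ℝ (L N' (v t)) (v t)| ≤ c₂ / t ^ 2 * d * d := by
      refine (abs_real_inner_le_norm _ _).trans ?_
      gcongr
      exact (norm_toEuclideanLin_le _ _).trans (by gcongr)
    have b3 : |inner ℝ (L (N t) v') (v t)| ≤ (1 / m + p) / t * (F * ‖x‖) * d := by
      refine (abs_real_inner_le_norm _ _).trans ?_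
      gcongr
      exact (norm_toEuclideanLin_le _ _).trans (by gcongr)
    rw [hφ', inner_add_left]
    calc _ ≤ (1 / m + p) / t * d * (F * ‖x‖) + (c₂ / t ^ 2 * d * d +
          (1 / m + p) / t * (F * ‖x‖) * d) :=
          (abs_add_le _ _).trans (add_le_add b1 ((abs_add_le _ _).trans (add_le_add b2 b3)))
      _ = _ := by rw [hc₃]; ring
  have hlogd := (hδ.log hSpos.det_pos.ne')
  set g : ℝ := 1 / 2 * (0 - δ / (covMatrix Q B t).det) + 0 + -(1 / 2) * φ' with hg
  refine ⟨g, ?_, ?_⟩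
  · have h1 : HasDerivAt (fun t => Real.exp (1 / 2 * (Real.log (covMatrixInfty Q B).det -
        Real.log (covMatrix Q B t).det) + R Q B x + -(1 / 2) * quadForm (N t) (v t)))
        (Real.exp (1 / 2 * (Real.log (covMatrixInfty Q B).det -
        Real.log (covMatrix Q B t).det) + R Q B x + -(1 / 2) * quadForm (N t) (v t)) * g) t := by
      refine HasDerivAt.exp ?_
      exact ((((hasDerivAt_const t _).sub hlogd).const_mul (1 / 2)).add
        (hasDerivAt_const t _)).add (hφd.const_mul (-(1 / 2)))
    rw [mehlerKernel_eq_exp hQ hB ht0]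
    refine h1.congr_of_eventuallyEq ?_
    filter_upwards [lt_mem_nhds ht0] with s hs
    exact mehlerKernel_eq_exp hQ hB hs x u
  · have hdd : |δ / (covMatrix Q B t).det| ≤ c₁ * (1 / t) := by
      have hmt : 0 < (m * t) ^ n := by positivity
      rw [abs_div, abs_of_pos hSpos.det_pos, div_le_iff₀ hSpos.det_pos]
      calc |δ| = t * |δ| / t := by field_simp
        _ ≤ (n.factorial * n * A ^ n) * t ^ n / t := by gcongr
        _ = c₁ * (1 / t) * (m * t) ^ n := by rw [hc₁, mul_pow]; field_simp
        _ ≤ _ := by gcongr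
    have hd0 : 0 ≤ d := norm_nonneg _
    set X := 1 / t with hX
    set Y := d ^ 2 / t ^ 2 with hY
    set Z := ‖x‖ * d / t with hZ
    have hX0 : 0 ≤ X := by positivity
    have hY0 : 0 ≤ Y := by positivity
    have hZ0 : 0 ≤ Z := by positivity
    have h1 : |g| ≤ |δ / (covMatrix Q B t).det| + |φ'| := by
      have e : g = -(1 / 2) * (δ / (covMatrix Q B t).det) + -(1 / 2) * φ' := by rw [hg]; ring
      rw [e]
      refine (abs_add_le _ _).trans ?_
      rw [abs_mul, abs_mul, abs_neg, abs_of_pos (by norm_num : (0 : ℝ) < 1 / 2)]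
      linarith [abs_nonneg (δ / (covMatrix Q B t).det), abs_nonneg φ']
    calc |g| ≤ c₁ * X + (c₂ * Y + c₃ * Z) := h1.trans (add_le_add hdd hφ'le)
      _ ≤ (c₁ + c₂ + c₃ + 1) * X + ((c₁ + c₂ + c₃ + 1) * Y + (c₁ + c₂ + c₃ + 1) * Z) := by
          gcongr <;> linarith
      _ = (c₁ + c₂ + c₃ + 1) * (X + Y + Z) := by ring

end Matrices

variable {n : ℕ} {Q B : Matrix (Fin n) (Fin n) ℝ}

/-! ### The total variation of the Mehler kernel in time -/

/-- The flow `D_t` as a family of continuous linear maps. -/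
def flowCLM (Q B : Matrix (Fin n) (Fin n) ℝ) (t : ℝ) :
    EuclideanSpace ℝ (Fin n) →L[ℝ] EuclideanSpace ℝ (Fin n) :=
  Matrix.toEuclideanCLM (n := Fin n) (𝕜 := ℝ) (flow Q B t)

theorem mehlerKernel_nonneg (hQ : Q.PosDef)
    (hB : ∀ z ∈ spectrum ℂ (B.map (algebraMap ℝ ℂ)), z.re < 0) {t : ℝ} (ht : 0 < t)
    (x u : EuclideanSpace ℝ (Fin n)) : 0 ≤ mehlerKernel Q B t x u := by
  rw [mehlerKernel_eq_exp hQ hB ht]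
  exact (Real.exp_pos _).le

/-- Half of the Gaussian factor of `K_t` absorbs the powers of `|u - D_t x| / √t` which come from its
logarithmic derivative. -/
theorem exists_abs_deriv_mehlerKernel_le (hQ : Q.PosDef)
    (hB : ∀ z ∈ spectrum ℂ (B.map (algebraMap ℝ ℂ)), z.re < 0) :
    ∃ a A : ℝ, 0 < a ∧ 0 < A ∧ ∀ t ∈ Ioc (0 : ℝ) 1, ∀ x u,
      DifferentiableAt ℝ (fun t => mehlerKernel Q B t x u) t ∧
      |deriv (fun t => mehlerKernel Q B t x u) t| ≤
        A * Real.exp (R Q B x) * timeKernel (flowCLM Q B) n a t x u := by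
  obtain ⟨a, A₁, ha, hA₁, hK⟩ := exists_mehlerKernel_le hQ hB
  obtain ⟨A₂, hA₂, hg⟩ := exists_hasDerivAt_mehlerKernel hQ hB
  obtain ⟨A₃, hA₃, hle₃⟩ := exists_pow_mul_exp_neg_sq_le 2 (half_pos ha)
  obtain ⟨A₄, hA₄, hle₄⟩ := exists_pow_mul_exp_neg_sq_le 1 (half_pos ha)
  refine ⟨a / 2, A₁ * A₂ * (1 + A₃ + A₄), by positivity, by positivity, fun t ht x u => ?_⟩
  obtain ⟨g, hgd, hgle⟩ := hg t ht x u
  refine ⟨hgd.differentiableAt, ?_⟩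
  rw [hgd.deriv, abs_mul, abs_of_nonneg (mehlerKernel_nonneg hQ hB ht.1 x u)]
  have hKt := hK t ht x u
  obtain ⟨ht0, ht1⟩ := ht
  have hw := Real.sqrt_pos.2 ht0
  have hwt := Real.sq_sqrt ht0.le
  unfold timeKernel
  change _ ≤ _ * ((Real.sqrt t ^ n)⁻¹ * (1 / t + (1 + ‖x‖) / Real.sqrt t) *
    Real.exp (-(a / 2) * (‖u - Matrix.toEuclideanLin (flow Q B t) x‖ ^ 2 / t)))
  have hd0 : 0 ≤ ‖u - Matrix.toEuclideanLin (flow Q B t) x‖ := norm_nonneg _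
  generalize ‖u - Matrix.toEuclideanLin (flow Q B t) x‖ = d at hgle hKt hd0 ⊢
  generalize mehlerKernel Q B t x u = K at hKt ⊢
  have hex0 : 0 < Real.exp (R Q B x) := Real.exp_pos _
  generalize Real.exp (R Q B x) = ex at hKt hex0 ⊢
  have hx0 : 0 ≤ ‖x‖ := norm_nonneg x
  generalize ‖x‖ = m at hgle hx0 ⊢
  generalize Real.sqrt t = w at hw hwt hKt ⊢
  have hz : d ^ 2 / t = (d / w) ^ 2 := by rw [div_pow, hwt]
  have hz0 : 0 ≤ d / w := by positivity
  have e1 : 1 / t + d ^ 2 / t ^ 2 + m * d / t =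
      1 / t + (d / w) ^ 2 * (1 / t) + (d / w) * (m / w) := by
    rw [← hz, ← hwt]; field_simp
  rw [e1] at hgle
  rw [hz] at hKt ⊢
  set z := d / w
  have h3 := hle₃ z hz0
  have h4 := hle₄ z hz0
  rw [pow_one] at h4
  set Ez := Real.exp (-(a / 2) * z ^ 2) with hEz
  have hEz0 : 0 < Ez := Real.exp_pos _
  have hEz1 : Ez ≤ 1 := Real.exp_le_one_iff.2 (by
    rw [neg_mul]; exact neg_nonpos.2 (by positivity))
  have hsplit : Real.exp (-a * z ^ 2) = Ez * Ez := by
    rw [hEz, ← Real.exp_add]; congr 1; ring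
  rw [hsplit] at hKt
  have ht0' : 0 ≤ 1 / t := by positivity
  have hmw : 0 ≤ m / w := by positivity
  have h1w : 0 ≤ 1 / w := by positivity
  have key : (1 / t + z ^ 2 * (1 / t) + z * (m / w)) * Ez ≤
      (1 + A₃ + A₄) * (1 / t + (1 + m) / w) := by
    have p1 : 1 / t * Ez ≤ 1 / t * 1 := by gcongr
    have p2 : 1 / t * (z ^ 2 * Ez) ≤ 1 / t * A₃ := by gcongr
    have p3 : m / w * (z * Ez) ≤ m / w * A₄ := by gcongr
    have p4 : 0 ≤ A₄ * (1 / t) := by positivity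
    have p5 : 0 ≤ (1 + A₃) * (m / w) := by positivity
    have p6 : 0 ≤ (1 + A₃ + A₄) * (1 / w) := by positivity
    have p7 : (1 + m) / w = 1 / w + m / w := add_div _ _ _
    rw [p7]
    linarith
  calc K * |g| ≤ A₁ * ex * ((w ^ n)⁻¹ * (Ez * Ez)) *
        (A₂ * (1 / t + z ^ 2 * (1 / t) + z * (m / w))) := by gcongr
    _ = A₁ * A₂ * ex * (w ^ n)⁻¹ * ((1 / t + z ^ 2 * (1 / t) + z * (m / w)) * Ez) * Ez := by ring
    _ ≤ A₁ * A₂ * ex * (w ^ n)⁻¹ * ((1 + A₃ + A₄) * (1 / t + (1 + m) / w)) * Ez := by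
        gcongr
    _ = _ := by ring

/-- Increments in time are bounded by the integral of a bound for the derivative. -/
theorem ofReal_abs_sub_le_lintegral {φ g : ℝ → ℝ} {s t M : ℝ} (hst : s ≤ t)
    (hd : ∀ r ∈ Icc s t, DifferentiableAt ℝ φ r) (hg : ∀ r ∈ Icc s t, |deriv φ r| ≤ g r)
    (hM : ∀ r ∈ Icc s t, g r ≤ M) :
    ENNReal.ofReal |φ t - φ s| ≤ ∫⁻ r in Ioc s t, ENNReal.ofReal (g r) := by
  have hint : IntervalIntegrable (deriv φ) volume s t := by
    rw [intervalIntegrable_iff_integrableOn_Ioc_of_le hst]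
    refine Measure.integrableOn_of_bounded (M := M) measure_Ioc_lt_top.ne
      (measurable_deriv φ).aestronglyMeasurable ?_
    refine (ae_restrict_iff' measurableSet_Ioc).2 (Filter.Eventually.of_forall fun r hr => ?_)
    exact (hg r (Ioc_subset_Icc_self hr)).trans (hM r (Ioc_subset_Icc_self hr))
  have h1 := intervalIntegral.integral_eq_sub_of_hasDerivAt
    (fun r hr => (hd r (by rwa [uIcc_of_le hst] at hr)).hasDerivAt) hint
  rw [← h1, intervalIntegral.integral_of_le hst, ← Real.norm_eq_abs, ofReal_norm]
  refine (enorm_integral_le_lintegral_enorm _).trans ?_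
  refine setLIntegral_mono' measurableSet_Ioc fun r hr => ?_
  rw [← ofReal_norm]
  exact ENNReal.ofReal_le_ofReal (hg r (Ioc_subset_Icc_self hr))

theorem sum_setLIntegral_Ioc_le {t : ℕ → ℝ} (ht : Monotone t) (g : ℝ → ℝ≥0∞) (N : ℕ) :
    ∑ i ∈ Finset.range N, ∫⁻ r in Ioc (t i) (t (i + 1)), g r ≤ ∫⁻ r in Ioc (t 0) (t N), g r := by
  induction N with
  | zero => simp
  | succ N ih =>
    rw [Finset.sum_range_succ, ← Ioc_union_Ioc_eq_Ioc (ht (Nat.zero_le N)) (ht (Nat.le_succ N)),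
      lintegral_union measurableSet_Ioc]
    · gcongr
    · exact disjoint_left.2 fun r hr hr' => not_lt.2 hr.2 hr'.1

theorem exists_sum_abs_mehlerKernel_sub_le (hQ : Q.PosDef)
    (hB : ∀ z ∈ spectrum ℂ (B.map (algebraMap ℝ ℂ)), z.re < 0) :
    ∃ a A : ℝ, 0 < a ∧ 0 < A ∧ ∀ t : ℕ → ℝ, Monotone t → (∀ i, t i ∈ Ioc (0 : ℝ) 1) → ∀ N x u,
      ∑ i ∈ Finset.range N,
        ENNReal.ofReal |mehlerKernel Q B (t (i + 1)) x u - mehlerKernel Q B (t i) x u| ≤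
      ENNReal.ofReal (A * Real.exp (R Q B x)) * totalKernel (flowCLM Q B) n a x u := by
  obtain ⟨a, A, ha, hA, hle⟩ := exists_abs_deriv_mehlerKernel_le hQ hB
  refine ⟨a, A, ha, hA, fun t ht htI N x u => ?_⟩
  calc _ ≤ ∑ i ∈ Finset.range N, ∫⁻ r in Ioc (t i) (t (i + 1)), ENNReal.ofReal
        (A * Real.exp (R Q B x) * timeKernel (flowCLM Q B) n a r x u) := by
        refine Finset.sum_le_sum fun i _ => ?_
        have hsub : ∀ r ∈ Icc (t i) (t (i + 1)), r ∈ Ioc (0 : ℝ) 1 := fun r hr =>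
          ⟨(htI i).1.trans_le hr.1, hr.2.trans (htI (i + 1)).2⟩
        refine ofReal_abs_sub_le_lintegral (ht (Nat.le_succ i))
          (φ := fun t => mehlerKernel Q B t x u)
          (M := A * Real.exp (R Q B x) * ((Real.sqrt (t i) ^ n)⁻¹ *
            (1 / t i + (1 + ‖x‖) / Real.sqrt (t i)) * 1))
          (fun r hr => (hle r (hsub r hr) x u).1) (fun r hr => (hle r (hsub r hr) x u).2)
          (fun r hr => ?_)
        have h0 := (htI i).1
        have hr0 : 0 < r := h0.trans_le hr.1
        have hs := Real.sqrt_pos.2 h0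
        have hss := Real.sqrt_le_sqrt hr.1
        have hexp : Real.exp (-a * (‖u - flowCLM Q B r x‖ ^ 2 / r)) ≤ 1 :=
          Real.exp_le_one_iff.2 (by rw [neg_mul]; exact neg_nonpos.2 (by positivity))
        have := hr.1
        unfold timeKernel
        gcongr
    _ ≤ ∫⁻ r in Ioc (t 0) (t N), ENNReal.ofReal
        (A * Real.exp (R Q B x) * timeKernel (flowCLM Q B) n a r x u) :=
        sum_setLIntegral_Ioc_le ht _ N
    _ ≤ ∫⁻ r in Ioc (0 : ℝ) 1, ENNReal.ofReal
        (A * Real.exp (R Q B x) * timeKernel (flowCLM Q B) n a r x u) :=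
        lintegral_mono_set (Ioc_subset_Ioc (htI 0).1.le (htI N).2)
    _ = _ := by
        rw [totalKernel, ← lintegral_const_mul' _ _ ENNReal.ofReal_ne_top]
        refine lintegral_congr fun r => ?_
        rw [ENNReal.ofReal_mul (by positivity)]

/-! ### The cut-off functions -/

section Cutoffs

variable {r r' : ℕ → EuclideanSpace ℝ (Fin n) → ℝ}

namespace IsRingCutoffs

theorem summable (h : IsRingCutoffs Q B r r') (x u : EuclideanSpace ℝ (Fin n)) :
    Summable fun j => r' j x * r j u :=
  (h.hasSum_one u).summable.of_nonneg_of_le (fun j => mul_nonneg (h.mem_Icc' j x).1 (h.nonneg j u))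
    fun j => mul_le_of_le_one_left (h.nonneg j u) (h.mem_Icc' j x).2

theorem hasSum_one_sub_eta (h : IsRingCutoffs Q B r r') (x u : EuclideanSpace ℝ (Fin n)) :
    HasSum (fun j => (1 - r' j x) * r j u) (1 - eta r r' x u) := by
  simp_rw [sub_mul, one_mul]
  exact (h.hasSum_one u).sub (h.summable x u).hasSum

theorem one_sub_eta_nonneg (h : IsRingCutoffs Q B r r') (x u : EuclideanSpace ℝ (Fin n)) :
    0 ≤ 1 - eta r r' x u :=
  (h.hasSum_one_sub_eta x u).nonneg fun j =>
    mul_nonneg (sub_nonneg.2 (h.mem_Icc' j x).2) (h.nonneg j u)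

theorem one_sub_eta_le (h : IsRingCutoffs Q B r r') (x u : EuclideanSpace ℝ (Fin n)) :
    1 - eta r r' x u ≤ 1 := by
  have : 0 ≤ eta r r' x u :=
    tsum_nonneg fun j => mul_nonneg (h.mem_Icc' j x).1 (h.nonneg j u)
  linarith

theorem measurable_eta (h : IsRingCutoffs Q B r r') (x : EuclideanSpace ℝ (Fin n)) :
    Measurable fun u => eta r r' x u := by
  refine measurable_of_tendsto_metrizable (f := fun (N : ℕ) u =>
    ∑ j ∈ Finset.range N, r' j x * r j u) (fun N => ?_) ?_
  · exact Finset.measurable_fun_sum _ fun j _ => (h.smooth j).continuous.measurable.const_mul _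
  · exact tendsto_pi_nhds.2 fun u => (h.summable x u).hasSum.tendsto_sum_nat

/-- On the support of `1 - η` the levels of the two points differ by at least one. -/
theorem one_le_abs_R_sub (h : IsRingCutoffs Q B r r') (hR : ∀ x, 0 ≤ R Q B x)
    {x u : EuclideanSpace ℝ (Fin n)} (hne : 1 - eta r r' x u ≠ 0) :
    1 ≤ |R Q B x - R Q B u| := by
  by_contra hlt
  push Not at hlt
  rw [abs_lt] at hlt
  refine hne ((h.hasSum_one_sub_eta x u).unique ?_)
  have hzero : ∀ j, (1 - r' j x) * r j u = 0 := by
    intro j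
    rcases eq_or_ne (r j u) 0 with h0 | h0
    · rw [h0, mul_zero]
    have hu : (j : ℝ) ≤ R Q B u ∧ R Q B u ≤ (j : ℝ) + 2 := by
      rcases h.tsupport_subset j (subset_tsupport _ h0) with hu | hu
      · obtain ⟨-, h1, h2⟩ := hu
        rw [Int.cast_natCast] at h1 h2
        exact ⟨h1, by linarith⟩
      · obtain ⟨-, h1, h2⟩ := hu
        push_cast at h1 h2
        exact ⟨by linarith, by linarith⟩
    have hone : r' j x = 1 := by
      refine h.eq_one' j ⌊R Q B x⌋ ⟨?_, ?_⟩ x ⟨Int.floor_nonneg.2 (hR x), Int.floor_le _,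
        (Int.lt_floor_add_one _).le⟩
      · rw [Int.le_floor]
        push_cast
        linarith
      · rw [← Int.lt_add_one_iff, Int.floor_lt]
        push_cast
        linarith
    rw [hone, sub_self, zero_mul]
  simp_rw [hzero]
  exact hasSum_zero

end IsRingCutoffs

end Cutoffs

/-! ### The variation of the global part -/

/-- The `ℓ^p` norm is at most the `ℓ¹` norm. -/
theorem rpow_sum_rpow_le_sum {ι : Type*} (s : Finset ι) (a : ι → ℝ≥0∞) {p : ℝ} (hp : 1 ≤ p) :
    (∑ i ∈ s, a i ^ p) ^ (1 / p) ≤ ∑ i ∈ s, a i := by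
  classical
  have hp0 : 0 < p := one_pos.trans_le hp
  rw [one_div, ENNReal.rpow_inv_le_iff hp0]
  induction s using Finset.induction_on with
  | empty => simp
  | insert i s hi ih =>
    rw [Finset.sum_insert hi, Finset.sum_insert hi]
    exact (add_le_add le_rfl ih).trans (ENNReal.add_rpow_le_rpow_add _ _ hp)

theorem continuous_mehlerKernel (t : ℝ) (x : EuclideanSpace ℝ (Fin n)) :
    Continuous fun u => mehlerKernel Q B t x u := by
  unfold mehlerKernel
  have := (continuous_quadForm ((covMatrix Q B t)⁻¹ - (covMatrixInfty Q B)⁻¹)).comp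
    (continuous_id.sub (continuous_const (y := Matrix.toEuclideanLin (flow Q B t) x)))
  exact continuous_const.mul (Real.continuous_exp.comp (continuous_const.mul this))

theorem IsRingCutoffs.integrable_globalPart {r r' : ℕ → EuclideanSpace ℝ (Fin n) → ℝ}
    (h : IsRingCutoffs Q B r r') (hQ : Q.PosDef)
    (hB : ∀ z ∈ spectrum ℂ (B.map (algebraMap ℝ ℂ)), z.re < 0)
    {f : EuclideanSpace ℝ (Fin n) → ℝ} {μ : Measure (EuclideanSpace ℝ (Fin n))}
    (hf : Integrable f μ) {t : ℝ} (ht : t ∈ Ioc (0 : ℝ) 1) (x : EuclideanSpace ℝ (Fin n)) :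
    Integrable (fun u => mehlerKernel Q B t x u * (1 - eta r r' x u) * f u) μ := by
  obtain ⟨a, A, ha, hA, hle⟩ := exists_mehlerKernel_le hQ hB
  refine hf.bdd_mul (c := A * Real.exp (R Q B x) * ((Real.sqrt t ^ n)⁻¹ * 1)) ?_ ?_
  · exact ((continuous_mehlerKernel t x).measurable.mul
      (measurable_const.sub (h.measurable_eta x))).aestronglyMeasurable
  · refine Filter.Eventually.of_forall fun u => ?_
    have hK := mehlerKernel_nonneg hQ hB ht.1 x u
    have ht0 := ht.1
    rw [Real.norm_of_nonneg (mul_nonneg hK (h.one_sub_eta_nonneg x u))]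
    refine (mul_le_of_le_one_right hK (h.one_sub_eta_le x u)).trans ((hle t ht x u).trans ?_)
    have hexp : Real.exp (-a * (‖u - Matrix.toEuclideanLin (flow Q B t) x‖ ^ 2 / t)) ≤ 1 :=
      Real.exp_le_one_iff.2 (by rw [neg_mul]; exact neg_nonpos.2 (by positivity))
    gcongr

/-- The variation of `𝓗_t^glob f(x)` in time is controlled by the positive operator whose kernel is
the time integral of the bound for `∂_t K_t`, restricted to pairs of points with levels at least
one apart. -/
theorem exists_variation_globalPart_le (hQ : Q.PosDef)
    (hB : ∀ z ∈ spectrum ℂ (B.map (algebraMap ℝ ℂ)), z.re < 0) (hR : ∀ x, 0 ≤ R Q B x) :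
    ∃ a A : ℝ, 0 < a ∧ 0 < A ∧ ∀ r r', IsRingCutoffs Q B r r' →
      ∀ f : EuclideanSpace ℝ (Fin n) → ℝ, Integrable f (gammaInfty Q B) →
      ∀ ϱ : ℝ, 1 ≤ ϱ → ∀ x,
        variation ϱ (Ioc 0 1) (fun t => globalPart Q B r r' t f x) ≤
          ENNReal.ofReal (A * Real.exp (R Q B x)) *
            ∫⁻ u, globalKernel (R Q B) (flowCLM Q B) n a x u * ‖f u‖ₑ ∂(gammaInfty Q B) := by
  obtain ⟨a, A, ha, hA, hle⟩ := exists_sum_abs_mehlerKernel_sub_le hQ hB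
  refine ⟨a, A, ha, hA, fun r r' h f hf ϱ hϱ x => iSup_le ?_⟩
  rintro ⟨N, t, ht, htI⟩
  refine (rpow_sum_rpow_le_sum _ _ hϱ).trans ?_
  have hmeas : ∀ i, AEMeasurable (fun u => ENNReal.ofReal
      |mehlerKernel Q B (t (i + 1)) x u - mehlerKernel Q B (t i) x u| *
        (ENNReal.ofReal (1 - eta r r' x u) * ‖f u‖ₑ)) (gammaInfty Q B) := fun i =>
    (((continuous_mehlerKernel _ x).sub
      (continuous_mehlerKernel _ x)).abs.measurable.ennreal_ofReal.aemeasurable).mul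
      ((measurable_const.sub (h.measurable_eta x)).ennreal_ofReal.aemeasurable.mul
        hf.aestronglyMeasurable.enorm)
  calc ∑ i ∈ Finset.range N, ENNReal.ofReal
        |globalPart Q B r r' (t (i + 1)) f x - globalPart Q B r r' (t i) f x|
      ≤ ∑ i ∈ Finset.range N, ∫⁻ u, ENNReal.ofReal
        |mehlerKernel Q B (t (i + 1)) x u - mehlerKernel Q B (t i) x u| *
          (ENNReal.ofReal (1 - eta r r' x u) * ‖f u‖ₑ) ∂(gammaInfty Q B) := by
        refine Finset.sum_le_sum fun i _ => ?_
        unfold globalPart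
        rw [← integral_sub (h.integrable_globalPart hQ hB hf (htI _) x)
          (h.integrable_globalPart hQ hB hf (htI _) x), ← Real.norm_eq_abs, ofReal_norm]
        refine (enorm_integral_le_lintegral_enorm _).trans (lintegral_mono fun u => le_of_eq ?_)
        rw [← sub_mul, ← sub_mul, enorm_mul, enorm_mul, Real.enorm_eq_ofReal_abs,
          Real.enorm_of_nonneg (h.one_sub_eta_nonneg x u), mul_assoc]
    _ = ∫⁻ u, (∑ i ∈ Finset.range N, ENNReal.ofReal
        |mehlerKernel Q B (t (i + 1)) x u - mehlerKernel Q B (t i) x u|) *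
          (ENNReal.ofReal (1 - eta r r' x u) * ‖f u‖ₑ) ∂(gammaInfty Q B) := by
        simp_rw [Finset.sum_mul]
        rw [lintegral_finsetSum' _ fun i _ => hmeas i]
    _ ≤ ∫⁻ u, ENNReal.ofReal (A * Real.exp (R Q B x)) *
          (globalKernel (R Q B) (flowCLM Q B) n a x u * ‖f u‖ₑ) ∂(gammaInfty Q B) := by
        refine lintegral_mono fun u => ?_
        rw [← mul_assoc, ← mul_assoc]
        refine mul_le_mul' ?_ le_rfl
        rcases eq_or_ne (1 - eta r r' x u) (0 : ℝ) with h0 | h0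
        · simp [h0]
        have hsep : globalKernel (R Q B) (flowCLM Q B) n a x u =
            totalKernel (flowCLM Q B) n a x u :=
          indicator_of_mem (s := {p : EuclideanSpace ℝ (Fin n) × EuclideanSpace ℝ (Fin n) |
            1 ≤ |R Q B p.1 - R Q B p.2|}) (h.one_le_abs_R_sub hR h0) _
        rw [hsep]
        refine le_trans ?_ (hle t ht htI N x u)
        exact mul_le_of_le_one_right' (ENNReal.ofReal_le_one.2 (h.one_sub_eta_le x u))
    _ = _ := lintegral_const_mul' _ _ ENNReal.ofReal_ne_top

theorem gammaInfty_eq (Q B : Matrix (Fin n) (Fin n) ℝ)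
    (hc : 0 ≤ (2 * Real.pi) ^ (-(n : ℝ) / 2) * (covMatrixInfty Q B).det ^ (-(1 : ℝ) / 2)) :
    gammaInfty Q B = ENNReal.ofReal
      ((2 * Real.pi) ^ (-(n : ℝ) / 2) * (covMatrixInfty Q B).det ^ (-(1 : ℝ) / 2)) •
        volume.withDensity fun x => ENNReal.ofReal (Real.exp (-R Q B x)) := by
  rw [← withDensity_smul' _ _ ENNReal.ofReal_ne_top, gammaInfty]
  congr 1
  ext x
  rw [Pi.smul_apply, smul_eq_mul, ← ENNReal.ofReal_mul hc, R, neg_mul]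

theorem IsExpandingFlow.lintegral_globalKernel_withDensity_enorm {E : Type*} [NormedAddCommGroup E]
    [NormedSpace ℝ E] [MeasurableSpace E] [BorelSpace E] [SecondCountableTopology E] {R : E → ℝ}
    {D : ℝ → E →L[ℝ] E} {T c C : ℝ} (h : IsExpandingFlow R D T c C) (n : ℕ) (a : ℝ) (x : E)
    {μ : Measure E} {f : E → ℝ} (hf : AEStronglyMeasurable f μ) :
    ∫⁻ u, globalKernel R D n a x u ∂(μ.withDensity fun u => ‖f u‖ₑ) =
      ∫⁻ u, globalKernel R D n a x u * ‖f u‖ₑ ∂μ := by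
  have hm : Measurable fun u => globalKernel R D n a x u :=
    (h.measurable_globalKernel n a).comp measurable_prodMk_left
  rw [lintegral_withDensity_eq_lintegral_mul₀ hf.enorm hm.aemeasurable]
  exact lintegral_congr fun u => mul_comm _ _

end OrnsteinUhlenbeck

open OrnsteinUhlenbeck in
theorem theorem6p1 {n : ℕ} (hn : 1 ≤ n)
    (Q B : Matrix (Fin n) (Fin n) ℝ) (hQ : Q.PosDef)
    (hB : ∀ z ∈ spectrum ℂ (B.map (algebraMap ℝ ℂ)), z.re < 0) :
    ∃ C : ℝ, 0 < C ∧
      ∀ r r' : ℕ → EuclideanSpace ℝ (Fin n) → ℝ, OrnsteinUhlenbeck.IsRingCutoffs Q B r r' →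
      ∀ f : EuclideanSpace ℝ (Fin n) → ℝ, Integrable f (OrnsteinUhlenbeck.gammaInfty Q B) →
        (∀ t ∈ Ioc (0 : ℝ) 1, ∀ x, Integrable
          (fun u => OrnsteinUhlenbeck.mehlerKernel Q B t x u *
            (1 - OrnsteinUhlenbeck.eta r r' x u) * f u) (OrnsteinUhlenbeck.gammaInfty Q B)) ∧
        ∀ ϱ : ℝ, 1 ≤ ϱ → ∀ α : ℝ, 0 < α →
          OrnsteinUhlenbeck.gammaInfty Q B
            {x | ENNReal.ofReal α < OrnsteinUhlenbeck.variation ϱ (Ioc 0 1)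
              (fun t => OrnsteinUhlenbeck.globalPart Q B r r' t f x)} ≤
            ENNReal.ofReal (C / α * ∫ u, |f u| ∂(OrnsteinUhlenbeck.gammaInfty Q B)) := by
  obtain ⟨T, c, C, hflow⟩ := exists_isExpandingFlow hQ hB
  change IsExpandingFlow (R Q B) (flowCLM Q B) T c C at hflow
  obtain ⟨a, A, ha, hA, hvar⟩ := exists_variation_globalPart_le hQ hB hflow.R_nonneg
  obtain ⟨d, rfl⟩ : ∃ d, n = d + 1 := ⟨n - 1, by omega⟩
  obtain ⟨A₁, hA₁, hweak⟩ := hflow.exists_weak_type volume (d := d) finrank_euclideanSpace_fin ha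
  set c₀ : ℝ := (2 * Real.pi) ^ (-((d + 1 : ℕ) : ℝ) / 2) *
    (covMatrixInfty Q B).det ^ (-(1 : ℝ) / 2) with hc₀
  have hc₀pos : 0 < c₀ := by
    have := (posDef_covMatrixInfty hQ hB).det_pos
    positivity
  have hγ := gammaInfty_eq Q B hc₀pos.le
  rw [← hc₀] at hγ
  refine ⟨c₀ * (A₁ * A), by positivity, fun r r' h f hf =>
    ⟨fun t ht x => h.integrable_globalPart hQ hB hf ht x, fun ϱ hϱ α hα => ?_⟩⟩
  set ν := (gammaInfty Q B).withDensity fun u => ‖f u‖ₑ with hν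
  have hνuniv : ν univ = ENNReal.ofReal (∫ u, |f u| ∂(gammaInfty Q B)) := by
    rw [hν, withDensity_apply _ MeasurableSet.univ, Measure.restrict_univ]
    exact (ofReal_integral_norm_eq_lintegral_enorm hf).symm
  have : IsFiniteMeasure ν := ⟨by rw [hνuniv]; exact ENNReal.ofReal_lt_top⟩
  have hsub : {x | ENNReal.ofReal α < variation ϱ (Ioc 0 1)
      (fun t => globalPart Q B r r' t f x)} ⊆
      {x | ENNReal.ofReal (α / A) < ENNReal.ofReal (Real.exp (R Q B x)) *
        ∫⁻ u, globalKernel (R Q B) (flowCLM Q B) (d + 1) a x u ∂ν} := by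
    intro x hx
    have hx' := lt_of_lt_of_le hx (hvar r r' h f hf ϱ hϱ x)
    have hν' := hflow.lintegral_globalKernel_withDensity_enorm (d + 1) a x hf.aestronglyMeasurable
    rw [← hν] at hν'
    rw [mem_ofPred_eq, hν', ENNReal.ofReal_div_of_pos hA]
    refine ENNReal.div_lt_of_lt_mul' ?_
    rwa [ENNReal.ofReal_mul hA.le, mul_assoc] at hx'
  calc gammaInfty Q B _ ≤ gammaInfty Q B {x | ENNReal.ofReal (α / A) <
        ENNReal.ofReal (Real.exp (R Q B x)) *
          ∫⁻ u, globalKernel (R Q B) (flowCLM Q B) (d + 1) a x u ∂ν} := measure_mono hsub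
    _ ≤ ENNReal.ofReal c₀ * (ENNReal.ofReal (A₁ / (α / A)) * ν univ) := by
        rw [hγ, Measure.smul_apply, smul_eq_mul]
        gcongr
        exact hweak ν (α / A) (by positivity)
    _ = _ := by
        rw [hνuniv, ← ENNReal.ofReal_mul (by positivity), ← ENNReal.ofReal_mul hc₀pos.le]
        congr 1
        field_simp

end
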